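/- Let $X$ be a finite-dimensional real vector space. Fix a Lebesgue measure on $X$ and identify the dual $X^*$ with $X$ by means of an (arbitrary, auxiliary) Euclidean structure. Let $\mathscr B(X)$ be the algebra of bounded operators on $L^2(X)$, $\mathscr K(X)$ the ideal of compact operators, $(U_xf)(y)=f(x+y)$, $V_k$ the operator of multiplication by the character $k\in X^*$, $\varphi(Q)$ the operator of multiplication by $\varphi$, and $\psi(P)=\mathcal F^{*}M_\psi\mathcal F$, where $\mathcal F$ is the Fourier transform. Let $\mathscr C(X)$ be the set of $T\in\mathscr B(X)$ such that $\lim_{k\to0}\|[T,V_k]\|=0$ and $\lim_{x\to0}\|(U_x-1)T\|=\lim_{x\to 0}\|(U_x-1)T^*\|=0$, and let $\mathscr C_s(X)$ be $\mathscr C(X)$ with the topology defined by the seminorms $T\mapsto\|T\theta(Q)\|+\|\theta(Q)T\|$, $\theta\in C_0(X)$. For a subspace $Z\subset X$ regard $C_0(X/Z)$ as a space of functions on $X$ (by composition with $X\to X/Z$). Let $\mathcal G(X)$ be the norm closure of $\sum_{Z}C_0(X/Z)$, the sum running over all subspaces $Z$ of $X$, and, for a subspace $Y$, let $\mathcal G(X/Y)$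 be the norm closure of $\sum_{Z\supset Y}C_0(X/Z)$. For $\mathcal A=\mathcal G(X)$ or $\mathcal G(X/Y)$ let $\mathcal A\rtimes X$ be the norm closed linear span of the operators $\varphi(Q)\psi(P)$ with $\varphi\in\mathcal A$, $\psi\in C_0(X^*)$. Put $\mathscr G(X)=\mathcal G(X)\rtimes X$ and $\mathscr G_Y(X)=\mathcal G(X/Y)\rtimes X$. The Grassmann filter of a finite-dimensional real vector space $V$ is the filter generated by the sets $V\setminus(L+\Lambda)$, where $L$ is a finite union of strict subspaces of $V$ and $\Lambda\subset V$ is compact; for a subspace $Y\subset X$ let $\mathfrak g_Y$ be the filter on $X$ generated by the Grassmann filter of $Y$. Let $\mathbb P(X)$ be the set of one-dimensional subspaces of $X$. A morphism is a $*$-homomorphism. Then $\mathscr G(X)$ and the $\mathscr G_Y(X)\subset\mathscr G(X)$ are $C^*$-algebras, and: 1. For each $T\in\mathscr G(X)$ and each subspace $Y\subset X$ the limit $\tau_YT=\lim_{y\to\mathfrak g_Y}U_yTU_y^*$ exists in $\mathscr C_s(X)$ and belongs to $\mathscr G_Y(X)$. 2. For each $Y$ the map $\tau_Y$ is a morphism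 and a linear projection of $\mathscr G(X)$ onto $\mathscr G_Y(X)$, and it is the only morphism which is a linear projection of $\mathscr G(X)$ onto $\mathscr G_Y(X)$. 3. $\tau_Y\tau_Z=\tau_Z\tau_Y=\tau_{Y+Z}$ for all subspaces $Y,Z\subset X$. 4. If $Y\in\mathbb P(X)$ and $y\in Y$, $y\ne0$, then $\tau_YT=\lim_{t\to+\infty}U_{ty}TU_{ty}^*$ in $\mathscr C_s(X)$ for each $T\in\mathscr G(X)$. 5. An operator $T\in\mathscr G(X)$ is compact if and only if $\tau_YT=0$ for all $Y\in\mathbb P(X)$. Moreover $\mathscr K(X)\subset\mathscr G(X)$, and $T\mapsto(\tau_YT)_{Y\in\mathbb P(X)}$ induces an isometric embedding of $C^*$-algebras $$\mathscr G(X)/\mathscr K(X)\hookrightarrow\prod_{Y\in\mathbb P(X)}\mathscr G_Y(X),$$ where the product is the $C^*$-algebra of bounded families. -/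

import Mathlib

open MeasureTheory Filter Topology
open scoped ENNReal FourierTransform InnerProductSpace BoundedContinuousFunction
  ZeroAtInfty Pointwise

noncomputable section

namespace QuantumGrassmann

/-! ### Operators on `L²(X)`

`X` is a finite dimensional real vector space. A Euclidean structure on `X` is fixed as an auxiliary
datum: it fixes the Lebesgue measure and it identifies the dual space `X*` with `X`, a vector `ξ`
being the character `y ↦ exp (2 π i ⟪y, ξ⟫)`. -/

section Operators

variable (X : Type*) [NormedAddCommGroup X] [InnerProductSpace ℝ X] [FiniteDimensional ℝ X]
  [MeasurableSpace X] [BorelSpace X]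

/-- The Hilbert space `L²(X)`. -/
abbrev L2 : Type _ := Lp (α := X) ℂ 2 (volume : Measure X)

/-- The algebra `𝓑(X)` of all bounded operators on `L²(X)`. -/
abbrev BddOp : Type _ := L2 X →L[ℂ] L2 X

variable {X}

/-- The operator `φ(Q)` of multiplication by a bounded continuous function `φ`. -/
def mulOp (φ : X →ᵇ ℂ) : BddOp X :=
  (ContinuousLinearMap.mul ℂ ℂ).holderL (volume : Measure X) ∞ 2 2
    ((memLp_top_of_bound φ.continuous.aestronglyMeasurable ‖φ‖
      (Eventually.of_forall φ.norm_coe_le_norm)).toLp φ)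

/-- The operator `ψ(P) = 𝓕⁻¹ ψ(Q) 𝓕`, for a bounded continuous function `ψ` on `X* = X`;
here `𝓕` is the unitary Fourier transform of `L²(X)`. -/
def momentumOp (ψ : X →ᵇ ℂ) : BddOp X :=
  ((Lp.fourierTransformₗᵢ X ℂ).symm.toContinuousLinearEquiv : L2 X →L[ℂ] L2 X) ∘L mulOp ψ ∘L
    ((Lp.fourierTransformₗᵢ X ℂ).toContinuousLinearEquiv : L2 X →L[ℂ] L2 X)

/-- The translation operator `(U_x f)(y) = f (x + y)`. -/
def transOp (x : X) : BddOp X :=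
  (Lp.compMeasurePreservingₗᵢ ℂ (fun y : X => x + y)
    (measurePreserving_add_left volume x)).toContinuousLinearMap

/-- The character `y ↦ exp (2 π i ⟪y, ξ⟫)` as a bounded continuous function. -/
def charFun (ξ : X) : X →ᵇ ℂ :=
  BoundedContinuousFunction.ofNormedAddCommGroup (fun y : X => ((𝐞 ⟪y, ξ⟫_ℝ : Circle) : ℂ))
    (by fun_prop) 1 (fun y => (Circle.norm_coe _).le)

/-- `x.T = U_x T U_x^*`. -/
def translate (x : X) (T : BddOp X) : BddOp X := transOp x * T * star (transOp x)

variable (X) in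
/-- The `C^*`-algebra `𝓒(X)` of all operators `T` such that `‖[T, V_k]‖ → 0` as `k → 0`, where `V_k`
is multiplication by the character `k`, and `‖(U_x - 1) T‖ → 0`, `‖(U_x - 1) T^*‖ → 0` as `x → 0`. -/
def hamAlgebra : Set (BddOp X) :=
  {T | Tendsto (fun k : X => ‖T * mulOp (charFun k) - mulOp (charFun k) * T‖) (𝓝 0) (𝓝 0) ∧
    Tendsto (fun x : X => ‖(transOp x - 1) * T‖) (𝓝 0) (𝓝 0) ∧
    Tendsto (fun x : X => ‖(transOp x - 1) * star T‖) (𝓝 0) (𝓝 0)}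

variable (X) in
/-- The seminorms `T ↦ ‖T θ(Q)‖ + ‖θ(Q) T‖`, with `θ ∈ C₀(X)`. -/
def csSeminorms : SeminormFamily ℂ (BddOp X) C₀(X, ℂ) := fun θ =>
  (normSeminorm ℂ (BddOp X)).comp (LinearMap.mulRight ℂ (mulOp θ.toBCF)) +
    (normSeminorm ℂ (BddOp X)).comp (LinearMap.mulLeft ℂ (mulOp θ.toBCF))

variable (X) in
/-- The space `𝓒_s(X)`: the set `𝓒(X)` with the topology defined by the seminorms `csSeminorms`. -/
abbrev csTopology : TopologicalSpace (hamAlgebra X) :=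
  (csSeminorms X).moduleFilterBasis.topology.induced Subtype.val

/-- `F` takes values in `𝓒(X)`, and `T` is in `𝓒(X)` and is a limit of `F` along the filter `l`
in the space `𝓒_s(X)`. -/
def TendstoCs {α : Type*} (F : α → BddOp X) (l : Filter α) (T : BddOp X) : Prop :=
  ∃ (hF : ∀ a, F a ∈ hamAlgebra X) (hT : T ∈ hamAlgebra X),
    Tendsto (fun a => (⟨F a, hF a⟩ : hamAlgebra X)) l (@nhds _ (csTopology X) ⟨T, hT⟩)

/-- The crossed product `𝒜 ⋊ X`: the norm closed linear span of the operators `φ(Q) ψ(P)` with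
`φ ∈ 𝒜` and `ψ ∈ C₀(X*)`. -/
def crossedProduct (𝒜 : Submodule ℂ (X →ᵇ ℂ)) : Submodule ℂ (BddOp X) :=
  (Submodule.span ℂ {T | ∃ φ ∈ 𝒜, ∃ ψ : C₀(X, ℂ),
    T = mulOp φ * momentumOp ψ.toBCF}).topologicalClosure

end Operators

/-! ### Grassmann algebras and Grassmann filters -/

section Grassmann

variable {X : Type*} [NormedAddCommGroup X] [InnerProductSpace ℝ X]

/-- The algebra `C₀(X/Y)` as a space of functions on `X`: the functions `φ ∘ π_Y` with `φ` in
`C₀(X/Y)`, where `π_Y : X → X/Y` is the canonical surjection. -/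
def quotientC0 (Y : Submodule ℝ X) : Set (X →ᵇ ℂ) :=
  {f | ∃ φ : C₀(X ⧸ Y, ℂ), ∀ x, f x = φ (Y.mkQ x)}

variable (X) in
/-- The classical Grassmann algebra `𝒢(X)`: the norm closure of `∑_Y C₀(X/Y)`, where `Y` runs over
all subspaces of `X`. -/
def grassmannAlgebra : Submodule ℂ (X →ᵇ ℂ) :=
  (Submodule.span ℂ (⋃ Y : Submodule ℝ X, quotientC0 Y)).topologicalClosure

/-- The subalgebra `𝒢(X/Y)` of `𝒢(X)`: the norm closure of `∑_Z C₀(X/Z)`, where `Z` runs over all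
subspaces of `X` which contain `Y`. -/
def grassmannAlgebraOver (Y : Submodule ℝ X) : Submodule ℂ (X →ᵇ ℂ) :=
  (Submodule.span ℂ (⋃ Z : Submodule ℝ X, ⋃ _ : Y ≤ Z, quotientC0 Z)).topologicalClosure

variable (X) in
/-- The quantum Grassmann algebra `𝓖(X) = 𝒢(X) ⋊ X`. -/
def quantumGrassmann [FiniteDimensional ℝ X] [MeasurableSpace X] [BorelSpace X] :
    Submodule ℂ (BddOp X) :=
  crossedProduct (grassmannAlgebra X)

/-- The algebra `𝓖_Y(X) = 𝒢(X/Y) ⋊ X`. -/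
def quantumGrassmannOver [FiniteDimensional ℝ X] [MeasurableSpace X] [BorelSpace X]
    (Y : Submodule ℝ X) : Submodule ℂ (BddOp X) :=
  crossedProduct (grassmannAlgebraOver Y)

variable (X) in
/-- The Grassmann filter of `X`, generated by the complements of the sets `L + Λ`, where `L` is a
finite union of strict subspaces of `X` and `Λ` is compact. -/
def grassmannFilter : Filter X :=
  Filter.generate {s | ∃ F : Finset (Submodule ℝ X), (∀ Y ∈ F, Y ≠ ⊤) ∧
    ∃ Λ : Set X, IsCompact Λ ∧ s = ((⋃ Y ∈ F, (Y : Set X)) + Λ)ᶜ}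

/-- The filter on `X` generated by the Grassmann filter of a subspace `Y`. -/
def grassmannFilterOn (Y : Submodule ℝ X) : Filter X :=
  (grassmannFilter Y).map ((↑) : Y → X)

variable (X) in
/-- The projective space of `X`: the set of all one dimensional subspaces. -/
abbrev Lines : Type _ := {Y : Submodule ℝ X // Module.finrank ℝ Y = 1}

/-- The compact operators which belong to a subalgebra of `𝓑(X)`. -/
def compactPart [FiniteDimensional ℝ X] [MeasurableSpace X] [BorelSpace X]
    (A : NonUnitalStarSubalgebra ℂ (BddOp X)) : Submodule ℂ A :=
  (compactOperator (RingHom.id ℂ) (L2 X) (L2 X)).comap A.toNonUnitalSubalgebra.toSubmodule.subtype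

end Grassmann

end QuantumGrassmann

end

open MeasureTheory Filter Topology
open scoped ENNReal FourierTransform InnerProductSpace BoundedContinuousFunction
  ZeroAtInfty Pointwise
open scoped SchwartzMap

set_option linter.unusedSectionVars false

noncomputable section

/-! Everything is decided on the generators `φ(Q) ψ(P)` with `φ ∈ C₀(X/Z)`. Conjugation by `U_y`
replaces `φ` by `φ(· + y)` and leaves `ψ(P)` alone. If `Y ≤ Z` and `y ∈ Y`, nothing changes. If `Y`
is not contained in `Z` and `y` tends to infinity modulo `Z`, the bump `φ(· + y)` leaves every
region localized by some `θ ∈ C₀(X)`, so the limit is `0`. Thus `τ_Y` keeps the components with `Y ≤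
Z` and kills the others. Conjugations are contractions, so the limit extends to the norm closure
(`exists_limit`). The Grassmann filter of `Y` and the rays of a line both escape modulo every `Z`
not containing `Y` (`IsEscaping`). A curve of moments gives a nontrivial filter of this kind, which
makes the limit unique. The projection property and `τ_Y τ_Z = τ_{Y+Z}` are then read off on
generators.

Writing `φ(Q) ψ(P)` as an integral of operators `Φ(z)(Q) U_z` serves twice. It reorders `ψ(P) φ(Q)`,
so that the crossed products are star algebras (`IsIntegralOp.mem_crossedProduct`). It also
identifies the crossed product by `C₀(X)` with the compact operators
(`mem_crossedProduct_of_isCompactOperator`, `isCompactOperator_of_mem_crossedProduct`).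

For the compactness criterion, suppose that all `τ_Y T` with `Y` a line vanish. Approximate `T` by
an `S` built from a finite family of subspaces stable under intersection. Every `τ_Y S` is small,
and a functional calculus cut-off inside that small algebra corrects `S` slightly to an `H` with
`τ_Y H = 0` exactly (`exists_norm_sub_le_of_forall_norm_le`). Since `H = H - τ_Z H`, the nonzero
subspaces `Z` of the finite family can be removed one by one (`mem_crossedProduct_bot_of_finite`),
and `H` is compact. The same cut-off shows that the quotient norm is the supremum of the `‖τ_Y T‖`.

For uniqueness, a projection `P` onto `𝓖_Y(X)` fixes every `ψ(P)`, hence is blind to conjugation by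
`U_y` with `y ∈ Y` (`map_translateElem`). If `Y` is not contained in `Z`, the sum of `N` widely
separated translates of `φ` has norm `o(N)`, up to an arbitrarily small multiple of `N`, while its
image is `N` times the image of one generator. That image is therefore `0`
(`map_generator_eq_zero`). -/

namespace QuantumGrassmann

/-! ### Translates of functions. -/

section Shift

variable {X : Type*} [NormedAddCommGroup X]

/-- The translate `φ(· + x)`. -/
def shift (x : X) (φ : X →ᵇ ℂ) : X →ᵇ ℂ :=
  φ.compContinuous ⟨fun y => x + y, by fun_prop⟩

@[simp] theorem shift_apply (x : X) (φ : X →ᵇ ℂ) (y : X) : shift x φ y = φ (x + y) := rfl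

theorem norm_shift (x : X) (φ : X →ᵇ ℂ) : ‖shift x φ‖ = ‖φ‖ := by
  refine le_antisymm ?_ ?_
  · exact (BoundedContinuousFunction.norm_le (norm_nonneg _)).2 fun y => φ.norm_coe_le_norm _
  · refine (BoundedContinuousFunction.norm_le (norm_nonneg _)).2 fun y => ?_
    simpa using (shift x φ).norm_coe_le_norm (-x + y)

end Shift

/-! ### Multiplication, momentum and translation operators. -/

section OperatorAlgebra

variable {X : Type*} [NormedAddCommGroup X] [InnerProductSpace ℝ X] [FiniteDimensional ℝ X]
  [MeasurableSpace X] [BorelSpace X]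

theorem bddOp_mul_apply (S T : BddOp X) (w : L2 X) : (S * T) w = S (T w) := rfl

theorem mulOp_ae (φ : X →ᵇ ℂ) (w : L2 X) : mulOp φ w =ᵐ[volume] fun x => φ x * w x := by
  have h := (ContinuousLinearMap.mul ℂ ℂ).coeFn_holder (r := 2)
    ((memLp_top_of_bound φ.continuous.aestronglyMeasurable ‖φ‖
      (Eventually.of_forall φ.norm_coe_le_norm)).toLp φ : Lp ℂ ∞ (volume : Measure X)) w
  refine h.trans ?_
  filter_upwards [MemLp.coeFn_toLp (memLp_top_of_bound φ.continuous.aestronglyMeasurable ‖φ‖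
      (Eventually.of_forall φ.norm_coe_le_norm) : MemLp φ ∞ (volume : Measure X))] with x hx
  simp [hx]

theorem transOp_ae (x : X) (w : L2 X) : transOp x w =ᵐ[volume] fun y => w (x + y) :=
  Lp.coeFn_compMeasurePreserving w (measurePreserving_add_left volume x)

/-- Multiplication operators as a star algebra homomorphism. -/
def mulOpHom : (X →ᵇ ℂ) →⋆ₐ[ℂ] BddOp X where
  toFun := mulOp
  map_one' := by
    ext1 w
    apply Lp.ext
    filter_upwards [mulOp_ae 1 w] with x hx
    simp [hx]
  map_mul' φ χ := by
    ext1 w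
    apply Lp.ext
    filter_upwards [mulOp_ae (φ * χ) w, mulOp_ae φ (mulOp χ w), mulOp_ae χ w] with x h1 h2 h3
    simp [h1, h2, h3, mul_assoc]
  map_zero' := by
    ext1 w
    apply Lp.ext
    filter_upwards [mulOp_ae 0 w] with x hx
    simp [hx]
  map_add' φ χ := by
    ext1 w
    apply Lp.ext
    filter_upwards [mulOp_ae (φ + χ) w, Lp.coeFn_add (mulOp φ w) (mulOp χ w), mulOp_ae φ w,
      mulOp_ae χ w] with x h1 h2 h3 h4
    refine h1.trans (Eq.trans ?_ h2.symm)
    simp [h3, h4, add_mul]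
  commutes' c := by
    ext1 w
    apply Lp.ext
    rw [Algebra.algebraMap_eq_smul_one, Algebra.algebraMap_eq_smul_one]
    filter_upwards [mulOp_ae (c • 1) w, Lp.coeFn_smul c w] with x h1 h2
    simp [h1, h2]
  map_star' φ := by
    symm
    rw [ContinuousLinearMap.star_eq_adjoint, eq_comm, ContinuousLinearMap.eq_adjoint_iff]
    intro u v
    rw [L2.inner_def, L2.inner_def]
    apply integral_congr_ae
    filter_upwards [mulOp_ae (star φ) u, mulOp_ae φ v] with x h1 h2
    simp [h1, h2]
    ring

@[simp] theorem mulOpHom_apply (φ : X →ᵇ ℂ) : mulOpHom φ = mulOp φ := rfl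

/-- The unitary Fourier transform of `L²(X)`, as a bounded operator. -/
def fourierOp : BddOp X :=
  ((Lp.fourierTransformₗᵢ X ℂ).toContinuousLinearEquiv : L2 X →L[ℂ] L2 X)

theorem star_fourierOp_eq : star (fourierOp : BddOp X) =
    ((Lp.fourierTransformₗᵢ X ℂ).symm.toContinuousLinearEquiv : L2 X →L[ℂ] L2 X) := by
  rw [ContinuousLinearMap.star_eq_adjoint, eq_comm, ContinuousLinearMap.eq_adjoint_iff]
  intro u v
  have := (Lp.fourierTransformₗᵢ X ℂ).inner_map_map ((Lp.fourierTransformₗᵢ X ℂ).symm u) v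
  simpa [fourierOp] using this.symm

theorem star_fourierOp_mul : star (fourierOp : BddOp X) * fourierOp = 1 := by
  rw [star_fourierOp_eq]
  ext1 w
  simp [fourierOp]

theorem fourierOp_mul_star : (fourierOp : BddOp X) * star fourierOp = 1 := by
  rw [star_fourierOp_eq]
  ext1 w
  simp [fourierOp]

theorem momentumOp_eq (ψ : X →ᵇ ℂ) : momentumOp ψ = star fourierOp * mulOp ψ * fourierOp := by
  rw [star_fourierOp_eq]; rfl

/-- The operators `ψ(P)` as a star algebra homomorphism. -/
def momentumOpHom : (X →ᵇ ℂ) →⋆ₐ[ℂ] BddOp X where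
  toFun := momentumOp
  map_one' := by
    rw [momentumOp_eq, ← mulOpHom_apply, map_one, mul_one, star_fourierOp_mul]
  map_mul' φ χ := by
    simp only [momentumOp_eq, ← mulOpHom_apply, map_mul]
    calc _ = star fourierOp * mulOpHom φ * 1 * mulOpHom χ * fourierOp := by noncomm_ring
      _ = _ := by rw [← fourierOp_mul_star]; noncomm_ring
  map_zero' := by
    simp [momentumOp_eq, ← mulOpHom_apply]
  map_add' φ χ := by
    simp only [momentumOp_eq, ← mulOpHom_apply, map_add]; noncomm_ring
  commutes' c := by
    rw [Algebra.algebraMap_eq_smul_one, Algebra.algebraMap_eq_smul_one]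
    simp [momentumOp_eq, ← mulOpHom_apply, star_fourierOp_mul]
  map_star' φ := by
    simp only [momentumOp_eq, ← mulOpHom_apply, map_star]
    simp [mul_assoc]

@[simp] theorem momentumOpHom_apply (φ : X →ᵇ ℂ) : momentumOpHom φ = momentumOp φ := rfl

theorem norm_mulOp_le (φ : X →ᵇ ℂ) : ‖mulOp φ‖ ≤ ‖φ‖ :=
  NonUnitalStarAlgHom.norm_apply_le (mulOpHom (X := X)) φ

theorem norm_momentumOp_le (φ : X →ᵇ ℂ) : ‖momentumOp φ‖ ≤ ‖φ‖ :=
  NonUnitalStarAlgHom.norm_apply_le (momentumOpHom (X := X)) φ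

theorem transOp_mul (x y : X) : transOp x * transOp y = transOp (x + y) := by
  ext1 w
  apply Lp.ext
  have h := (measurePreserving_add_left volume x).quasiMeasurePreserving.ae (transOp_ae y w)
  filter_upwards [transOp_ae x (transOp y w), transOp_ae (x + y) w, h] with z h1 h2 h3
  rw [bddOp_mul_apply, h1, h2, h3]
  congr 1; abel

theorem transOp_zero : transOp (0 : X) = 1 := by
  ext1 w
  apply Lp.ext
  filter_upwards [transOp_ae 0 w] with z h1
  simp [h1]

theorem norm_transOp_apply (x : X) (w : L2 X) : ‖transOp x w‖ = ‖w‖ :=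
  (Lp.compMeasurePreservingₗᵢ ℂ (fun y : X => x + y)
    (measurePreserving_add_left volume x)).norm_map w

theorem star_transOp (x : X) : star (transOp x) = transOp (-x) := by
  rw [ContinuousLinearMap.star_eq_adjoint, eq_comm, ContinuousLinearMap.eq_adjoint_iff]
  intro u v
  have := (Lp.compMeasurePreservingₗᵢ ℂ (fun y : X => x + y)
    (measurePreserving_add_left volume x)).inner_map_map (transOp (-x) u) v
  refine this.symm.trans ?_
  change inner ℂ ((transOp x * transOp (-x)) u) (transOp x v) = _
  rw [transOp_mul, add_neg_cancel, transOp_zero]; rfl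

theorem norm_transOp_le (x : X) : ‖transOp x‖ ≤ 1 :=
  ContinuousLinearMap.opNorm_le_bound _ zero_le_one fun w => by rw [norm_transOp_apply, one_mul]

theorem continuous_transOp_apply (w : L2 X) : Continuous fun x : X => transOp x w := by
  let g : C(X, C(X, X)) := ContinuousMap.curry ⟨fun p : X × X => p.1 + p.2, by fun_prop⟩
  exact Continuous.compMeasurePreservingLp (f := fun _ : X => w) (g := g) continuous_const
    g.continuous (fun x => measurePreserving_add_left volume x) (by simp)

theorem transOp_mul_mulOp (x : X) (φ : X →ᵇ ℂ) :
    transOp x * mulOp φ = mulOp (shift x φ) * transOp x := by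
  ext1 w
  apply Lp.ext
  have h := (measurePreserving_add_left volume x).quasiMeasurePreserving.ae (mulOp_ae φ w)
  filter_upwards [transOp_ae x (mulOp φ w), mulOp_ae (shift x φ) (transOp x w), transOp_ae x w, h]
    with z h1 h2 h3 h4
  rw [bddOp_mul_apply, bddOp_mul_apply, h1, h2, h3, h4,
    shift_apply]

/-- Schwartz functions are dense in `L²`, and on them this is the usual rule that the Fourier
transform turns a translation into multiplication by a character. -/
theorem fourierOp_mul_transOp (x : X) : fourierOp * transOp x = mulOp (charFun x) * fourierOp := by
  apply ContinuousLinearMap.coeFn_injective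
  refine (SchwartzMap.denseRange_toLpCLM (E := X) (F := ℂ) (p := 2) (μ := volume)
    ENNReal.ofNat_ne_top).equalizer
    (ContinuousLinearMap.continuous _) (ContinuousLinearMap.continuous _) ?_
  funext f
  set g : 𝓢(X, ℂ) := f.compSubConstCLM ℂ (-x)
  have h1 : transOp x (f.toLp 2) = g.toLp 2 := by
    apply Lp.ext
    have h := (measurePreserving_add_left volume x).quasiMeasurePreserving.ae
      (f.coeFn_toLp 2 (volume : Measure X))
    filter_upwards [transOp_ae x (f.toLp 2), g.coeFn_toLp 2, h] with z h1 h2 h3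
    rw [h1, h2, h3, SchwartzMap.compSubConstCLM_apply, sub_neg_eq_add, add_comm]
  have h2 (h : 𝓢(X, ℂ)) : fourierOp (h.toLp 2) = (𝓕 h).toLp 2 := SchwartzMap.toLp_fourier_eq h
  have h3 (ξ : X) : 𝓕 g ξ = charFun x ξ * 𝓕 f ξ := by
    have := congrFun (VectorFourier.fourierIntegral_comp_add_right 𝐞 volume (innerₗ X) f x) ξ
    rw [innerₗ_apply_apply, Circle.smul_def, smul_eq_mul, real_inner_comm] at this
    refine Eq.trans ?_ this
    rw [SchwartzMap.fourier_coe]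
    refine congrFun (congrArg _ ?_) ξ
    funext y
    simp [g]
  change fourierOp (transOp x (f.toLp 2)) = mulOp (charFun x) (fourierOp (f.toLp 2))
  rw [h1, h2, h2]
  apply Lp.ext
  filter_upwards [mulOp_ae (charFun x) ((𝓕 f).toLp 2), (𝓕 f).coeFn_toLp 2 (volume : Measure X),
    (𝓕 g).coeFn_toLp 2 (volume : Measure X)] with ξ e1 e2 e3
  rw [e1, e2, e3, h3]

/-- This puts `U_x` among the functions of `P`, so it commutes with every `ψ(P)`. Conjugation by
`U_x` therefore acts only on the factor `φ(Q)` of a generator. -/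
theorem transOp_eq_momentumOp (x : X) : transOp x = momentumOp (charFun x) := by
  rw [momentumOp_eq, mul_assoc, ← fourierOp_mul_transOp, ← mul_assoc, star_fourierOp_mul, one_mul]

theorem transOp_mul_momentumOp (x : X) (ψ : X →ᵇ ℂ) :
    transOp x * momentumOp ψ = momentumOp ψ * transOp x := by
  simp only [transOp_eq_momentumOp, ← momentumOpHom_apply, ← map_mul, mul_comm]

theorem translate_mul (x : X) (S T : BddOp X) :
    translate x (S * T) = translate x S * translate x T := by
  have h : star (transOp x) * transOp x = (1 : BddOp X) := by
    rw [star_transOp, transOp_mul, neg_add_cancel, transOp_zero]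
  calc _ = transOp x * S * 1 * T * star (transOp x) := by simp only [translate]; noncomm_ring
    _ = _ := by rw [← h]; simp only [translate]; noncomm_ring

theorem translate_mulOp (x : X) (φ : X →ᵇ ℂ) : translate x (mulOp φ) = mulOp (shift x φ) := by
  rw [translate, transOp_mul_mulOp, mul_assoc, star_transOp, transOp_mul, add_neg_cancel,
    transOp_zero, mul_one]

theorem translate_momentumOp (x : X) (ψ : X →ᵇ ℂ) :
    translate x (momentumOp ψ) = momentumOp ψ := by
  rw [translate, transOp_mul_momentumOp, mul_assoc, star_transOp, transOp_mul, add_neg_cancel,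
    transOp_zero, mul_one]

theorem translate_add (x : X) (S T : BddOp X) :
    translate x (S + T) = translate x S + translate x T := by
  simp only [translate]; noncomm_ring

theorem translate_smul (x : X) (c : ℂ) (T : BddOp X) :
    translate x (c • T) = c • translate x T := by
  simp [translate]

theorem translate_star (x : X) (T : BddOp X) : translate x (star T) = star (translate x T) := by
  simp [translate, mul_assoc]

theorem norm_translate_le (x : X) (T : BddOp X) : ‖translate x T‖ ≤ ‖T‖ := by
  have h := norm_transOp_le x
  calc _ ≤ ‖transOp x‖ * ‖T‖ * ‖star (transOp x)‖ :=
        (norm_mul_le _ _).trans (mul_le_mul_of_nonneg_right (norm_mul_le _ _) (norm_nonneg _))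
    _ ≤ 1 * ‖T‖ * 1 := by rw [star_transOp]; gcongr; exact norm_transOp_le _
    _ = _ := by ring

end OperatorAlgebra

/-! ### The function spaces `C₀(X/Y)` and the algebras they generate. -/

section FunctionAlgebra

/-- The map induced on the quotient by the kernel is injective and linear on a finite dimensional
space, hence bounded below. -/
theorem exists_norm_mkQ_ker_le {V W : Type*} [NormedAddCommGroup V] [NormedSpace ℝ V]
    [FiniteDimensional ℝ V] [NormedAddCommGroup W] [NormedSpace ℝ W] (f : V →ₗ[ℝ] W) :
    ∃ C : ℝ, 0 ≤ C ∧ ∀ v, ‖(LinearMap.ker f).mkQ v‖ ≤ C * ‖f v‖ := by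
  have : IsClosed (LinearMap.ker f : Set V) := Submodule.closed_of_finiteDimensional _
  obtain ⟨K, hK, h⟩ := LinearMap.exists_antilipschitzWith ((LinearMap.ker f).liftQ f le_rfl)
    (Submodule.ker_liftQ_eq_bot' _ _ rfl)
  refine ⟨K, K.2, fun v => ?_⟩
  simpa using ZeroHomClass.bound_of_antilipschitz _ h ((LinearMap.ker f).mkQ v)

variable {X : Type*} [NormedAddCommGroup X] [InnerProductSpace ℝ X] [FiniteDimensional ℝ X]

instance isClosed_submodule (Y : Submodule ℝ X) : IsClosed (Y : Set X) :=
  Submodule.closed_of_finiteDimensional _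

theorem exists_norm_mkQ_inf_le (Y Z : Submodule ℝ X) :
    ∃ C : ℝ, 0 ≤ C ∧ ∀ x, ‖(Y ⊓ Z).mkQ x‖ ≤ C * max ‖Y.mkQ x‖ ‖Z.mkQ x‖ := by
  obtain ⟨C, hC, h⟩ := exists_norm_mkQ_ker_le (Y.mkQ.prod Z.mkQ)
  rw [LinearMap.ker_prod, Submodule.ker_mkQ, Submodule.ker_mkQ] at h
  exact ⟨C, hC, fun x => h x⟩

theorem exists_mem_add_of_norm_mkQ_lt {V : Type*} [SeminormedAddCommGroup V] [NormedSpace ℝ V]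
    (Y : Submodule ℝ V) {x : V} {R : ℝ}
    (h : ‖Y.mkQ x‖ < R) : ∃ y ∈ Y, ∃ z, ‖z‖ < R ∧ y + z = x := by
  obtain ⟨z, hz, hzR⟩ := QuotientAddGroup.norm_lt_iff.1 h
  refine ⟨x - z, ?_, z, hzR, sub_add_cancel _ _⟩
  rw [← Submodule.Quotient.mk_eq_zero Y, Submodule.Quotient.mk_sub, sub_eq_zero]
  exact hz.symm

theorem norm_mkQ_bot {V : Type*} [SeminormedAddCommGroup V] [NormedSpace ℝ V] (x : V) :
    ‖(⊥ : Submodule ℝ V).mkQ x‖ = ‖x‖ := by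
  refine le_antisymm (Submodule.Quotient.norm_mk_le _ x) (le_of_forall_pos_lt_add fun δ hδ => ?_)
  obtain ⟨y, hy, z, hz, h⟩ := exists_mem_add_of_norm_mkQ_lt (⊥ : Submodule ℝ V) (x := x)
    (lt_add_of_pos_right _ hδ)
  rw [(Submodule.mem_bot ℝ).1 hy, zero_add] at h
  rwa [h] at hz

/-- Periodicity along `Y` together with decay in the quotient norm. This form stays on `X` and is
what all later estimates use. -/
theorem mem_quotientC0_iff {Y : Submodule ℝ X} {f : X →ᵇ ℂ} :
    f ∈ quotientC0 Y ↔ (∀ x, ∀ y ∈ Y, f (x + y) = f x) ∧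
      ∀ ε > 0, ∃ R : ℝ, ∀ x, R < ‖Y.mkQ x‖ → ‖f x‖ < ε := by
  constructor
  · rintro ⟨φ, hφ⟩
    refine ⟨fun x y hy => ?_, fun ε hε => ?_⟩
    · rw [hφ, hφ, map_add, Submodule.mkQ_apply Y y, (Submodule.Quotient.mk_eq_zero Y).2 hy, add_zero]
    · have h := (φ.zero_at_infty'.mono_left (Metric.cobounded_le_cocompact (α := X ⧸ Y))).eventually
        (Metric.ball_mem_nhds 0 hε)
      rw [← comap_norm_atTop, eventually_comap] at h
      obtain ⟨R, hR⟩ := eventually_atTop.1 h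
      refine ⟨R, fun x hx => ?_⟩
      rw [hφ]
      simpa using hR _ hx.le (Y.mkQ x) rfl
  · rintro ⟨hp, hd⟩
    have hp' : ∀ x y : X, Y.quotientRel x y → f x = f y := by
      intro x y hxy
      rw [Submodule.quotientRel_def] at hxy
      simpa using hp y _ hxy
    refine ⟨⟨⟨fun q => Quotient.lift f hp' q, ?_⟩, ?_⟩, fun x => rfl⟩
    · exact Continuous.quotient_lift f.continuous hp'
    · rw [Metric.tendsto_nhds]
      intro ε hε
      obtain ⟨R, hR⟩ := hd ε hε
      -- The quotient norm is an infimum over representatives, so a class of norm at most `R` is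
      -- only known to have a representative of norm below `R + 1`.
      have : IsCompact (Y.mkQ '' Metric.closedBall 0 (R + 1)) :=
        (isCompact_closedBall _ _).image (Y.mkQL).continuous
      filter_upwards [this.compl_mem_cocompact] with q hq
      obtain ⟨x, rfl⟩ := Y.mkQ_surjective q
      change dist (f x) 0 < ε
      rw [dist_zero_right]
      refine hR x (lt_of_not_ge fun hle => hq ?_)
      obtain ⟨y, hy, z, hz, rfl⟩ := exists_mem_add_of_norm_mkQ_lt Y (hle.trans_lt (lt_add_one R))
      refine ⟨z, by simpa using hz.le, ?_⟩
      rw [map_add, Submodule.mkQ_apply Y y, (Submodule.Quotient.mk_eq_zero Y).2 hy, zero_add]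

/-- A point far away modulo `Y ⊓ Z` is far away modulo `Y` or modulo `Z`, so one of the two factors
is small there. This is why the sum of the `C₀(X/Z)` is an algebra graded by intersection. -/
theorem mul_mem_quotientC0 {Y Z : Submodule ℝ X} {f g : X →ᵇ ℂ} (hf : f ∈ quotientC0 Y)
    (hg : g ∈ quotientC0 Z) : f * g ∈ quotientC0 (Y ⊓ Z) := by
  rw [mem_quotientC0_iff] at *
  refine ⟨fun x y hy => ?_, fun ε hε => ?_⟩
  · simp [hf.1 x y hy.1, hg.1 x y hy.2]
  · obtain ⟨R, hR⟩ := hf.2 (ε / (‖g‖ + 1)) (by positivity)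
    obtain ⟨S, hS⟩ := hg.2 (ε / (‖f‖ + 1)) (by positivity)
    obtain ⟨C, hC, h⟩ := exists_norm_mkQ_inf_le Y Z
    refine ⟨C * max R S, fun x hx => ?_⟩
    have h1 : max R S < max ‖Y.mkQ x‖ ‖Z.mkQ x‖ := lt_of_mul_lt_mul_left (hx.trans_le (h x)) hC
    have h2 : R < ‖Y.mkQ x‖ ∨ S < ‖Z.mkQ x‖ := by
      rcases lt_max_iff.1 h1 with h | h
      · exact Or.inl ((le_max_left _ _).trans_lt h)
      · exact Or.inr ((le_max_right _ _).trans_lt h)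
    rw [BoundedContinuousFunction.mul_apply, norm_mul]
    rcases h2 with h2 | h2
    · have := hR x h2
      rw [lt_div_iff₀ (by positivity)] at this
      refine lt_of_le_of_lt ?_ this
      have := g.norm_coe_le_norm x
      gcongr; linarith
    · have := hS x h2
      rw [lt_div_iff₀ (by positivity), mul_comm] at this
      refine lt_of_le_of_lt ?_ this
      have := f.norm_coe_le_norm x
      gcongr; linarith

theorem star_mem_quotientC0 {Y : Submodule ℝ X} {f : X →ᵇ ℂ} (hf : f ∈ quotientC0 Y) :
    star f ∈ quotientC0 Y := by
  rw [mem_quotientC0_iff] at *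
  refine ⟨fun x y hy => ?_, fun ε hε => ?_⟩
  · simp [hf.1 x y hy]
  · simpa using hf.2 ε hε

theorem shift_mem_quotientC0 {Y : Submodule ℝ X} {f : X →ᵇ ℂ} (hf : f ∈ quotientC0 Y) (x : X) :
    shift x f ∈ quotientC0 Y := by
  rw [mem_quotientC0_iff] at *
  refine ⟨fun z y hy => ?_, fun ε hε => ?_⟩
  · simp [← add_assoc, hf.1 _ y hy]
  · obtain ⟨R, hR⟩ := hf.2 ε hε
    refine ⟨R + ‖Y.mkQ x‖, fun z hz => hR (x + z) ?_⟩
    have := norm_sub_le (Y.mkQ (x + z)) (Y.mkQ x)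
    rw [← map_sub, add_sub_cancel_left] at this
    linarith

theorem uniformContinuous_of_mem_quotientC0 {Y : Submodule ℝ X} {f : X →ᵇ ℂ}
    (hf : f ∈ quotientC0 Y) : UniformContinuous f := by
  obtain ⟨φ, hφ⟩ := hf
  have h1 : UniformContinuous φ := ZeroAtInftyContinuousMap.uniformContinuous φ
  have h2 : UniformContinuous Y.mkQ := Y.mkQL.uniformContinuous
  rw [show (f : X → ℂ) = φ ∘ Y.mkQ from funext hφ]
  exact h1.comp h2

theorem toBCF_mem_quotientC0_bot (φ : C₀(X, ℂ)) : φ.toBCF ∈ quotientC0 (⊥ : Submodule ℝ X) := by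
  rw [mem_quotientC0_iff]
  refine ⟨fun x y hy => by rw [(Submodule.mem_bot ℝ).1 hy, add_zero], fun ε hε => ?_⟩
  have h := φ.zero_at_infty'.eventually (Metric.ball_mem_nhds 0 hε)
  rw [← Metric.cobounded_eq_cocompact, ← comap_norm_atTop, eventually_comap] at h
  obtain ⟨R, hR⟩ := eventually_atTop.1 h
  refine ⟨R, fun x hx => ?_⟩
  rw [norm_mkQ_bot] at hx
  simpa using hR _ hx.le x rfl

theorem exists_eq_toBCF_of_mem_quotientC0_bot {f : X →ᵇ ℂ}
    (hf : f ∈ quotientC0 (⊥ : Submodule ℝ X)) : ∃ φ : C₀(X, ℂ), f = φ.toBCF := by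
  rw [mem_quotientC0_iff] at hf
  refine ⟨⟨f.toContinuousMap, ?_⟩, rfl⟩
  rw [Metric.tendsto_nhds]
  intro ε hε
  obtain ⟨R, hR⟩ := hf.2 ε hε
  rw [← Metric.cobounded_eq_cocompact, ← comap_norm_atTop, eventually_comap]
  filter_upwards [eventually_gt_atTop R] with r hr x hx
  rw [dist_zero_right]
  exact hR x (by rwa [norm_mkQ_bot, hx])

/-- The norm closure of `∑ C₀(X/Z)`, where `Z` runs over a set of subspaces. -/
def grassmannAlgebraOf (F : Set (Submodule ℝ X)) : Submodule ℂ (X →ᵇ ℂ) :=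
  (Submodule.span ℂ (⋃ Z ∈ F, quotientC0 Z)).topologicalClosure

/-- A closed translation invariant star algebra of bounded uniformly continuous functions. -/
structure IsTranslationAlgebra (𝒜 : Submodule ℂ (X →ᵇ ℂ)) : Prop where
  isClosed : IsClosed (𝒜 : Set (X →ᵇ ℂ))
  shift_mem : ∀ f ∈ 𝒜, ∀ x, shift x f ∈ 𝒜
  uniformContinuous : ∀ f ∈ 𝒜, UniformContinuous f
  star_mem : ∀ f ∈ 𝒜, star f ∈ 𝒜
  mul_mem : ∀ f ∈ 𝒜, ∀ g ∈ 𝒜, f * g ∈ 𝒜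

theorem grassmannAlgebraOf_induction {F : Set (Submodule ℝ X)} {p : (X →ᵇ ℂ) → Prop}
    (hgen : ∀ Z ∈ F, ∀ f ∈ quotientC0 Z, p f) (h0 : p 0)
    (hadd : ∀ f g, p f → p g → p (f + g)) (hsmul : ∀ (c : ℂ) f, p f → p (c • f))
    (hcl : IsClosed {f | p f}) {f : X →ᵇ ℂ} (hf : f ∈ grassmannAlgebraOf F) : p f := by
  refine closure_minimal (t := {f | p f}) (fun g hg => ?_) hcl hf
  refine Submodule.span_induction (p := fun g _ => p g) (fun g hg => ?_) h0
    (fun f g _ _ => hadd f g) (fun c f _ => hsmul c f) hg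
  simp only [Set.mem_iUnion] at hg
  obtain ⟨Z, hZ, hg⟩ := hg
  exact hgen Z hZ g hg

theorem quotientC0_subset_grassmannAlgebraOf {F : Set (Submodule ℝ X)} {Z : Submodule ℝ X}
    (hZ : Z ∈ F) : quotientC0 Z ⊆ (grassmannAlgebraOf F : Set (X →ᵇ ℂ)) := fun _ hf =>
  Submodule.le_topologicalClosure _ (Submodule.subset_span (Set.mem_biUnion hZ hf))

theorem isClosed_grassmannAlgebraOf (F : Set (Submodule ℝ X)) :
    IsClosed (grassmannAlgebraOf F : Set (X →ᵇ ℂ)) := Submodule.isClosed_topologicalClosure _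

theorem continuous_shift (x : X) : Continuous (shift x) := by
  refine LipschitzWith.continuous (K := 1) (LipschitzWith.of_dist_le_mul fun f g => ?_)
  rw [dist_eq_norm, dist_eq_norm, show shift x f - shift x g = shift x (f - g) from rfl, norm_shift]
  simp

/-- Each property is checked on generators and passes to the closure. Stability of `F` under
intersection is needed for products only. -/
theorem isTranslationAlgebra_grassmannAlgebraOf {F : Set (Submodule ℝ X)}
    (hF : ∀ Y ∈ F, ∀ Z ∈ F, Y ⊓ Z ∈ F) : IsTranslationAlgebra (grassmannAlgebraOf F) where
  isClosed := isClosed_grassmannAlgebraOf F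
  shift_mem f hf x := by
    refine grassmannAlgebraOf_induction (p := fun f => shift x f ∈ grassmannAlgebraOf F) ?_ ?_ ?_ ?_
      ((isClosed_grassmannAlgebraOf F).preimage (continuous_shift x)) hf
    · exact fun Z hZ f hf => quotientC0_subset_grassmannAlgebraOf hZ (shift_mem_quotientC0 hf x)
    · exact Submodule.zero_mem _
    · exact fun f g => Submodule.add_mem _
    · exact fun c f => Submodule.smul_mem _ c
  uniformContinuous f hf := by
    refine grassmannAlgebraOf_induction (p := fun f => UniformContinuous f) ?_ ?_ ?_ ?_ ?_ hf
    · exact fun Z hZ f hf => uniformContinuous_of_mem_quotientC0 hf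
    · exact uniformContinuous_const
    · exact fun f g hf hg => hf.add hg
    · exact fun c f hf => hf.const_smul c
    · refine isClosed_of_closure_subset fun f hf => Metric.uniformContinuous_iff.2 fun ε hε => ?_
      obtain ⟨g, hg, hfg⟩ := Metric.mem_closure_iff.1 hf (ε / 3) (by positivity)
      obtain ⟨δ, hδ, h⟩ := Metric.uniformContinuous_iff.1 hg (ε / 3) (by positivity)
      refine ⟨δ, hδ, fun a b hab => ?_⟩
      have h1 := (BoundedContinuousFunction.dist_coe_le_dist (f := f) (g := g) a).trans_lt hfg
      have h2 := (BoundedContinuousFunction.dist_coe_le_dist (f := f) (g := g) b).trans_lt hfg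
      have h3 := dist_triangle4 (f a) (g a) (g b) (f b)
      rw [dist_comm (g b)] at h3
      linarith [h hab]
  star_mem f hf := by
    refine grassmannAlgebraOf_induction (p := fun f => star f ∈ grassmannAlgebraOf F) ?_ ?_ ?_ ?_
      ((isClosed_grassmannAlgebraOf F).preimage continuous_star) hf
    · exact fun Z hZ f hf => quotientC0_subset_grassmannAlgebraOf hZ (star_mem_quotientC0 hf)
    · simp
    · intro f g hf hg; rw [star_add]; exact Submodule.add_mem _ hf hg
    · intro c f hf; rw [star_smul]; exact Submodule.smul_mem _ _ hf
  mul_mem f hf g hg := by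
    refine grassmannAlgebraOf_induction (p := fun f => f * g ∈ grassmannAlgebraOf F) ?_ ?_ ?_ ?_
      ((isClosed_grassmannAlgebraOf F).preimage (continuous_mul_const g)) hf
    · intro Y hY f hf
      refine grassmannAlgebraOf_induction (p := fun g => f * g ∈ grassmannAlgebraOf F) ?_ ?_ ?_ ?_
        ((isClosed_grassmannAlgebraOf F).preimage (continuous_const_mul f)) hg
      · exact fun Z hZ g hg =>
          quotientC0_subset_grassmannAlgebraOf (hF Y hY Z hZ) (mul_mem_quotientC0 hf hg)
      · simp
      · intro f g hf hg; rw [mul_add]; exact Submodule.add_mem _ hf hg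
      · intro c f hf; rw [mul_smul_comm]; exact Submodule.smul_mem _ _ hf
    · simp
    · intro f g hf hg; rw [add_mul]; exact Submodule.add_mem _ hf hg
    · intro c f hf; rw [smul_mul_assoc]; exact Submodule.smul_mem _ _ hf

theorem continuous_shift_left {f : X →ᵇ ℂ} (hf : UniformContinuous f) :
    Continuous fun x : X => shift x f := by
  rw [Metric.continuous_iff]
  intro b ε hε
  obtain ⟨δ, hδ, h⟩ := Metric.uniformContinuous_iff.1 hf (ε / 2) (half_pos hε)
  refine ⟨δ, hδ, fun a ha => lt_of_le_of_lt ?_ (half_lt_self hε)⟩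
  refine (BoundedContinuousFunction.dist_le (half_pos hε).le).2 fun y => (h ?_).le
  simpa using ha

theorem grassmannAlgebra_eq : grassmannAlgebra X = grassmannAlgebraOf Set.univ := by
  simp [grassmannAlgebra, grassmannAlgebraOf]

theorem grassmannAlgebraOver_eq (Y : Submodule ℝ X) :
    grassmannAlgebraOver Y = grassmannAlgebraOf (Set.Ici Y) := by
  simp [grassmannAlgebraOver, grassmannAlgebraOf]

end FunctionAlgebra

/-! ### Integral representation of `φ(Q) ψ(P)`, and crossed products as star algebras. -/

section IntegralOperators

variable {X : Type*} [NormedAddCommGroup X] [InnerProductSpace ℝ X] [FiniteDimensional ℝ X]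

/-- A continuous compactly supported function as a bounded continuous function. -/
def compactlySupportedBCF (f : X → ℂ) (hf : Continuous f) (hc : HasCompactSupport f) : X →ᵇ ℂ :=
  (⟨⟨f, hf⟩, hc.is_zero_at_infty⟩ : C₀(X, ℂ)).toBCF

@[simp] theorem compactlySupportedBCF_coe (f : X → ℂ) (hf : Continuous f)
    (hc : HasCompactSupport f) : ⇑(compactlySupportedBCF f hf hc) = f := rfl

theorem uniformContinuous_of_hasCompactSupport {E : Type*} [NormedAddCommGroup E] {Φ : X → E}
    (hΦ : Continuous Φ) (hs : HasCompactSupport Φ) : UniformContinuous Φ :=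
  hΦ.uniformContinuous_of_tendsto_cocompact hs.is_zero_at_infty

/-- A partition of unity subordinate to small balls, on each of which `Φ` varies by less than `ε`.
It turns vector valued functions into finite sums of elementary ones. -/
theorem exists_sum_smul_approx {E : Type*} [NormedAddCommGroup E] [NormedSpace ℂ E] {Φ : X → E}
    (hΦ : Continuous Φ) (hs : HasCompactSupport Φ) {ε : ℝ} (hε : 0 < ε) :
    ∃ (s : Finset X) (p : X → X →ᵇ ℂ),
      (∀ z ∈ s, tsupport (p z) ⊆ Metric.cthickening 1 (tsupport Φ)) ∧
      ∀ x, ‖Φ x - ∑ z ∈ s, p z x • Φ z‖ ≤ ε := by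
  rcases (tsupport Φ).eq_empty_or_nonempty with h0 | hne
  · refine ⟨∅, fun _ => 0, by simp, fun x => ?_⟩
    have : Φ = 0 := by rwa [tsupport_eq_empty_iff] at h0
    simp [this, hε.le]
  obtain ⟨δ', hδ', hu⟩ := Metric.uniformContinuous_iff.1
    (uniformContinuous_of_hasCompactSupport hΦ hs) ε hε
  -- The cap at `1` keeps the supports of the weights inside the closed `1`-thickening.
  set δ := min δ' 1
  have hδ : 0 < δ := lt_min hδ' one_pos
  obtain ⟨t, htS, htf, hcov⟩ := hs.isCompact.finite_cover_balls hδ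
  set s := htf.toFinset
  set q : X → X → ℝ := fun z x => max 0 (δ - dist x z)
  have hq0 : ∀ z x, 0 ≤ q z x := fun z x => le_max_left _ _
  -- The distance to the support makes the denominator positive everywhere without changing it on
  -- the support, where the weights must add up to `1`.
  set D : X → ℝ := fun x => ∑ z ∈ s, q z x + Metric.infDist x (tsupport Φ)
  have hD : ∀ x, 0 < D x := by
    intro x
    by_cases hx : x ∈ tsupport Φ
    · obtain ⟨z, hz, hxz⟩ := Set.mem_iUnion₂.1 (hcov hx)
      have hz' : z ∈ s := htf.mem_toFinset.2 hz
      have h1 : 0 < q z x := lt_max_of_lt_right (by simpa using hxz)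
      have h2 : q z x ≤ ∑ z ∈ s, q z x :=
        Finset.single_le_sum (f := fun z => q z x) (fun i _ => hq0 i x) hz'
      have := Metric.infDist_nonneg (x := x) (s := tsupport Φ)
      simp only [D]; linarith
    · have h1 := ((isClosed_tsupport Φ).notMem_iff_infDist_pos hne).1 hx
      have h2 : 0 ≤ ∑ z ∈ s, q z x := Finset.sum_nonneg fun i _ => hq0 i x
      simp only [D]; linarith
  have hqc : ∀ z, Continuous (q z) := fun z => by fun_prop
  have hDc : Continuous D := (continuous_finsetSum _ fun z _ => hqc z).add
    (Metric.continuous_infDist_pt _)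
  have hpc : ∀ z, Continuous fun x => ((q z x / D x : ℝ) : ℂ) := fun z =>
    Complex.continuous_ofReal.comp ((hqc z).div hDc fun x => (hD x).ne')
  have hK : IsCompact (Metric.cthickening 1 (tsupport Φ)) := hs.isCompact.cthickening
  have hqs : ∀ z x, z ∈ s → q z x ≠ 0 → dist x z < δ := by
    intro z x _ h
    by_contra hcon
    exact h (max_eq_left (by linarith))
  have hps : ∀ z ∈ s, tsupport (fun x => ((q z x / D x : ℝ) : ℂ)) ⊆
      Metric.cthickening 1 (tsupport Φ) := by
    intro z hz
    refine closure_minimal (fun x hx => ?_) Metric.isClosed_cthickening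
    have hqx : q z x ≠ 0 := by
      intro h; simp [h] at hx
    refine Metric.mem_cthickening_of_dist_le x z 1 _ (htS (htf.mem_toFinset.1 hz)) ?_
    exact ((hqs z x hz hqx).trans_le (min_le_right _ _)).le
  classical
  refine ⟨s, fun z => if hz : z ∈ s then compactlySupportedBCF _ (hpc z)
    (hK.of_isClosed_subset (isClosed_tsupport _) (hps z hz)) else 0, ?_, fun x => ?_⟩
  · intro z hz
    simpa [hz] using hps z hz
  · have h1 : ∑ z ∈ s, (if hz : z ∈ s then compactlySupportedBCF _ (hpc z)
        (hK.of_isClosed_subset (isClosed_tsupport _) (hps z hz)) else 0) x • Φ z =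
        ∑ z ∈ s, ((q z x / D x : ℝ) : ℂ) • Φ z := by
      refine Finset.sum_congr rfl fun z hz => ?_
      simp [hz]
    rw [h1]
    have h2 : Φ x = ∑ z ∈ s, ((q z x / D x : ℝ) : ℂ) • Φ x := by
      rw [← Finset.sum_smul, ← Complex.ofReal_sum, ← Finset.sum_div]
      by_cases hx : x ∈ tsupport Φ
      · have : D x = ∑ z ∈ s, q z x := by
          simp only [D]; rw [Metric.infDist_zero_of_mem hx, add_zero]
        rw [← this, div_self (hD x).ne', Complex.ofReal_one, one_smul]
      · rw [image_eq_zero_of_notMem_tsupport hx, smul_zero]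
    have h3 : ∑ z ∈ s, q z x / D x ≤ 1 := by
      rw [← Finset.sum_div, div_le_one (hD x)]
      exact le_add_of_nonneg_right Metric.infDist_nonneg
    calc ‖Φ x - ∑ z ∈ s, ((q z x / D x : ℝ) : ℂ) • Φ z‖
        = ‖∑ z ∈ s, ((q z x / D x : ℝ) : ℂ) • (Φ x - Φ z)‖ := by
          conv_lhs => rw [h2]
          rw [← Finset.sum_sub_distrib]; simp_rw [smul_sub]
      _ ≤ ∑ z ∈ s, q z x / D x * ε := by
          refine norm_sum_le_of_le _ fun z hz => ?_
          have h4 : 0 ≤ q z x / D x := div_nonneg (hq0 z x) (hD x).le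
          rw [norm_smul, Complex.norm_real, Real.norm_of_nonneg h4]
          by_cases h5 : q z x = 0
          · simp [h5]
          · refine mul_le_mul_of_nonneg_left ?_ h4
            rw [← dist_eq_norm]
            exact (hu ((hqs z x hz h5).trans_le (min_le_left _ _))).le
      _ ≤ ε := by
          rw [← Finset.sum_mul]
          exact mul_le_of_le_one_left hε.le h3

variable [MeasurableSpace X] [BorelSpace X]

theorem continuous_charFun_uncurry : Continuous fun p : X × X => charFun p.1 p.2 :=
  continuous_subtype_val.comp (Real.continuous_fourierChar.comp (continuous_snd.inner continuous_fst))

theorem continuous_charFun_left (ξ : X) : Continuous fun z : X => charFun z ξ :=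
  continuous_charFun_uncurry.comp (continuous_id.prodMk continuous_const)

theorem norm_charFun_apply (z ξ : X) : ‖charFun z ξ‖ = 1 := Circle.norm_coe _

theorem integrable_mul_charFun {f : X → ℂ} (hf : Integrable f) (ξ : X) :
    Integrable fun z => f z * charFun z ξ :=
  hf.mul_bdd (c := 1) (continuous_charFun_left ξ).aestronglyMeasurable
    (Eventually.of_forall fun z => (norm_charFun_apply z ξ).le)

/-- The function `ξ ↦ ∫ exp (2 π i ⟪z, ξ⟫) f z dz`, the symbol of `∫ f z U_z dz`. -/
def symbol (f : X → ℂ) (hf : Integrable f) : C₀(X, ℂ) where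
  toFun := 𝓕⁻ f
  continuous_toFun := by
    rw [show 𝓕⁻ f = fun ξ => 𝓕 f (-ξ) from funext fun ξ => Real.fourierInv_eq_fourier_neg f ξ]
    exact (VectorFourier.fourierIntegral_continuous Real.continuous_fourierChar
      (innerSL ℝ).continuous₂ hf).comp continuous_neg
  zero_at_infty' := by
    rw [show 𝓕⁻ f = fun ξ => 𝓕 f (-ξ) from funext fun ξ => Real.fourierInv_eq_fourier_neg f ξ]
    exact (tendsto_integral_exp_inner_smul_cocompact f).comp
      (Homeomorph.neg X).isClosedEmbedding.tendsto_cocompact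

theorem symbol_apply (f : X → ℂ) (hf : Integrable f) (ξ : X) :
    symbol f hf ξ = ∫ z, f z * charFun z ξ := by
  change 𝓕⁻ f ξ = _
  rw [Real.fourierInv_eq]
  refine integral_congr_ae (Eventually.of_forall fun z => ?_)
  simp [charFun, Circle.smul_def, real_inner_comm, mul_comm]

theorem norm_symbol_sub_le {f g : X → ℂ} (hf : Integrable f) (hg : Integrable g) :
    ‖(symbol f hf).toBCF - (symbol g hg).toBCF‖ ≤ ∫ z, ‖f z - g z‖ := by
  refine (BoundedContinuousFunction.norm_le (integral_nonneg fun _ => norm_nonneg _)).2 fun ξ => ?_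
  change ‖symbol f hf ξ - symbol g hg ξ‖ ≤ _
  rw [symbol_apply, symbol_apply,
    ← integral_sub (integrable_mul_charFun hf ξ) (integrable_mul_charFun hg ξ)]
  refine norm_integral_le_of_norm_le (hf.sub hg).norm (Eventually.of_forall fun z => ?_)
  rw [← sub_mul, norm_mul, norm_charFun_apply, mul_one]

theorem exists_hasCompactSupport_approx (ψ : C₀(X, ℂ)) {ε : ℝ} (hε : 0 < ε) :
    ∃ f : X → ℂ, Continuous f ∧ HasCompactSupport f ∧ ∀ x, ‖ψ x - f x‖ ≤ ε := by
  obtain ⟨K, hK, hKψ⟩ := mem_cocompact.1 (ψ.zero_at_infty'.eventually (Metric.ball_mem_nhds 0 hε))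
  obtain ⟨χ, h1, -, hc, h01⟩ := exists_continuous_one_zero_of_isCompact hK isClosed_empty
    (Set.disjoint_empty K)
  refine ⟨fun x => (χ x : ℂ) * ψ x, by fun_prop, ?_, fun x => ?_⟩
  · exact (hc.comp_left (g := fun r : ℝ => (r : ℂ)) Complex.ofReal_zero).mul_right
  · have h2 : ψ x - χ x * ψ x = ((1 - χ x : ℝ) : ℂ) * ψ x := by push_cast; ring
    rw [h2, norm_mul, Complex.norm_real, Real.norm_of_nonneg (by linarith [(h01 x).2])]
    by_cases hx : x ∈ K
    · simp [h1 hx, hε.le]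
    · have h3 : ‖ψ x‖ < ε := by simpa using hKψ hx
      have h4 := (h01 x).1
      calc (1 - χ x) * ‖ψ x‖ ≤ 1 * ε := by gcongr; linarith
        _ = ε := one_mul ε

/-- Approximate `ψ` uniformly by a continuous function of compact support, then by a smooth one. The
latter is the inverse Fourier transform of a Schwartz function, which is replaced by a compactly
supported `f` close to it in `L¹`. Each of the three steps costs `ε / 3`. -/
theorem exists_symbol_approx (ψ : C₀(X, ℂ)) {ε : ℝ} (hε : 0 < ε) :
    ∃ (f : X → ℂ) (_ : Continuous f) (_ : HasCompactSupport f) (hi : Integrable f),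
      ‖ψ.toBCF - (symbol f hi).toBCF‖ ≤ ε := by
  obtain ⟨g, hg, hgc, hψg⟩ := exists_hasCompactSupport_approx ψ (ε := ε / 3) (by positivity)
  obtain ⟨h, hh, hgh, hs⟩ := hg.exists_contDiff_approx ⊤ (continuous_const (y := ε / 3))
    (fun _ => by positivity)
  have hhc : HasCompactSupport h := hgc.mono hs
  set s : 𝓢(X, ℂ) := hhc.toSchwartzMap hh
  set k : 𝓢(X, ℂ) := 𝓕 s
  obtain ⟨f, hfc, hkf, hf, hi⟩ :=
    (k.integrable (μ := volume)).exists_hasCompactSupport_integral_sub_le (ε := ε / 3)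
      (by positivity)
  have hk : ∀ x, symbol k (k.integrable (μ := volume)) x = h x := by
    intro x
    change 𝓕⁻ (k : X → ℂ) x = s x
    rw [← SchwartzMap.fourierInv_coe, FourierTransform.fourierInv_fourier_eq]
  have h1 := norm_symbol_sub_le (k.integrable (μ := volume)) hi
  refine ⟨f, hf, hfc, hi, (BoundedContinuousFunction.norm_le hε.le).2 fun x => ?_⟩
  have h2 := (((symbol k (k.integrable (μ := volume))).toBCF -
    (symbol f hi).toBCF).norm_coe_le_norm x).trans (h1.trans hkf)
  change ‖symbol k (k.integrable (μ := volume)) x - symbol f hi x‖ ≤ _ at h2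
  rw [hk] at h2
  change ‖ψ x - symbol f hi x‖ ≤ ε
  have h3 := hψg x
  have h4 := hgh x
  rw [dist_comm, dist_eq_norm] at h4
  have h5 : ψ x - symbol f hi x = (ψ x - g x) + (g x - h x) + (h x - symbol f hi x) := by ring
  rw [h5]
  refine (norm_add₃_le).trans ?_
  linarith

theorem mulOp_charFun_eq (z : X) :
    mulOp (charFun z) = fourierOp * transOp z * star fourierOp := by
  rw [fourierOp_mul_transOp, mul_assoc, fourierOp_mul_star, mul_one]

theorem integrable_inner_mulOp {f : X → ℂ} (hf : Integrable f) (v w : L2 X) :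
    Integrable (fun p : X × X => f p.1 * charFun p.1 p.2 * inner ℂ (v p.2) (w p.2))
      (volume.prod volume) := by
  have h1 : Integrable (fun p : X × X => f p.1 * inner ℂ (v p.2) (w p.2)) (volume.prod volume) :=
    hf.mul_prod (L2.integrable_inner v w)
  have h2 := h1.mul_bdd (c := 1)
    (continuous_charFun_uncurry (X := X)).aestronglyMeasurable
    (Eventually.of_forall fun p => (norm_charFun_apply p.1 p.2).le)
  refine h2.congr (Eventually.of_forall fun p => ?_)
  simp only; ring

theorem integrable_smul_apply {f : X → ℂ} (hf : Continuous f) (hc : HasCompactSupport f)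
    {g : X → L2 X} (hg : Continuous g) : Integrable fun z => f z • g z :=
  (hf.smul hg).integrable_of_hasCompactSupport hc.smul_right

/-- Pairing with an arbitrary vector reduces this to Fubini; conjugating by the Fourier transform
then turns characters into translations. -/
theorem mulOp_symbol_apply {f : X → ℂ} (hf : Continuous f) (hc : HasCompactSupport f)
    (hi : Integrable f) (w : L2 X) :
    mulOp (symbol f hi).toBCF w = ∫ z, f z • mulOp (charFun z) w := by
  have hcont : Continuous fun z : X => mulOp (charFun z) w := by
    simp_rw [mulOp_charFun_eq]
    exact fourierOp.continuous.comp (continuous_transOp_apply (star fourierOp w))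
  refine ext_inner_left ℂ fun v => ?_
  rw [← integral_inner (integrable_smul_apply hf hc hcont) v, L2.inner_def]
  have h1 (z : X) : inner ℂ v (f z • mulOp (charFun z) w) =
      ∫ ξ, f z * charFun z ξ * inner ℂ (v ξ) (w ξ) := by
    rw [inner_smul_right, L2.inner_def, ← integral_const_mul]
    refine integral_congr_ae ?_
    filter_upwards [mulOp_ae (charFun z) w] with ξ h
    simp only [h, RCLike.inner_apply]; ring
  simp_rw [h1]
  rw [integral_integral_swap (integrable_inner_mulOp hi v w)]
  refine integral_congr_ae ?_
  filter_upwards [mulOp_ae (symbol f hi).toBCF w] with ξ h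
  rw [h, integral_mul_const, ← symbol_apply f hi]
  change inner ℂ (v ξ) (symbol f hi ξ * w ξ) = _
  simp only [RCLike.inner_apply]; ring

theorem momentumOp_symbol_apply {f : X → ℂ} (hf : Continuous f) (hc : HasCompactSupport f)
    (hi : Integrable f) (w : L2 X) :
    momentumOp (symbol f hi).toBCF w = ∫ z, f z • transOp z w := by
  rw [momentumOp_eq]
  change star fourierOp (mulOp (symbol f hi).toBCF (fourierOp w)) = _
  have hcont : Continuous fun z : X => mulOp (charFun z) (fourierOp w) := by
    simp_rw [mulOp_charFun_eq]
    exact fourierOp.continuous.comp (continuous_transOp_apply (star fourierOp (fourierOp w)))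
  rw [mulOp_symbol_apply hf hc hi,
    ← ContinuousLinearMap.integral_comp_comm _ (integrable_smul_apply hf hc hcont)]
  refine integral_congr_ae (Eventually.of_forall fun z => ?_)
  simp only
  rw [map_smul, transOp_eq_momentumOp, momentumOp_eq]
  rfl

/-- `T` is the operator `∫ Φ(z)(Q) U_z dz`. -/
def IsIntegralOp (T : BddOp X) (Φ : X → X →ᵇ ℂ) : Prop :=
  ∀ w, T w = ∫ z, mulOp (Φ z) (transOp z w)

theorem continuous_mulOp : Continuous (mulOp : (X →ᵇ ℂ) → BddOp X) :=
  AddMonoidHomClass.continuous_of_bound (mulOpHom (X := X)) 1 fun φ => by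
    simpa using norm_mulOp_le φ

theorem continuous_momentumOp : Continuous (momentumOp : (X →ᵇ ℂ) → BddOp X) :=
  AddMonoidHomClass.continuous_of_bound (momentumOpHom (X := X)) 1 fun φ => by
    simpa using norm_momentumOp_le φ

theorem integrable_mulOp_transOp {Φ : X → X →ᵇ ℂ} (hΦ : Continuous Φ) (hc : HasCompactSupport Φ)
    (w : L2 X) : Integrable fun z => mulOp (Φ z) (transOp z w) := by
  refine ((continuous_mulOp.comp hΦ).clm_apply
    (continuous_transOp_apply w)).integrable_of_hasCompactSupport ?_
  refine hc.mono fun z hz h => hz ?_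
  change mulOpHom (Φ z) (transOp z w) = 0
  rw [h, map_zero, zero_apply]

/-- Since each `U_z` is isometric, the integrand is bounded by `ε ‖w‖` on `K` and vanishes
elsewhere. Uniform closeness of the kernels thus gives closeness in operator norm. -/
theorem IsIntegralOp.norm_sub_le {S T : BddOp X} {Φ Ψ : X → X →ᵇ ℂ} (hT : IsIntegralOp T Φ)
    (hS : IsIntegralOp S Ψ) (hΦ : Continuous Φ) (hΨ : Continuous Ψ) {K : Set X} (hK : IsCompact K)
    (hΦK : tsupport Φ ⊆ K) (hΨK : tsupport Ψ ⊆ K) {ε : ℝ} (hε : 0 ≤ ε)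
    (h : ∀ z, ‖Φ z - Ψ z‖ ≤ ε) : ‖T - S‖ ≤ volume.real K * ε := by
  refine ContinuousLinearMap.opNorm_le_bound _ (by positivity) fun w => ?_
  have i1 := integrable_mulOp_transOp hΦ (hK.of_isClosed_subset (isClosed_tsupport _) hΦK) w
  have i2 := integrable_mulOp_transOp hΨ (hK.of_isClosed_subset (isClosed_tsupport _) hΨK) w
  have hind : Integrable (K.indicator fun _ : X => ε * ‖w‖) :=
    (integrableOn_const hK.measure_lt_top.ne).integrable_indicator hK.measurableSet
  rw [sub_apply, hT, hS, ← integral_sub i1 i2]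
  refine (norm_integral_le_of_norm_le hind (Eventually.of_forall fun z => ?_)).trans_eq ?_
  · by_cases hz : z ∈ K
    · rw [Set.indicator_of_mem hz, ← sub_apply, ← mulOpHom_apply,
        ← mulOpHom_apply, ← map_sub]
      refine (ContinuousLinearMap.le_opNorm _ _).trans ?_
      rw [norm_transOp_apply]
      gcongr
      exact (norm_mulOp_le _).trans (h z)
    · rw [Set.indicator_of_notMem hz, image_eq_zero_of_notMem_tsupport (fun h => hz (hΦK h)),
        image_eq_zero_of_notMem_tsupport (fun h => hz (hΨK h)), sub_self, norm_zero]
  · rw [integral_indicator_const _ hK.measurableSet, smul_eq_mul, mul_assoc]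

theorem isIntegralOp_sum {ι : Type*} (s : Finset ι) {T : ι → BddOp X} {Φ : ι → X → X →ᵇ ℂ}
    (hT : ∀ i ∈ s, IsIntegralOp (T i) (Φ i)) (hΦ : ∀ i ∈ s, Continuous (Φ i))
    (hc : ∀ i ∈ s, HasCompactSupport (Φ i)) :
    IsIntegralOp (∑ i ∈ s, T i) (fun z => ∑ i ∈ s, Φ i z) := by
  intro w
  rw [sum_apply, Finset.sum_congr rfl fun i hi => hT i hi w,
    ← integral_finsetSum _ fun i hi => integrable_mulOp_transOp (hΦ i hi) (hc i hi) w]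
  refine integral_congr_ae (Eventually.of_forall fun z => ?_)
  simp only [← mulOpHom_apply, map_sum, sum_apply]

theorem isIntegralOp_mul_momentumOp_symbol (φ : X →ᵇ ℂ) {f : X → ℂ} (hf : Continuous f)
    (hc : HasCompactSupport f) (hi : Integrable f) :
    IsIntegralOp (mulOp φ * momentumOp (symbol f hi).toBCF) (fun z => f z • φ) := by
  intro w
  rw [bddOp_mul_apply, momentumOp_symbol_apply hf hc hi,
    ← ContinuousLinearMap.integral_comp_comm _
      (integrable_smul_apply hf hc (continuous_transOp_apply w))]
  refine integral_congr_ae (Eventually.of_forall fun z => ?_)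
  simp only [← mulOpHom_apply, map_smul]
  rfl

theorem isIntegralOp_momentumOp_symbol_mul (φ : X →ᵇ ℂ) {f : X → ℂ} (hf : Continuous f)
    (hc : HasCompactSupport f) (hi : Integrable f) :
    IsIntegralOp (momentumOp (symbol f hi).toBCF * mulOp φ) (fun z => f z • shift z φ) := by
  intro w
  rw [bddOp_mul_apply, momentumOp_symbol_apply hf hc hi]
  refine integral_congr_ae (Eventually.of_forall fun z => ?_)
  simp only [← mulOpHom_apply, map_smul]
  simp only [mulOpHom_apply]
  rw [← bddOp_mul_apply, transOp_mul_mulOp]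
  rfl

theorem mul_mem_crossedProduct {𝒜 : Submodule ℂ (X →ᵇ ℂ)} {φ : X →ᵇ ℂ} (hφ : φ ∈ 𝒜)
    (ψ : C₀(X, ℂ)) : mulOp φ * momentumOp ψ.toBCF ∈ crossedProduct 𝒜 :=
  Submodule.le_topologicalClosure _ (Submodule.subset_span ⟨φ, hφ, ψ, rfl⟩)

theorem isClosed_crossedProduct (𝒜 : Submodule ℂ (X →ᵇ ℂ)) :
    IsClosed (crossedProduct 𝒜 : Set (BddOp X)) := Submodule.isClosed_topologicalClosure _

/-- When `Φ` is a finite sum of terms `p z • φ` with `φ ∈ 𝒜`, the operator is a finite sum of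
generators `φ(Q) ψ(P)`, with `ψ` the symbol of `p`. The general case follows by a partition of
unity. -/
theorem IsIntegralOp.mem_crossedProduct {T : BddOp X} {Φ : X → X →ᵇ ℂ} (hT : IsIntegralOp T Φ)
    (hΦ : Continuous Φ) (hc : HasCompactSupport Φ) {𝒜 : Submodule ℂ (X →ᵇ ℂ)}
    (h𝒜 : ∀ z, Φ z ∈ 𝒜) : T ∈ crossedProduct 𝒜 := by
  have hK : IsCompact (Metric.cthickening 1 (tsupport Φ)) := hc.isCompact.cthickening
  set K := Metric.cthickening 1 (tsupport Φ)
  rw [← SetLike.mem_coe, ← (isClosed_crossedProduct 𝒜).closure_eq, Metric.mem_closure_iff]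
  intro ε hε
  -- The accuracy stays below `ε` after multiplication by the volume of `K`; the `+ 1` covers a null
  -- set.
  obtain ⟨s, p, hps, hp⟩ := exists_sum_smul_approx hΦ hc
    (ε := ε / (2 * (volume.real K + 1))) (by positivity)
  have hpc : ∀ z ∈ s, HasCompactSupport (p z) := fun z hz =>
    hK.of_isClosed_subset (isClosed_tsupport _) (hps z hz)
  have hpi : ∀ z ∈ s, Integrable (p z) := fun z hz =>
    (p z).continuous.integrable_of_hasCompactSupport (hpc z hz)
  have hcont : ∀ z, Continuous fun x => p z x • Φ z := fun z =>
    (p z).continuous.smul continuous_const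
  classical
  refine ⟨∑ z ∈ s.attach, mulOp (Φ z) * momentumOp (symbol (p z) (hpi z z.2)).toBCF,
    Submodule.sum_mem _ fun z _ => mul_mem_crossedProduct (h𝒜 _) _, ?_⟩
  have hS := isIntegralOp_sum s.attach
    (T := fun z => mulOp (Φ z) * momentumOp (symbol (p z) (hpi z z.2)).toBCF)
    (Φ := fun z x => p z x • Φ z)
    (fun z _ => isIntegralOp_mul_momentumOp_symbol (Φ z) (p z).continuous (hpc z z.2) _)
    (fun z _ => hcont z) (fun z _ => (hpc z z.2).smul_right)
  have hsub : tsupport (fun x => ∑ z ∈ s.attach, p z x • Φ z) ⊆ K := by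
    refine closure_minimal (fun x hx => ?_) Metric.isClosed_cthickening
    by_contra hxK
    refine hx (Finset.sum_eq_zero fun z _ => ?_)
    rw [image_eq_zero_of_notMem_tsupport (fun h => hxK (hps z z.2 h)), zero_smul]
  rw [dist_eq_norm]
  refine (hT.norm_sub_le hS hΦ (continuous_finsetSum _ fun z _ => hcont z) hK
    (Metric.self_subset_cthickening _) hsub (by positivity) fun x => ?_).trans_lt
    (?_ : _ * (ε / (2 * (volume.real K + 1))) < ε)
  · rw [Finset.sum_attach s fun z => p z x • Φ z]
    exact hp x
  · have h0 : 0 ≤ volume.real K := measureReal_nonneg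
    rw [mul_div_assoc', div_lt_iff₀ (by positivity)]
    nlinarith

/-- Moving `φ(Q)` to the left past `U_z` translates `φ` by `z`. The resulting kernel `f z • shift z
φ` has values in `𝒜` by translation invariance, and is norm continuous because `φ` is uniformly
continuous. -/
theorem momentumOp_mul_mem_crossedProduct {𝒜 : Submodule ℂ (X →ᵇ ℂ)}
    (h𝒜 : IsTranslationAlgebra 𝒜) {φ : X →ᵇ ℂ} (hφ : φ ∈ 𝒜) (ψ : C₀(X, ℂ)) :
    momentumOp ψ.toBCF * mulOp φ ∈ crossedProduct 𝒜 := by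
  rw [← SetLike.mem_coe, ← (isClosed_crossedProduct 𝒜).closure_eq, Metric.mem_closure_iff]
  intro ε hε
  obtain ⟨f, hf, hc, hi, h⟩ := exists_symbol_approx ψ (ε := ε / (2 * (‖φ‖ + 1))) (by positivity)
  refine ⟨_, (isIntegralOp_momentumOp_symbol_mul φ hf hc hi).mem_crossedProduct
    (hf.smul (continuous_shift_left (h𝒜.uniformContinuous φ hφ))) hc.smul_right
    fun z => 𝒜.smul_mem _ (h𝒜.shift_mem φ hφ z), ?_⟩
  rw [dist_eq_norm, ← sub_mul, ← momentumOpHom_apply, ← momentumOpHom_apply, ← map_sub]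
  calc _ ≤ ε / (2 * (‖φ‖ + 1)) * ‖φ‖ := by
        refine (norm_mul_le _ _).trans ?_
        gcongr
        · exact (norm_momentumOp_le _).trans h
        · exact norm_mulOp_le φ
    _ < ε := by
        rw [div_mul_eq_mul_div, div_lt_iff₀ (by positivity)]
        nlinarith [norm_nonneg φ]

theorem crossedProduct_induction {𝒜 : Submodule ℂ (X →ᵇ ℂ)} {p : BddOp X → Prop}
    (hgen : ∀ φ ∈ 𝒜, ∀ ψ : C₀(X, ℂ), p (mulOp φ * momentumOp ψ.toBCF)) (h0 : p 0)
    (hadd : ∀ S T, p S → p T → p (S + T)) (hsmul : ∀ (c : ℂ) T, p T → p (c • T))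
    (hcl : IsClosed {T | p T}) {T : BddOp X} (hT : T ∈ crossedProduct 𝒜) : p T := by
  refine closure_minimal (t := {f | p f}) (fun g hg => ?_) hcl hT
  refine Submodule.span_induction (p := fun g _ => p g) (fun g hg => ?_) h0
    (fun f g _ _ => hadd f g) (fun c f _ => hsmul c f) hg
  obtain ⟨φ, hφ, ψ, rfl⟩ := hg
  exact hgen φ hφ ψ

theorem mulOp_mul_mem_crossedProduct {𝒜 ℬ : Submodule ℂ (X →ᵇ ℂ)} {φ : X →ᵇ ℂ}
    (h : ∀ χ ∈ 𝒜, φ * χ ∈ ℬ) {T : BddOp X} (hT : T ∈ crossedProduct 𝒜) :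
    mulOp φ * T ∈ crossedProduct ℬ := by
  refine crossedProduct_induction (p := fun T => mulOp φ * T ∈ crossedProduct ℬ) ?_ ?_ ?_ ?_
    ((isClosed_crossedProduct ℬ).preimage (continuous_const_mul _)) hT
  · intro χ hχ ψ
    rw [← mul_assoc, ← mulOpHom_apply, ← mulOpHom_apply, ← map_mul, mulOpHom_apply]
    exact mul_mem_crossedProduct (h χ hχ) ψ
  · simp
  · intro S T hS hT; rw [mul_add]; exact Submodule.add_mem _ hS hT
  · intro c T hT; rw [mul_smul_comm]; exact Submodule.smul_mem _ _ hT

theorem mul_momentumOp_mem_crossedProduct {𝒜 : Submodule ℂ (X →ᵇ ℂ)} (ψ : C₀(X, ℂ))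
    {T : BddOp X} (hT : T ∈ crossedProduct 𝒜) :
    T * momentumOp ψ.toBCF ∈ crossedProduct 𝒜 := by
  refine crossedProduct_induction (p := fun T => T * momentumOp ψ.toBCF ∈ crossedProduct 𝒜)
    ?_ ?_ ?_ ?_ ((isClosed_crossedProduct 𝒜).preimage (continuous_mul_const _)) hT
  · intro χ hχ η
    rw [mul_assoc, ← momentumOpHom_apply, ← momentumOpHom_apply, ← map_mul, momentumOpHom_apply]
    exact mul_mem_crossedProduct hχ (η * ψ)
  · simp
  · intro S T hS hT; rw [add_mul]; exact Submodule.add_mem _ hS hT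
  · intro c T hT; rw [smul_mul_assoc]; exact Submodule.smul_mem _ _ hT

/-- The crossed product by a translation algebra is a star subalgebra. -/
def crossedProductAlgebra {𝒜 : Submodule ℂ (X →ᵇ ℂ)} (h𝒜 : IsTranslationAlgebra 𝒜) :
    NonUnitalStarSubalgebra ℂ (BddOp X) where
  carrier := crossedProduct 𝒜
  add_mem' := Submodule.add_mem _
  zero_mem' := Submodule.zero_mem _
  smul_mem' c _ hT := Submodule.smul_mem _ c hT
  mul_mem' {S T} hS hT := by
    refine crossedProduct_induction (p := fun S => S * T ∈ crossedProduct 𝒜) ?_ ?_ ?_ ?_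
      ((isClosed_crossedProduct 𝒜).preimage (continuous_mul_const _)) hS
    · intro φ hφ ψ
      refine crossedProduct_induction
        (p := fun T => mulOp φ * momentumOp ψ.toBCF * T ∈ crossedProduct 𝒜) ?_ ?_ ?_ ?_
        ((isClosed_crossedProduct 𝒜).preimage (continuous_const_mul _)) hT
      · intro χ hχ η
        -- In `φ(Q) ψ(P) χ(Q) η(P)` only the middle pair `ψ(P) χ(Q)` is in the wrong order.
        rw [mul_assoc, ← mul_assoc _ (mulOp χ)]
        exact mulOp_mul_mem_crossedProduct (fun f hf => h𝒜.mul_mem φ hφ f hf)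
          (mul_momentumOp_mem_crossedProduct η (momentumOp_mul_mem_crossedProduct h𝒜 hχ ψ))
      · simp
      · intro S T hS hT; rw [mul_add]; exact Submodule.add_mem _ hS hT
      · intro c T hT; rw [mul_smul_comm]; exact Submodule.smul_mem _ _ hT
    · simp
    · intro S T hS hT; rw [add_mul]; exact Submodule.add_mem _ hS hT
    · intro c T hT; rw [smul_mul_assoc]; exact Submodule.smul_mem _ _ hT
  star_mem' {T} hT := by
    refine crossedProduct_induction (p := fun T => star T ∈ crossedProduct 𝒜) ?_ ?_ ?_ ?_
      ((isClosed_crossedProduct 𝒜).preimage continuous_star) hT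
    · intro φ hφ ψ
      rw [star_mul, ← mulOpHom_apply, ← momentumOpHom_apply, ← map_star, ← map_star]
      exact momentumOp_mul_mem_crossedProduct h𝒜 (h𝒜.star_mem φ hφ) (star ψ)
    · simp
    · intro S T hS hT; rw [star_add]; exact Submodule.add_mem _ hS hT
    · intro c T hT; rw [star_smul]; exact Submodule.smul_mem _ _ hT

end IntegralOperators

/-! ### The compact operators are the crossed product by `C₀(X)`. -/

section CompactOperators

variable {X : Type*} [NormedAddCommGroup X] [InnerProductSpace ℝ X] [FiniteDimensional ℝ X]
  [MeasurableSpace X] [BorelSpace X]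

/-- A compactly supported continuous function as an element of `L²(X)`. -/
def compactlySupportedL2 (a : X →ᵇ ℂ) (ha : HasCompactSupport a) : L2 X :=
  (a.continuous.memLp_of_hasCompactSupport ha).toLp a

theorem compactlySupportedL2_ae (a : X →ᵇ ℂ) (ha : HasCompactSupport a) :
    compactlySupportedL2 a ha =ᵐ[volume] a := MemLp.coeFn_toLp _

theorem dense_compactlySupportedL2 :
    Dense {u : L2 X | ∃ a, ∃ ha, u = compactlySupportedL2 a ha} := by
  rw [Metric.dense_iff]
  intro u r hr
  obtain ⟨g, hgc, hg, hgcont, hgm⟩ := (Lp.memLp u).exists_hasCompactSupport_eLpNorm_sub_le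
    (by simp) (ε := ENNReal.ofReal (r / 2)) (by simpa using hr)
  refine ⟨compactlySupportedL2 (compactlySupportedBCF g hgcont hgc) hgc, ?_, _, _, rfl⟩
  rw [Metric.mem_ball, dist_comm]
  refine lt_of_le_of_lt ?_ (half_lt_self hr)
  rw [← ENNReal.ofReal_le_ofReal_iff (half_pos hr).le, ← edist_dist]
  refine le_trans (le_of_eq ?_) hg
  conv_lhs => rw [← Lp.toLp_coeFn u (Lp.memLp u)]
  exact Lp.edist_toLp_toLp _ _ _ _

theorem hasCompactSupport_star {a : X →ᵇ ℂ} (ha : HasCompactSupport a) :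
    HasCompactSupport (star a : X →ᵇ ℂ) :=
  ha.comp_left (g := star) (star_zero ℂ)

theorem mul_shift_eq_zero {a b : X →ᵇ ℂ} {K L : Set X} (hK : tsupport a ⊆ K) (hL : tsupport b ⊆ L)
    {z : X} (hz : z ∉ L - K) : a * shift z b = 0 := by
  ext x
  change a x * b (z + x) = 0
  by_cases hx : x ∈ tsupport a
  · rw [image_eq_zero_of_notMem_tsupport (f := b) fun h =>
      hz ⟨_, hL h, x, hK hx, add_sub_cancel_right z x⟩, mul_zero]
  · rw [image_eq_zero_of_notMem_tsupport hx, zero_mul]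

theorem isCompact_sub {K L : Set X} (hK : IsCompact K) (hL : IsCompact L) :
    IsCompact (L - K : Set X) := by
  rw [sub_eq_add_neg]
  exact hL.add hK.neg

theorem hasCompactSupport_mul_shift {a b : X →ᵇ ℂ} (ha : HasCompactSupport a)
    (hb : HasCompactSupport b) : HasCompactSupport fun z => a * shift z b :=
  HasCompactSupport.intro (isCompact_sub ha.isCompact hb.isCompact) fun _ hz =>
    mul_shift_eq_zero subset_rfl subset_rfl hz

theorem continuous_mul_shift (a : X →ᵇ ℂ) {b : X →ᵇ ℂ} (hb : HasCompactSupport b) :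
    Continuous fun z => a * shift z b :=
  continuous_const.mul
    (continuous_shift_left (uniformContinuous_of_hasCompactSupport b.continuous hb))

/-- The operator sends `w` to `a(x) ∫ b(y) w(y) dy`. The substitution `y = z + x` exhibits the
kernel `a · b(z + ·)`. -/
theorem isIntegralOp_rankOne (a b : X →ᵇ ℂ) (ha : HasCompactSupport a) (hb : HasCompactSupport b) :
    IsIntegralOp (InnerProductSpace.rankOne ℂ (compactlySupportedL2 a ha)
      (compactlySupportedL2 (star b) (hasCompactSupport_star hb))) (fun z => a * shift z b) := by
  intro w
  have hΦ := continuous_mul_shift a hb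
  have hc := hasCompactSupport_mul_shift ha hb
  refine ext_inner_left ℂ fun v => ?_
  rw [← integral_inner (integrable_mulOp_transOp hΦ hc w) v, InnerProductSpace.rankOne_apply,
    inner_smul_right]
  have h1 : inner ℂ v (compactlySupportedL2 a ha) = ∫ x, inner ℂ (v x) (a x) := by
    rw [L2.inner_def]
    refine integral_congr_ae ?_
    filter_upwards [compactlySupportedL2_ae a ha] with x hx
    rw [hx]
  have h2 : inner ℂ (compactlySupportedL2 (star b) (hasCompactSupport_star hb)) w =
      ∫ x, b x * w x := by
    rw [L2.inner_def]
    refine integral_congr_ae ?_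
    filter_upwards [compactlySupportedL2_ae (star b) (hasCompactSupport_star hb)] with x hx
    rw [hx]
    simp [mul_comm]
  have h3 : ∀ z, inner ℂ v (mulOp (a * shift z b) (transOp z w)) =
      ∫ x, inner ℂ (v x) (a x) * (b (z + x) * w (z + x)) := by
    intro z
    rw [L2.inner_def]
    refine integral_congr_ae ?_
    filter_upwards [mulOp_ae (a * shift z b) (transOp z w), transOp_ae z w] with x hx hx'
    rw [hx, hx']
    simp; ring
  have i1 : Integrable fun x => inner ℂ (v x) (a x) := by
    refine (L2.integrable_inner (𝕜 := ℂ) v (compactlySupportedL2 a ha)).congr ?_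
    filter_upwards [compactlySupportedL2_ae a ha] with x hx
    rw [hx]
  have i2 : Integrable fun x => b x * w x := by
    refine (L2.integrable_inner (𝕜 := ℂ)
      (compactlySupportedL2 (star b) (hasCompactSupport_star hb)) w).congr ?_
    filter_upwards [compactlySupportedL2_ae (star b) (hasCompactSupport_star hb)] with x hx
    rw [hx]
    simp [mul_comm]
  have i3 : Integrable (fun p : X × X => inner ℂ (v p.2) (a p.2) * (b (p.1 + p.2) * w (p.1 + p.2)))
      (volume.prod volume) := by
    have h := (measurePreserving_prod_add_swap (volume : Measure X) (volume : Measure X))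
    have := h.integrable_comp_of_integrable (i1.mul_prod i2)
    refine this.congr (Eventually.of_forall fun p => ?_)
    simp [add_comm]
  simp_rw [h3]
  rw [integral_integral_swap i3, h1, h2]
  have h4 : ∀ x, ∫ z, inner ℂ (v x) (a x) * (b (z + x) * w (z + x)) =
      inner ℂ (v x) (a x) * ∫ y, b y * w y := by
    intro x
    rw [integral_const_mul]
    congr 1
    exact integral_add_right_eq_self (fun y => b y * w y) x
  simp_rw [h4]
  rw [integral_mul_const, mul_comm]

theorem compactlySupported_mem {a : X →ᵇ ℂ} (ha : HasCompactSupport a) :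
    a ∈ grassmannAlgebraOf ({⊥} : Set (Submodule ℝ X)) := by
  set φ : C₀(X, ℂ) := ⟨a.toContinuousMap, ha.is_zero_at_infty⟩
  have h : φ.toBCF = a := by ext; rfl
  rw [← h]
  exact quotientC0_subset_grassmannAlgebraOf (Set.mem_singleton _) (toBCF_mem_quotientC0_bot φ)

theorem rankOne_mem_crossedProduct (u v : L2 X) : InnerProductSpace.rankOne ℂ u v ∈
    crossedProduct (grassmannAlgebraOf ({⊥} : Set (Submodule ℝ X))) := by
  have hcl := isClosed_crossedProduct (grassmannAlgebraOf ({⊥} : Set (Submodule ℝ X)))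
  have h1 : ∀ (a : X →ᵇ ℂ) (ha : HasCompactSupport a) (v : L2 X),
      InnerProductSpace.rankOne ℂ (compactlySupportedL2 a ha) v ∈
      crossedProduct (grassmannAlgebraOf ({⊥} : Set (Submodule ℝ X))) := by
    intro a ha v
    refine dense_compactlySupportedL2.induction (P := fun v =>
      InnerProductSpace.rankOne ℂ (compactlySupportedL2 a ha) v ∈
      crossedProduct (grassmannAlgebraOf ({⊥} : Set (Submodule ℝ X)))) ?_
      (hcl.preimage (InnerProductSpace.rankOne ℂ (compactlySupportedL2 a ha)).continuous) v
    rintro _ ⟨b, hb, rfl⟩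
    have h := isIntegralOp_rankOne a (star b) ha (hasCompactSupport_star hb)
    simp only [star_star] at h
    exact h.mem_crossedProduct (continuous_mul_shift a (hasCompactSupport_star hb))
      (hasCompactSupport_mul_shift ha (hasCompactSupport_star hb))
      fun z => compactlySupported_mem ha.mul_right
  refine dense_compactlySupportedL2.induction (P := fun u => InnerProductSpace.rankOne ℂ u v ∈
      crossedProduct (grassmannAlgebraOf ({⊥} : Set (Submodule ℝ X)))) ?_ (hcl.preimage ?_) u
  · rintro _ ⟨a, ha, rfl⟩
    exact h1 a ha v
  · exact (ContinuousLinearMap.flip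
      (InnerProductSpace.rankOne ℂ : L2 X →L[ℂ] L2 X →L⋆[ℂ] BddOp X) v).continuous

/-- Project onto the span of a finite net of the image of the unit ball. The projected operator is a
finite sum of operators of rank one and is close to `T`. -/
theorem mem_crossedProduct_of_isCompactOperator {T : BddOp X} (hT : IsCompactOperator T) :
    T ∈ crossedProduct (grassmannAlgebraOf ({⊥} : Set (Submodule ℝ X))) := by
  rw [← SetLike.mem_coe, ← (isClosed_crossedProduct _).closure_eq, Metric.mem_closure_iff]
  intro ε hε
  obtain ⟨t, -, htf, ht⟩ := exists_finite_cover_balls_of_isCompact_closure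
    (hT.isCompact_closure_image_closedBall (f := (T : L2 X →ₗ[ℂ] L2 X)) 1) (half_pos hε)
  set V : Submodule ℂ (L2 X) := Submodule.span ℂ t
  have : FiniteDimensional ℂ V := FiniteDimensional.span_of_finite ℂ htf
  refine ⟨V.starProjection * T, ?_, ?_⟩
  · rw [(stdOrthonormalBasis ℂ V).starProjection_eq_sum_rankOne, Finset.sum_mul]
    refine Submodule.sum_mem _ fun i _ => ?_
    change InnerProductSpace.rankOne ℂ _ _ ∘L T ∈ _
    rw [InnerProductSpace.rankOne_comp]
    exact rankOne_mem_crossedProduct _ _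
  · rw [dist_eq_norm]
    refine lt_of_le_of_lt (ContinuousLinearMap.opNorm_le_of_unit_norm (half_pos hε).le
      fun x hx => ?_) (half_lt_self hε)
    obtain ⟨y, hy, hxy⟩ := Set.mem_iUnion₂.1 (ht ⟨x, by simp [hx], rfl⟩)
    change ‖T x - V.starProjection (T x)‖ ≤ _
    rw [V.starProjection_minimal]
    refine (ciInf_le ⟨0, ?_⟩ (⟨y, Submodule.subset_span hy⟩ : V)).trans ?_
    · rintro _ ⟨z, rfl⟩; exact norm_nonneg _
    · rw [← dist_eq_norm]; exact (Metric.mem_ball.1 hxy).le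

theorem isCompactOperator_rankOne (u v : L2 X) :
    IsCompactOperator (InnerProductSpace.rankOne ℂ u v) := by
  rw [InnerProductSpace.rankOne_def']
  have h : IsCompactOperator (ContinuousLinearMap.toSpanSingleton ℂ u) :=
    isCompactOperator_of_locallyCompactSpace_rng _
  exact h.comp_clm (innerSL ℂ v)

theorem hasCompactSupport_shift {f : X →ᵇ ℂ} (hf : HasCompactSupport f) (z : X) :
    HasCompactSupport (shift z f) :=
  hf.comp_homeomorph (Homeomorph.addLeft z)

/-- The integral kernel in the variables `x` and `y` is `φ(x) f(y - x)`, continuous with compact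
support. A partition of unity in `x` approximates it uniformly by kernels of finite rank. -/
theorem isCompactOperator_mul_symbol (φ : X →ᵇ ℂ) (hφ : HasCompactSupport φ) (f : X →ᵇ ℂ)
    (hc : HasCompactSupport f) (hi : Integrable f) :
    IsCompactOperator (mulOp φ * momentumOp (symbol f hi).toBCF) := by
  set G : X → X →ᵇ ℂ := fun x => φ x • shift (-x) f
  have hG : Continuous G := φ.continuous.smul ((continuous_shift_left
    (uniformContinuous_of_hasCompactSupport f.continuous hc)).comp continuous_neg)
  have hGs : HasCompactSupport G := hφ.smul_right
  have hGc : ∀ x, HasCompactSupport (G x) := fun x => (hasCompactSupport_shift hc (-x)).smul_left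
  set K₁ := Metric.cthickening 1 (tsupport G)
  set K₂ := tsupport f + tsupport φ
  have hK₁ : IsCompact K₁ := hGs.isCompact.cthickening
  have hK₂ : IsCompact K₂ := hc.isCompact.add hφ.isCompact
  have hGK : ∀ x, tsupport (G x) ⊆ K₂ := by
    intro x
    refine closure_minimal (fun y hy => ?_) hK₂.isClosed
    have h : φ x * f (-x + y) ≠ 0 := hy
    exact ⟨-x + y, subset_tsupport _ (right_ne_zero_of_mul h), x,
      subset_tsupport _ (left_ne_zero_of_mul h), neg_add_cancel_comm x y⟩
  -- A common compact set containing the translation parameters of both operators: `tsupport f` for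
  -- `φ(Q) ψ(P)`, and the differences `K₂ - K₁` for the finite rank approximation.
  set K := tsupport f ∪ (K₂ - K₁)
  have hK : IsCompact K := hc.isCompact.union (isCompact_sub hK₁ hK₂)
  have hcl : IsClosed {T : BddOp X | IsCompactOperator T} := isClosed_setOfPred_isCompactOperator
  change _ ∈ {T : BddOp X | IsCompactOperator T}
  rw [← hcl.closure_eq, Metric.mem_closure_iff]
  intro ε hε
  obtain ⟨s, p, hps, hp⟩ := exists_sum_smul_approx hG hGs
    (ε := ε / (2 * (volume.real K + 1))) (by positivity)
  have hpc : ∀ z ∈ s, HasCompactSupport (p z) := fun z hz =>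
    hK₁.of_isClosed_subset (isClosed_tsupport _) (hps z hz)
  set S : BddOp X := ∑ z ∈ s.attach, InnerProductSpace.rankOne ℂ
    (compactlySupportedL2 (p z) (hpc z z.2))
    (compactlySupportedL2 (star (G z)) (hasCompactSupport_star (hGc z)))
  refine ⟨S, ?_, ?_⟩
  · exact Submodule.sum_mem (compactOperator (RingHom.id ℂ) (L2 X) (L2 X)) fun z _ =>
      isCompactOperator_rankOne _ _
  have hS : IsIntegralOp S fun y => ∑ z ∈ s.attach, p z * shift y (G z) :=
    isIntegralOp_sum s.attach
      (fun z _ => isIntegralOp_rankOne (p z) (G z) (hpc z z.2) (hGc z))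
      (fun z _ => continuous_mul_shift (p z) (hGc z))
      fun z _ => hasCompactSupport_mul_shift (hpc z z.2) (hGc z)
  have hT := isIntegralOp_mul_momentumOp_symbol φ f.continuous hc hi
  have hΨK : tsupport (fun y => ∑ z ∈ s.attach, p z * shift y (G z)) ⊆ K := by
    refine closure_minimal (fun y hy => ?_) hK.isClosed
    by_contra hyK
    exact hy (Finset.sum_eq_zero fun z _ =>
      mul_shift_eq_zero (hps z z.2) (hGK z) fun h => hyK (Or.inr h))
  have hΦK : tsupport (fun z => f z • φ) ⊆ K :=
    (tsupport_smul_subset_left f fun _ => φ).trans Set.subset_union_left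
  rw [dist_eq_norm]
  refine (hT.norm_sub_le hS (f.continuous.smul continuous_const)
    (continuous_finsetSum _ fun z _ => continuous_mul_shift (p z) (hGc z)) hK hΦK hΨK
    (by positivity) fun y => ?_).trans_lt
    (?_ : _ * (ε / (2 * (volume.real K + 1))) < ε)
  · refine (BoundedContinuousFunction.norm_le (by positivity)).2 fun x => ?_
    -- The kernel indexed by the translation `y` at the point `x` is `G x` evaluated at `y + x`.
    have h1 := ((G x - ∑ z ∈ s, p z x • G z).norm_coe_le_norm (y + x)).trans (hp x)
    refine le_trans (le_of_eq ?_) h1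
    rw [Finset.sum_attach s fun z => p z * shift y (G z)]
    congr 1
    simp only [BoundedContinuousFunction.sub_apply, BoundedContinuousFunction.smul_apply,
      BoundedContinuousFunction.sum_apply, BoundedContinuousFunction.mul_apply, shift_apply,
      smul_eq_mul, G]
    rw [show -x + (y + x) = y by abel, mul_comm]
  · have h0 : 0 ≤ volume.real K := measureReal_nonneg
    rw [mul_div_assoc', div_lt_iff₀ (by positivity)]
    nlinarith

theorem mem_of_forall_symbol_mem {C : Set (X →ᵇ ℂ)} (hC : IsClosed C)
    (h : ∀ (f : X → ℂ) (_ : Continuous f) (_ : HasCompactSupport f) (hi : Integrable f),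
      (symbol f hi).toBCF ∈ C) (ψ : C₀(X, ℂ)) : ψ.toBCF ∈ C := by
  rw [← hC.closure_eq, Metric.mem_closure_iff]
  intro ε hε
  obtain ⟨f, hf, hc, hi, hψ⟩ := exists_symbol_approx ψ (half_pos hε)
  exact ⟨_, h f hf hc hi, by rw [dist_eq_norm]; linarith⟩

theorem mem_of_forall_hasCompactSupport_mem {C : Set (X →ᵇ ℂ)} (hC : IsClosed C)
    (h : ∀ f : X →ᵇ ℂ, HasCompactSupport f → f ∈ C) (φ : C₀(X, ℂ)) : φ.toBCF ∈ C := by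
  rw [← hC.closure_eq, Metric.mem_closure_iff]
  intro ε hε
  obtain ⟨f, hf, hc, hφ⟩ := exists_hasCompactSupport_approx φ (half_pos hε)
  refine ⟨_, h (compactlySupportedBCF f hf hc) hc, ?_⟩
  exact ((BoundedContinuousFunction.dist_le (half_pos hε).le).2 fun x => by
    rw [dist_eq_norm]; exact hφ x).trans_lt (half_lt_self hε)

theorem isCompactOperator_of_mem_crossedProduct {T : BddOp X}
    (hT : T ∈ crossedProduct (grassmannAlgebraOf ({⊥} : Set (Submodule ℝ X)))) :
    IsCompactOperator T := by
  have hcl : IsClosed {T : BddOp X | IsCompactOperator T} := isClosed_setOfPred_isCompactOperator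
  refine crossedProduct_induction (p := fun T => IsCompactOperator T) ?_ ?_ ?_ ?_ hcl hT
  · intro φ hφ ψ
    refine grassmannAlgebraOf_induction
      (p := fun φ => IsCompactOperator ((mulOp φ * momentumOp ψ.toBCF : BddOp X) : L2 X → L2 X)) ?_ ?_ ?_ ?_
      (hcl.preimage ((continuous_mul_const (momentumOp ψ.toBCF)).comp continuous_mulOp)) hφ
    · rintro _ rfl φ hφ
      obtain ⟨φ, rfl⟩ := exists_eq_toBCF_of_mem_quotientC0_bot hφ
      refine mem_of_forall_symbol_mem (hcl.preimage
        ((continuous_const_mul (mulOp φ.toBCF)).comp continuous_momentumOp)) (fun f hf hc hi => ?_) ψ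
      refine mem_of_forall_hasCompactSupport_mem (hcl.preimage
        ((continuous_mul_const (momentumOp (symbol f hi).toBCF)).comp continuous_mulOp)) (fun φ hφ => ?_) φ
      exact isCompactOperator_mul_symbol φ hφ (compactlySupportedBCF f hf hc) hc hi
    · rw [← mulOpHom_apply, map_zero, zero_mul]
      exact isCompactOperator_zero
    · intro f g hf hg
      rw [← mulOpHom_apply, map_add, add_mul]
      exact hf.add hg
    · intro c f hf
      rw [← mulOpHom_apply, map_smul, smul_mul_assoc]
      exact hf.smul c
  · exact isCompactOperator_zero
  · intro S T hS hT; exact hS.add hT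
  · intro c T hT; exact hT.smul c

end CompactOperators

/-! ### Limits checked on a dense subspace. -/

section Vanishing

variable {α E F : Type*} [NormedAddCommGroup E] [NormedSpace ℂ E] [NormedAddCommGroup F]
  [NormedSpace ℂ F]

/-- The vectors which are sent to `0` in the limit by a family of linear maps. -/
def vanishing (L : α → E →ₗ[ℂ] F) (l : Filter α) : Submodule ℂ E where
  carrier := {T | Tendsto (fun a => L a T) l (𝓝 0)}
  zero_mem' := by simpa using tendsto_const_nhds
  add_mem' {S T} hS hT := by simpa using Tendsto.add hS hT
  smul_mem' c T hT := by simpa using Tendsto.const_smul hT c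

theorem mem_vanishing {L : α → E →ₗ[ℂ] F} {l : Filter α} {T : E} :
    T ∈ vanishing L l ↔ Tendsto (fun a => L a T) l (𝓝 0) := Iff.rfl

/-- The uniform bound lets the approximation error be controlled independently of the index. Limits
of uniformly bounded families thus need checking on generators only. -/
theorem isClosed_vanishing {L : α → E →ₗ[ℂ] F} {C : ℝ} (hL : ∀ a T, ‖L a T‖ ≤ C * ‖T‖)
    (l : Filter α) : IsClosed (vanishing L l : Set E) := by
  refine isClosed_of_closure_subset fun T hT => ?_
  rw [SetLike.mem_coe, mem_vanishing, Metric.tendsto_nhds]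
  intro ε hε
  obtain ⟨S, hS, hTS⟩ := Metric.mem_closure_iff.1 hT (ε / (2 * (|C| + 1))) (by positivity)
  filter_upwards [Metric.tendsto_nhds.1 (mem_vanishing.1 hS) (ε / 2) (half_pos hε)] with a ha
  rw [dist_zero_right] at *
  have h1 : L a T = L a (T - S) + L a S := by simp
  have h2 : ‖L a (T - S)‖ ≤ ε / 2 := by
    rw [dist_eq_norm] at hTS
    calc _ ≤ C * ‖T - S‖ := hL a _
      _ ≤ (|C| + 1) * (ε / (2 * (|C| + 1))) := by
        gcongr
        linarith [le_abs_self C]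
      _ = ε / 2 := by field_simp
  rw [h1]
  linarith [norm_add_le (L a (T - S)) (L a S)]

end Vanishing

/-! ### Crossed products lie in `𝓒(X)`. -/

section HamAlgebra

variable {X : Type*} [NormedAddCommGroup X] [InnerProductSpace ℝ X] [FiniteDimensional ℝ X]
  [MeasurableSpace X] [BorelSpace X]

theorem norm_charFun_le (x : X) : ‖charFun x‖ ≤ 1 :=
  (BoundedContinuousFunction.norm_le zero_le_one).2 fun y => (norm_charFun_apply x y).le

theorem charFun_apply_add (z k ξ : X) : charFun z (k + ξ) = charFun z k * charFun z ξ := by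
  change ((𝐞 ⟪k + ξ, z⟫_ℝ : Circle) : ℂ) = (𝐞 ⟪k, z⟫_ℝ : Circle) * (𝐞 ⟪ξ, z⟫_ℝ : Circle)
  rw [inner_add_left, AddChar.map_add_eq_mul, Circle.coe_mul]

theorem charFun_apply_comm (z k : X) : charFun z k = charFun k z := by
  change ((𝐞 ⟪k, z⟫_ℝ : Circle) : ℂ) = (𝐞 ⟪z, k⟫_ℝ : Circle)
  rw [real_inner_comm]

theorem norm_charFun_sub_one_le (x ξ : X) : ‖charFun x ξ - 1‖ ≤ 2 * Real.pi * (‖ξ‖ * ‖x‖) := by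
  have h1 : charFun x ξ = Complex.exp (Complex.I * ((2 * Real.pi * ⟪ξ, x⟫_ℝ : ℝ) : ℂ)) := by
    change ((𝐞 ⟪ξ, x⟫_ℝ : Circle) : ℂ) = _
    rw [Real.fourierChar_apply, mul_comm]
  rw [h1]
  refine Real.norm_exp_I_mul_ofReal_sub_one_le.trans ?_
  rw [norm_mul, Real.norm_of_nonneg (by positivity)]
  gcongr
  exact norm_inner_le_norm ξ x

/-- Outside a large ball `ψ` is small, and on the ball the character is uniformly close to `1`. -/
theorem tendsto_charFun_sub_one_mul (ψ : C₀(X, ℂ)) :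
    Tendsto (fun x : X => (charFun x - 1) * ψ.toBCF) (𝓝 0) (𝓝 0) := by
  rw [Metric.tendsto_nhds]
  intro ε hε
  have h := ψ.zero_at_infty'.eventually (Metric.ball_mem_nhds 0 (half_pos (half_pos hε)))
  rw [← Metric.cobounded_eq_cocompact, ← comap_norm_atTop, eventually_comap] at h
  obtain ⟨R, hR⟩ := eventually_atTop.1 h
  have hlim : Tendsto (fun x : X => 2 * Real.pi * (|R| * ‖x‖) * ‖ψ.toBCF‖) (𝓝 0) (𝓝 0) := by
    have : Continuous fun x : X => 2 * Real.pi * (|R| * ‖x‖) * ‖ψ.toBCF‖ := by fun_prop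
    simpa using this.tendsto 0
  filter_upwards [Metric.tendsto_nhds.1 hlim (ε / 2) (half_pos hε)] with x hx
  rw [dist_zero_right] at *
  rw [Real.norm_of_nonneg (by positivity)] at hx
  refine lt_of_le_of_lt ?_ (half_lt_self hε)
  refine (BoundedContinuousFunction.norm_le (half_pos hε).le).2 fun ξ => ?_
  have e : ((charFun x - 1) * ψ.toBCF) ξ = (charFun x ξ - 1) * ψ ξ := rfl
  rw [e, norm_mul]
  rcases le_total R ‖ξ‖ with hξ | hξ
  · have h1 : ‖ψ ξ‖ < ε / 2 / 2 := by simpa using hR _ hξ ξ rfl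
    have h2 : ‖charFun x ξ - 1‖ ≤ 2 := by
      refine (norm_sub_le _ _).trans ?_
      rw [norm_charFun_apply, norm_one]; norm_num
    calc _ ≤ 2 * (ε / 2 / 2) := by gcongr
      _ = ε / 2 := by ring
  · refine le_trans ?_ hx.le
    refine mul_le_mul ?_ (ψ.toBCF.norm_coe_le_norm ξ) (norm_nonneg _) (by positivity)
    refine (norm_charFun_sub_one_le x ξ).trans ?_
    gcongr
    exact hξ.trans (le_abs_self R)

/-- The relation `ψ(P) V_k = V_k ψ(P + k)`. By density `ψ` may be taken to be the symbol of some
`f`; then both sides have the same kernel, because a character is multiplicative. -/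
theorem momentumOp_mul_mulOp_charFun (ψ : C₀(X, ℂ)) (k : X) :
    momentumOp ψ.toBCF * mulOp (charFun k) =
      mulOp (charFun k) * momentumOp (shift k ψ.toBCF) := by
  refine mem_of_forall_symbol_mem (C := {ψ | momentumOp ψ * mulOp (charFun k) =
      mulOp (charFun k) * momentumOp (shift k ψ)}) (isClosed_eq
        (continuous_momentumOp.mul continuous_const)
        (continuous_const.mul (continuous_momentumOp.comp (continuous_shift k))))
    (fun f hf hc hi => ?_) ψ
  have hgc : Continuous fun z => f z * charFun z k := hf.mul (continuous_charFun_left k)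
  have h1 : shift k (symbol f hi).toBCF = (symbol _ (integrable_mul_charFun hi k)).toBCF := by
    ext ξ
    change symbol f hi (k + ξ) = symbol _ (integrable_mul_charFun hi k) ξ
    rw [symbol_apply, symbol_apply]
    refine integral_congr_ae (Eventually.of_forall fun z => ?_)
    simp only [charFun_apply_add, mul_assoc]
  change momentumOp (symbol f hi).toBCF * mulOp (charFun k) = _ * momentumOp (shift k _)
  rw [h1]
  ext1 w
  rw [isIntegralOp_momentumOp_symbol_mul (charFun k) hf hc hi w,
    isIntegralOp_mul_momentumOp_symbol (charFun k) hgc hc.mul_right _ w]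
  refine integral_congr_ae (Eventually.of_forall fun z => ?_)
  have h2 : f z • shift z (charFun k) = (f z * charFun z k) • charFun k := by
    ext y
    change f z * charFun k (z + y) = f z * charFun z k * charFun k y
    rw [charFun_apply_add, charFun_apply_comm k z, mul_assoc]
  simp only [h2]

/-- On a generator, `(U_x - 1) φ(Q) ψ(P)` splits into a variation of `φ`, small by uniform
continuity, and `φ(Q) (U_x - 1) ψ(P)`, small by decay of `ψ`. The commutator with `V_k` is governed
by `ψ(P + k) - ψ(P)`. Adjoints need no separate argument since the crossed product is closed under
`star`. -/
theorem crossedProduct_subset_hamAlgebra {𝒜 : Submodule ℂ (X →ᵇ ℂ)}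
    (h𝒜 : IsTranslationAlgebra 𝒜) : (crossedProduct 𝒜 : Set (BddOp X)) ⊆ hamAlgebra X := by
  have key : ∀ T ∈ crossedProduct 𝒜,
      Tendsto (fun x : X => (transOp x - 1) * T) (𝓝 0) (𝓝 0) := by
    intro T hT
    have hcl := isClosed_vanishing (L := fun x : X => LinearMap.mulLeft ℂ (transOp x - 1))
      (C := 2) (fun x T => ?_) (𝓝 0)
    · refine crossedProduct_induction (p := fun T => T ∈ vanishing
        (fun x : X => LinearMap.mulLeft ℂ (transOp x - 1)) (𝓝 0)) ?_ (Submodule.zero_mem _)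
        (fun _ _ => Submodule.add_mem _) (fun c _ => Submodule.smul_mem _ c) hcl hT
      intro φ hφ ψ
      rw [mem_vanishing]
      have e : ∀ x, (transOp x - 1) * (mulOp φ * momentumOp ψ.toBCF) =
          mulOp (shift x φ - φ) * (transOp x * momentumOp ψ.toBCF) +
          mulOp φ * momentumOp ((charFun x - 1) * ψ.toBCF) := by
        intro x
        have e1 : mulOp (shift x φ - φ) = mulOp (shift x φ) - mulOp φ := map_sub mulOpHom _ _
        have e2 : momentumOp ((charFun x - 1) * ψ.toBCF) = (transOp x - 1) * momentumOp ψ.toBCF := by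
          rw [transOp_eq_momentumOp]
          simp only [← momentumOpHom_apply, map_mul, map_sub, map_one]
        rw [e1, e2, sub_mul, sub_mul, ← mul_assoc, ← mul_assoc, transOp_mul_mulOp]
        noncomm_ring
      simp only [LinearMap.mulLeft_apply, e]
      rw [← add_zero (0 : BddOp X)]
      refine Tendsto.add ?_ ?_
      · have h1 : Tendsto (fun x => ‖shift x φ - φ‖ * ‖momentumOp ψ.toBCF‖) (𝓝 0) (𝓝 0) := by
          have h := (((continuous_shift_left (h𝒜.uniformContinuous φ hφ)).sub
            continuous_const).norm.mul continuous_const).tendsto (0 : X)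
            (f := fun x => ‖shift x φ - φ‖ * ‖momentumOp ψ.toBCF‖)
          have e0 : shift 0 φ = φ := by ext; simp
          simpa [e0] using h
        refine squeeze_zero_norm (fun x => ?_) h1
        refine (norm_mul_le _ _).trans ?_
        gcongr
        · exact norm_mulOp_le _
        · refine (norm_mul_le _ _).trans ?_
          exact mul_le_of_le_one_left (norm_nonneg _) (norm_transOp_le x)
      · have h2 := (continuous_momentumOp.tendsto 0).comp (tendsto_charFun_sub_one_mul ψ)
        have h3 := h2.const_mul (mulOp φ)
        rwa [← momentumOpHom_apply, map_zero, mul_zero] at h3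
    · simp only [LinearMap.mulLeft_apply]
      refine (norm_mul_le _ _).trans ?_
      gcongr
      refine (norm_sub_le _ _).trans ?_
      have h1 := norm_transOp_le x
      have h2 : ‖(1 : BddOp X)‖ ≤ 1 := ContinuousLinearMap.norm_id_le
      linarith
  intro T hT
  refine ⟨?_, ?_, ?_⟩
  · have hcl := isClosed_vanishing (L := fun k : X => LinearMap.mulRight ℂ (mulOp (charFun k)) -
      LinearMap.mulLeft ℂ (mulOp (charFun k))) (C := 2) (fun x T => ?_) (𝓝 0)
    · suffices T ∈ vanishing (fun k : X => LinearMap.mulRight ℂ (mulOp (charFun k)) -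
          LinearMap.mulLeft ℂ (mulOp (charFun k))) (𝓝 0) from tendsto_zero_iff_norm_tendsto_zero.1 this
      refine crossedProduct_induction (p := fun T => T ∈ vanishing
        (fun k : X => LinearMap.mulRight ℂ (mulOp (charFun k)) -
          LinearMap.mulLeft ℂ (mulOp (charFun k))) (𝓝 0)) ?_ (Submodule.zero_mem _)
        (fun _ _ => Submodule.add_mem _) (fun c _ => Submodule.smul_mem _ c) hcl hT
      intro φ hφ ψ
      rw [mem_vanishing]
      have e : ∀ k, mulOp φ * momentumOp ψ.toBCF * mulOp (charFun k) -
          mulOp (charFun k) * (mulOp φ * momentumOp ψ.toBCF) =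
          mulOp φ * mulOp (charFun k) * momentumOp (shift k ψ.toBCF - ψ.toBCF) := by
        intro k
        have e1 : momentumOp (shift k ψ.toBCF - ψ.toBCF) =
          momentumOp (shift k ψ.toBCF) - momentumOp ψ.toBCF := map_sub momentumOpHom _ _
        have e2 : mulOp (charFun k) * mulOp φ = mulOp φ * mulOp (charFun k) := by
          simp only [← mulOpHom_apply, ← map_mul, mul_comm]
        rw [e1, mul_assoc, momentumOp_mul_mulOp_charFun, ← mul_assoc _ (mulOp φ), e2]
        noncomm_ring
      simp only [LinearMap.sub_apply, LinearMap.mulLeft_apply, LinearMap.mulRight_apply, e]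
      have h1 : Tendsto (fun k => ‖φ‖ * ‖shift k ψ.toBCF - ψ.toBCF‖) (𝓝 0) (𝓝 0) := by
        have h := (continuous_const.mul ((continuous_shift_left
          (ZeroAtInftyContinuousMap.uniformContinuous ψ)).sub
          continuous_const).norm).tendsto (0 : X)
          (f := fun k => ‖φ‖ * ‖shift k ψ.toBCF - ψ.toBCF‖)
        have e0 : shift 0 ψ.toBCF = ψ.toBCF := by ext; simp
        simpa [e0] using h
      refine squeeze_zero_norm (fun k => ?_) h1
      calc _ ≤ ‖mulOp φ‖ * ‖mulOp (charFun k)‖ * ‖momentumOp (shift k ψ.toBCF - ψ.toBCF)‖ :=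
            (norm_mul_le _ _).trans (mul_le_mul_of_nonneg_right (norm_mul_le _ _) (norm_nonneg _))
        _ ≤ ‖φ‖ * 1 * ‖shift k ψ.toBCF - ψ.toBCF‖ := by
            gcongr
            · exact norm_mulOp_le _
            · exact (norm_mulOp_le _).trans (norm_charFun_le k)
            · exact norm_momentumOp_le _
        _ = _ := by rw [mul_one]
    · have h := (norm_mulOp_le (charFun x)).trans (norm_charFun_le x)
      simp only [LinearMap.sub_apply, LinearMap.mulLeft_apply, LinearMap.mulRight_apply]
      refine (norm_sub_le _ _).trans ?_
      have h1 := norm_mul_le T (mulOp (charFun x))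
      have h2 := norm_mul_le (mulOp (charFun x)) T
      nlinarith [norm_nonneg T]
  · exact tendsto_zero_iff_norm_tendsto_zero.1 (key T hT)
  · exact tendsto_zero_iff_norm_tendsto_zero.1
      (key _ ((crossedProductAlgebra h𝒜).star_mem' hT))

end HamAlgebra

/-! ### Limits of `U_y T U_y^*` along escaping filters. -/

section Limits

variable {X : Type*} [NormedAddCommGroup X] [InnerProductSpace ℝ X] [FiniteDimensional ℝ X]
  [MeasurableSpace X] [BorelSpace X]

theorem crossedProduct_le_of_forall_mem {F : Set (Submodule ℝ X)} {V : Submodule ℂ (BddOp X)}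
    (hV : IsClosed (V : Set (BddOp X)))
    (hgen : ∀ Z ∈ F, ∀ φ ∈ quotientC0 Z, ∀ ψ : C₀(X, ℂ), mulOp φ * momentumOp ψ.toBCF ∈ V) :
    crossedProduct (grassmannAlgebraOf F) ≤ V := by
  intro T hT
  refine crossedProduct_induction (p := fun T => T ∈ V) (fun φ hφ ψ => ?_) V.zero_mem
    (fun _ _ => V.add_mem) (fun c _ => V.smul_mem c) hV hT
  refine grassmannAlgebraOf_induction (p := fun φ => mulOp φ * momentumOp ψ.toBCF ∈ V)
    (fun Z hZ φ hφ => hgen Z hZ φ hφ ψ) ?_ ?_ ?_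
    (hV.preimage ((continuous_mul_const (momentumOp ψ.toBCF)).comp continuous_mulOp)) hφ
  · rw [← mulOpHom_apply, map_zero, zero_mul]; exact V.zero_mem
  · intro f g hf hg
    rw [← mulOpHom_apply, map_add, add_mul]; exact V.add_mem hf hg
  · intro c f hf
    rw [← mulOpHom_apply, map_smul, smul_mul_assoc]; exact V.smul_mem c hf

theorem mul_mem_crossedProduct_grassmann {F : Set (Submodule ℝ X)} {Z : Submodule ℝ X} (hZ : Z ∈ F)
    {φ : X →ᵇ ℂ} (hφ : φ ∈ quotientC0 Z) (ψ : C₀(X, ℂ)) :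
    mulOp φ * momentumOp ψ.toBCF ∈ crossedProduct (grassmannAlgebraOf F) :=
  mul_mem_crossedProduct (quotientC0_subset_grassmannAlgebraOf hZ hφ) ψ

theorem crossedProduct_mono {F G : Set (Submodule ℝ X)} (h : F ⊆ G) :
    crossedProduct (grassmannAlgebraOf F) ≤ crossedProduct (grassmannAlgebraOf G) :=
  crossedProduct_le_of_forall_mem (isClosed_crossedProduct _)
    fun _ hZ _ hφ ψ => mul_mem_crossedProduct_grassmann (h hZ) hφ ψ

/-- Convergence with respect to the seminorms `csSeminorms`. -/
def LocTendsto {α : Type*} (F : α → BddOp X) (l : Filter α) (T : BddOp X) : Prop :=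
  ∀ θ : C₀(X, ℂ), Tendsto (fun a => (F a - T) * mulOp θ.toBCF) l (𝓝 0) ∧
    Tendsto (fun a => mulOp θ.toBCF * (F a - T)) l (𝓝 0)

theorem tendstoCs_of_locTendsto {α : Type*} {F : α → BddOp X} {l : Filter α} {T : BddOp X}
    (hF : ∀ a, F a ∈ hamAlgebra X) (hT : T ∈ hamAlgebra X) (h : LocTendsto F l T) :
    TendstoCs F l T := by
  refine ⟨hF, hT, ?_⟩
  -- `BddOp X` carries its norm topology by default, so the topology of the seminorms is named
  -- explicitly.
  have hws : @WithSeminorms ℂ (BddOp X) C₀(X, ℂ) _ _ _ (csSeminorms X)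
    (csSeminorms X).moduleFilterBasis.topology :=
      @WithSeminorms.mk _ _ _ _ _ _ _ (csSeminorms X).moduleFilterBasis.topology rfl
  rw [@nhds_induced _ _ (csSeminorms X).moduleFilterBasis.topology, tendsto_comap_iff]
  refine (@WithSeminorms.tendsto_nhds _ _ _ _ _ _ _
    (csSeminorms X).moduleFilterBasis.topology _ hws F l T).2 fun θ ε hε => ?_
  have h1 := (h θ).1.norm.add (h θ).2.norm
  rw [norm_zero, add_zero] at h1
  filter_upwards [h1.eventually (gt_mem_nhds hε)] with a ha
  exact ha

/-- Conjugation by `U_y` as a linear map. -/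
def translateₗ (y : X) : BddOp X →ₗ[ℂ] BddOp X where
  toFun := translate y
  map_add' := translate_add y
  map_smul' := translate_smul y

/-- The pairs `(T, S)` such that `U_y T U_y^*` converges to `S` along `l`. -/
def limitGraph (l : Filter X) : Submodule ℂ (BddOp X × BddOp X) :=
  ⨅ θ : C₀(X, ℂ),
    vanishing (fun y => LinearMap.mulRight ℂ (mulOp θ.toBCF) ∘ₗ
      (translateₗ y ∘ₗ LinearMap.fst ℂ _ _ - LinearMap.snd ℂ _ _)) l ⊓
    vanishing (fun y => LinearMap.mulLeft ℂ (mulOp θ.toBCF) ∘ₗ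
      (translateₗ y ∘ₗ LinearMap.fst ℂ _ _ - LinearMap.snd ℂ _ _)) l

theorem mem_limitGraph {l : Filter X} {p : BddOp X × BddOp X} :
    p ∈ limitGraph l ↔ LocTendsto (fun y => translate y p.1) l p.2 := by
  simp only [limitGraph, Submodule.mem_iInf, Submodule.mem_inf, mem_vanishing]
  rfl

theorem isClosed_limitGraph (l : Filter X) :
    IsClosed (limitGraph l : Set (BddOp X × BddOp X)) := by
  have h : ∀ (y : X) (p : BddOp X × BddOp X), ‖translate y p.1 - p.2‖ ≤ 2 * ‖p‖ := by
    intro y p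
    have h1 := norm_sub_le (translate y p.1) p.2
    have h2 := norm_translate_le y p.1
    linarith [norm_fst_le p, norm_snd_le p]
  simp only [limitGraph, Submodule.coe_iInf, Submodule.coe_inf]
  refine isClosed_iInter fun θ => (isClosed_vanishing (C := 2 * ‖mulOp θ.toBCF‖) ?_ l).inter
    (isClosed_vanishing (C := 2 * ‖mulOp θ.toBCF‖) ?_ l)
  · intro y p
    change ‖(translate y p.1 - p.2) * mulOp θ.toBCF‖ ≤ _
    refine (norm_mul_le _ _).trans ?_
    nlinarith [h y p, norm_nonneg (mulOp θ.toBCF)]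
  · intro y p
    change ‖mulOp θ.toBCF * (translate y p.1 - p.2)‖ ≤ _
    refine (norm_mul_le _ _).trans ?_
    nlinarith [h y p, norm_nonneg (mulOp θ.toBCF)]

theorem exists_mulOp_compactlySupportedL2_eq (a : X →ᵇ ℂ) (ha : HasCompactSupport a) :
    ∃ θ : C₀(X, ℂ), mulOp θ.toBCF (compactlySupportedL2 a ha) = compactlySupportedL2 a ha := by
  obtain ⟨χ, h1, -, hc, -⟩ := exists_continuous_one_zero_of_isCompact ha.isCompact isClosed_empty
    (Set.disjoint_empty _)
  have hc' : HasCompactSupport fun x => (χ x : ℂ) :=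
    hc.comp_left (g := fun r : ℝ => (r : ℂ)) Complex.ofReal_zero
  refine ⟨⟨⟨fun x => (χ x : ℂ), by fun_prop⟩, hc'.is_zero_at_infty⟩, Lp.ext ?_⟩
  filter_upwards [mulOp_ae _ (compactlySupportedL2 a ha), compactlySupportedL2_ae a ha] with x h2 h3
  rw [h2, h3]
  change (χ x : ℂ) * a x = a x
  by_cases hx : x ∈ tsupport a
  · simp [h1 hx]
  · rw [image_eq_zero_of_notMem_tsupport hx, mul_zero]

/-- A compactly supported vector equals `θ(Q)` of itself for a suitable cut-off `θ`, so the
seminorms control the family on a dense set. Boundedness extends this to strong convergence. -/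
theorem LocTendsto.tendsto_apply {α : Type*} {F : α → BddOp X} {l : Filter α} {T : BddOp X}
    (h : LocTendsto F l T) {C : ℝ} (hC : ∀ a, ‖F a‖ ≤ C) (u : L2 X) :
    Tendsto (fun a => F a u) l (𝓝 (T u)) := by
  have hcl := isClosed_vanishing (L := fun a => ((F a - T : BddOp X) : L2 X →ₗ[ℂ] L2 X))
    (C := C + ‖T‖) (fun a u => ?_) l
  · have : u ∈ vanishing (fun a => ((F a - T : BddOp X) : L2 X →ₗ[ℂ] L2 X)) l := by
      refine dense_compactlySupportedL2.induction (P := fun u => u ∈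
        vanishing (fun a => ((F a - T : BddOp X) : L2 X →ₗ[ℂ] L2 X)) l) ?_ hcl u
      rintro _ ⟨a, ha, rfl⟩
      obtain ⟨θ, hθ⟩ := exists_mulOp_compactlySupportedL2_eq a ha
      have h1 := ((ContinuousLinearMap.apply ℂ (L2 X)
        (compactlySupportedL2 a ha)).continuous.tendsto 0).comp (h θ).1
      rw [map_zero] at h1
      rw [mem_vanishing]
      refine h1.congr fun b => ?_
      change (F b - T) (mulOp θ.toBCF (compactlySupportedL2 a ha)) = _
      rw [hθ]; rfl
    exact tendsto_sub_nhds_zero_iff.1 this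
  · refine ((F a - T).le_opNorm u).trans ?_
    gcongr
    exact (norm_sub_le _ _).trans (by gcongr; exact hC a)

theorem LocTendsto.norm_le {α : Type*} {F : α → BddOp X} {l : Filter α} [l.NeBot] {T : BddOp X}
    (h : LocTendsto F l T) {C : ℝ} (hC : ∀ a, ‖F a‖ ≤ C) : ‖T‖ ≤ C := by
  obtain ⟨a⟩ := l.nonempty_of_neBot
  refine T.opNorm_le_bound ((norm_nonneg _).trans (hC a)) fun u => ?_
  exact le_of_tendsto (h.tendsto_apply hC u).norm
    (Eventually.of_forall fun a => (F a).le_of_opNorm_le (hC a) u)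

theorem LocTendsto.adjoint {α : Type*} {F : α → BddOp X} {l : Filter α} {T : BddOp X}
    (h : LocTendsto F l T) : LocTendsto (fun a => star (F a)) l (star T) := by
  intro θ
  have h1 : (star θ : C₀(X, ℂ)).toBCF = star θ.toBCF := rfl
  obtain ⟨h2, h3⟩ := h (star θ)
  constructor
  · have := h3.star
    rw [star_zero] at this
    refine this.congr fun a => ?_
    rw [star_mul, star_sub, h1, ← mulOpHom_apply, map_star, star_star, mulOpHom_apply]
  · have := h2.star
    rw [star_zero] at this
    refine this.congr fun a => ?_
    rw [star_mul, star_sub, h1, ← mulOpHom_apply, map_star, star_star, mulOpHom_apply]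

/-- A filter on a subspace `Y` which escapes to infinity modulo every subspace not containing
`Y`. -/
structure IsEscaping (l : Filter X) (Y : Submodule ℝ X) : Prop where
  eventually_mem : ∀ᶠ y in l, y ∈ Y
  tendsto : ∀ Z : Submodule ℝ X, ¬ Y ≤ Z → Tendsto (fun y => ‖Z.mkQ y‖) l atTop

theorem translate_generator (y : X) (φ ψ : X →ᵇ ℂ) :
    translate y (mulOp φ * momentumOp ψ) = mulOp (shift y φ) * momentumOp ψ := by
  rw [translate_mul, translate_mulOp, translate_momentumOp]

theorem shift_eq_self {Y Z : Submodule ℝ X} (hYZ : Y ≤ Z) {φ : X →ᵇ ℂ} (hφ : φ ∈ quotientC0 Z)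
    {y : X} (hy : y ∈ Y) : shift y φ = φ := by
  ext x
  rw [shift_apply, add_comm]
  exact (mem_quotientC0_iff.1 hφ).1 x y (hYZ hy)

theorem locTendsto_generator_of_le {l : Filter X} {Y Z : Submodule ℝ X} (hl : IsEscaping l Y)
    (hYZ : Y ≤ Z) {φ : X →ᵇ ℂ} (hφ : φ ∈ quotientC0 Z) (ψ : X →ᵇ ℂ) :
    LocTendsto (fun y => translate y (mulOp φ * momentumOp ψ)) l (mulOp φ * momentumOp ψ) := by
  intro θ
  constructor <;> refine tendsto_const_nhds.congr' ?_ <;>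
    filter_upwards [hl.eventually_mem] with y hy <;>
    rw [translate_generator, shift_eq_self hYZ hφ hy, sub_self] <;> simp

/-- Where `θ` is not small, `x` stays bounded, so `y + x` is far away modulo `Z` and `φ` is small
there. -/
theorem tendsto_mul_shift {l : Filter X} {Z : Submodule ℝ X}
    (hl : Tendsto (fun y => ‖Z.mkQ y‖) l atTop) {φ θ : X →ᵇ ℂ} (hφ : φ ∈ quotientC0 Z)
    (hθ : θ ∈ quotientC0 (⊥ : Submodule ℝ X)) : Tendsto (fun y => θ * shift y φ) l (𝓝 0) := by
  rw [Metric.tendsto_nhds]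
  intro ε hε
  obtain ⟨R, hR⟩ := (mem_quotientC0_iff.1 hφ).2 (ε / (2 * (‖θ‖ + 1))) (by positivity)
  obtain ⟨S, hS⟩ := (mem_quotientC0_iff.1 hθ).2 (ε / (2 * (‖φ‖ + 1))) (by positivity)
  filter_upwards [hl.eventually_gt_atTop (R + S)] with y hy
  rw [dist_zero_right]
  refine lt_of_le_of_lt ?_ (half_lt_self hε)
  refine (BoundedContinuousFunction.norm_le (half_pos hε).le).2 fun x => ?_
  rw [BoundedContinuousFunction.mul_apply, shift_apply, norm_mul]
  by_cases hx : S < ‖x‖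
  · have h1 := hS x (by rwa [norm_mkQ_bot])
    have h2 := φ.norm_coe_le_norm (y + x)
    calc _ ≤ ε / (2 * (‖φ‖ + 1)) * (‖φ‖ + 1) := by gcongr; linarith
      _ = ε / 2 := by field_simp
  · have h3 : R < ‖Z.mkQ (y + x)‖ := by
      have h4 := norm_sub_le (Z.mkQ (y + x)) (Z.mkQ x)
      rw [← map_sub, add_sub_cancel_right] at h4
      have h5 : ‖Z.mkQ x‖ ≤ ‖x‖ := Submodule.Quotient.norm_mk_le Z x
      linarith
    have h1 := hR _ h3
    have h2 := θ.norm_coe_le_norm x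
    calc _ ≤ (‖θ‖ + 1) * (ε / (2 * (‖θ‖ + 1))) := by gcongr; linarith
      _ = ε / 2 := by field_simp

/-- With `θ(Q)` on the left, the localization meets `φ(· + y)` directly. On the right it is
separated from it by `ψ(P)` and has to be moved across first. -/
theorem locTendsto_generator_zero {l : Filter X} {Z : Submodule ℝ X}
    (hl : Tendsto (fun y => ‖Z.mkQ y‖) l atTop) {φ : X →ᵇ ℂ} (hφ : φ ∈ quotientC0 Z)
    (ψ : C₀(X, ℂ)) :
    LocTendsto (fun y => translate y (mulOp φ * momentumOp ψ.toBCF)) l 0 := by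
  have key : ∀ θ : X →ᵇ ℂ, θ ∈ quotientC0 (⊥ : Submodule ℝ X) → ∀ η : C₀(X, ℂ),
      Tendsto (fun y => mulOp (θ * shift y φ) * momentumOp η.toBCF) l (𝓝 0) := by
    intro θ hθ η
    have h := ((continuous_mulOp.tendsto 0).comp (tendsto_mul_shift hl hφ hθ)).mul_const
      (momentumOp η.toBCF)
    rwa [← mulOpHom_apply, map_zero, zero_mul] at h
  intro θ
  constructor
  · have hcl := isClosed_vanishing (L := fun y => LinearMap.mulLeft ℂ (mulOp (shift y φ)))
      (C := ‖φ‖) (fun y T => ?_) l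
    -- The operator `ψ(P) θ(Q)` lies in the crossed product by `C₀(X)`, hence is a norm limit of
    -- sums of `χ(Q) η(P)` with `χ` vanishing at infinity, and such a `χ` stands next to `φ(· + y)`.
    · have h1 := crossedProduct_le_of_forall_mem (F := {⊥}) hcl (fun Z hZ χ hχ η => ?_)
        (momentumOp_mul_mem_crossedProduct
          (isTranslationAlgebra_grassmannAlgebraOf (by rintro _ rfl _ rfl; simp))
          (quotientC0_subset_grassmannAlgebraOf (Set.mem_singleton _)
            (toBCF_mem_quotientC0_bot θ)) ψ)
      · rw [mem_vanishing] at h1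
        refine h1.congr fun y => ?_
        change mulOp (shift y φ) * _ = (translate y (_ * _) - 0) * _
        rw [translate_generator, sub_zero, mul_assoc]
      · rw [Set.mem_singleton_iff] at hZ
        subst hZ
        rw [mem_vanishing]
        refine (key χ hχ η).congr fun y => ?_
        rw [LinearMap.mulLeft_apply, ← mul_assoc, mul_comm χ]
        simp only [← mulOpHom_apply, map_mul]
    · refine (norm_mul_le _ _).trans ?_
      gcongr
      exact (norm_mulOp_le _).trans (norm_shift y φ).le
  · refine (key θ.toBCF (toBCF_mem_quotientC0_bot θ) ψ).congr fun y => ?_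
    change _ = _ * (translate y (_ * _) - 0)
    rw [translate_generator, sub_zero, ← mul_assoc]
    simp only [← mulOpHom_apply, map_mul]

/-- The operators `T` such that `U_y T U_y^*` converges to `T` along `l`. -/
def limitFix (l : Filter X) : Submodule ℂ (BddOp X) where
  carrier := {T | (T, T) ∈ limitGraph l}
  zero_mem' := (limitGraph l).zero_mem
  add_mem' := fun h1 h2 => (limitGraph l).add_mem h1 h2
  smul_mem' := fun c _ h => (limitGraph l).smul_mem c h

theorem mem_limitFix {l : Filter X} {T : BddOp X} :
    T ∈ limitFix l ↔ LocTendsto (fun y => translate y T) l T :=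
  mem_limitGraph (p := (T, T))

theorem isClosed_limitFix (l : Filter X) : IsClosed (limitFix l : Set (BddOp X)) := by
  have hc : Continuous fun T : BddOp X => (T, T) := continuous_id.prodMk continuous_id
  exact (isClosed_limitGraph l).preimage hc

theorem locTendsto_of_mem_crossedProduct {l : Filter X} {Y : Submodule ℝ X} (hl : IsEscaping l Y)
    {T : BddOp X} (hT : T ∈ crossedProduct (grassmannAlgebraOf (Set.Ici Y))) :
    LocTendsto (fun y => translate y T) l T :=
  mem_limitFix.1 (crossedProduct_le_of_forall_mem (isClosed_limitFix l)
    (fun _ hZ _ hφ ψ => mem_limitFix.2 (locTendsto_generator_of_le hl hZ hφ ψ.toBCF)) hT)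

/-- The bound says that `G` is the graph of a contraction. A closed graph is complete, and
projecting it to the domain does not decrease the norm by antilipschitz control, so the domain is
closed. -/
theorem isClosed_map_fst {E : Type*} [NormedAddCommGroup E] [NormedSpace ℂ E] [CompleteSpace E]
    {G : Submodule ℂ (E × E)} (hG : IsClosed (G : Set (E × E))) (h : ∀ p ∈ G, ‖p.2‖ ≤ ‖p.1‖) :
    IsClosed (G.map (LinearMap.fst ℂ E E) : Set E) := by
  have : CompleteSpace G := hG.completeSpace_coe
  let f : G →L[ℂ] E := (ContinuousLinearMap.fst ℂ E E).comp G.subtypeL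
  have hf : AntilipschitzWith 1 f := by
    refine AddMonoidHomClass.antilipschitz_of_bound f fun p => ?_
    rw [NNReal.coe_one, one_mul]
    exact max_le le_rfl (h p p.2)
  have h1 := hf.isClosed_range f.uniformContinuous
  convert h1 using 1
  ext t
  simp [f]

attribute [irreducible] limitGraph

/-- One operator `S` serves every escaping filter: the pairs that work for all of them at once form
a closed subspace, which is the graph of a contraction because `l₀` is nontrivial. Its domain is
closed and contains all generators. -/
theorem exists_limit {Y : Submodule ℝ X} (l₀ : Filter X) [l₀.NeBot] (hl₀ : IsEscaping l₀ Y)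
    {T : BddOp X} (hT : T ∈ crossedProduct (grassmannAlgebraOf Set.univ)) :
    ∃ S ∈ crossedProduct (grassmannAlgebraOf (Set.Ici Y)),
      ∀ l : Filter X, IsEscaping l Y → LocTendsto (fun y => translate y T) l S := by
  let G : Submodule ℂ (BddOp X × BddOp X) :=
    (⨅ l : {l : Filter X // IsEscaping l Y}, limitGraph l.1) ⊓
      (crossedProduct (grassmannAlgebraOf (Set.Ici Y))).comap (LinearMap.snd ℂ _ _)
  have hG : ∀ p, p ∈ G ↔ (∀ l : Filter X, IsEscaping l Y →
      LocTendsto (fun y => translate y p.1) l p.2) ∧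
        p.2 ∈ crossedProduct (grassmannAlgebraOf (Set.Ici Y)) := by
    intro p
    simp only [G, Submodule.mem_inf, Submodule.mem_iInf, mem_limitGraph, Subtype.forall,
      Submodule.mem_comap, LinearMap.snd_apply]
  have hGc : IsClosed (G : Set (BddOp X × BddOp X)) := by
    simp only [G, Submodule.coe_inf, Submodule.coe_iInf]
    refine (isClosed_iInter fun l : {l : Filter X // IsEscaping l Y} =>
      isClosed_limitGraph l.1).inter ?_
    exact (isClosed_crossedProduct (grassmannAlgebraOf (Set.Ici Y))).preimage continuous_snd
  have hGn : ∀ p ∈ G, ‖p.2‖ ≤ ‖p.1‖ := fun p hp =>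
    (((hG p).1 hp).1 l₀ hl₀).norm_le fun y => norm_translate_le y p.1
  have hV : T ∈ G.map (LinearMap.fst ℂ _ _) := by
    refine crossedProduct_le_of_forall_mem (isClosed_map_fst hGc hGn) (fun Z hZ φ hφ ψ => ?_) hT
    by_cases hYZ : Y ≤ Z
    · refine ⟨(_, mulOp φ * momentumOp ψ.toBCF), (hG _).2 ⟨fun l hl => ?_, ?_⟩, rfl⟩
      · exact locTendsto_generator_of_le hl hYZ hφ ψ.toBCF
      · exact mul_mem_crossedProduct_grassmann hYZ hφ ψ
    · refine ⟨(_, 0), (hG _).2 ⟨fun l hl => ?_, Submodule.zero_mem _⟩, rfl⟩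
      exact locTendsto_generator_zero (hl.tendsto Z hYZ) hφ ψ
  obtain ⟨p, hp, rfl⟩ := hV
  exact ⟨p.2, ((hG p).1 hp).2, ((hG p).1 hp).1⟩

end Limits

/-! ### Filters escaping to infinity modulo subspaces. -/

section Escaping

variable {X : Type*} [NormedAddCommGroup X] [InnerProductSpace ℝ X] [FiniteDimensional ℝ X]

/-- A lower bound for the quotient norm: `v` annihilates `Z`, so any representative may be used in
Cauchy-Schwarz. -/
theorem exists_abs_inner_le_norm_mkQ {Z : Submodule ℝ X} {v : X} (hv : v ∈ Zᗮ) (x : X) :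
    |⟪v, x⟫_ℝ| ≤ ‖v‖ * ‖Z.mkQ x‖ := by
  refine le_of_forall_pos_lt_add fun ε hε => ?_
  have h : ‖Z.mkQ x‖ < ‖Z.mkQ x‖ + ε / (‖v‖ + 1) := lt_add_of_pos_right _ (by positivity)
  obtain ⟨y, hy, z, hz, rfl⟩ := exists_mem_add_of_norm_mkQ_lt Z h
  rw [inner_add_right, (Submodule.mem_orthogonal' Z v).1 hv y hy, zero_add]
  have h1 := abs_real_inner_le_norm v z
  have h2 : ‖v‖ * ‖z‖ ≤ ‖v‖ * (‖Z.mkQ (y + z)‖ + ε / (‖v‖ + 1)) := by gcongr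
  have h3 : ‖v‖ * (ε / (‖v‖ + 1)) < ε := by
    rw [mul_div_assoc', div_lt_iff₀ (by positivity)]
    nlinarith
  linarith

open Polynomial in
/-- A filter on a subspace escaping modulo every subspace which does not contain it: the image
of `atTop` under a curve of moments. -/
theorem exists_neBot_isEscaping (Y : Submodule ℝ X) : ∃ l : Filter X, l.NeBot ∧ IsEscaping l Y := by
  let b := Module.finBasis ℝ Y
  -- The exponents start at `1`. Pairing with `v` gives a polynomial in `t` without constant term
  -- and with coefficients `⟪v, b i⟫`, so a single nonzero coefficient already forces positive
  -- degree and hence divergence.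
  let γ : ℝ → X := fun t => ∑ i : Fin (Module.finrank ℝ Y), t ^ ((i : ℕ) + 1) • (b i : X)
  refine ⟨map γ atTop, inferInstance, eventually_map.2 (Eventually.of_forall fun t => ?_),
    fun Z hZ => ?_⟩
  · exact Y.sum_mem fun i _ => Y.smul_mem _ (b i).2
  have hb : ∃ i, (b i : X) ∉ Z := by
    by_contra! h
    refine hZ fun y hy => ?_
    have h1 := congrArg (Y.subtype) (b.sum_repr ⟨y, hy⟩)
    rw [map_sum] at h1
    have h2 : ∑ i, (b.repr ⟨y, hy⟩ i) • (b i : X) = y := by simpa using h1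
    rw [← h2]
    exact Z.sum_mem fun i _ => Z.smul_mem _ (h i)
  obtain ⟨i₀, hi₀⟩ := hb
  have hv : ∃ v ∈ Zᗮ, ⟪v, (b i₀ : X)⟫_ℝ ≠ 0 := by
    by_contra! h
    exact hi₀ (by rw [← Z.orthogonal_orthogonal]; exact (Submodule.mem_orthogonal _ _).2 h)
  obtain ⟨v, hvZ, hv⟩ := hv
  have hv0 : 0 < ‖v‖ := norm_pos_iff.2 (by rintro rfl; simp at hv)
  let p : ℝ[X] := ∑ i : Fin (Module.finrank ℝ Y), monomial ((i : ℕ) + 1) ⟪v, (b i : X)⟫_ℝ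
  have hp : ∀ t, p.eval t = ⟪v, γ t⟫_ℝ := by
    intro t
    simp only [p, γ, eval_finsetSum, eval_monomial, inner_sum, inner_smul_right]
    exact Finset.sum_congr rfl fun i _ => mul_comm _ _
  have hpc : p.coeff ((i₀ : ℕ) + 1) = ⟪v, (b i₀ : X)⟫_ℝ := by
    simp only [p, finsetSum_coeff, coeff_monomial]
    rw [Finset.sum_eq_single i₀]
    · simp
    · intro i _ hi
      rw [if_neg]
      simpa [Fin.ext_iff] using hi
    · simp
  have hdeg : 0 < p.degree := by
    refine lt_of_lt_of_le ?_ (le_degree_of_ne_zero (n := (i₀ : ℕ) + 1) (by rwa [hpc]))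
    exact_mod_cast Nat.succ_pos _
  rw [tendsto_map'_iff]
  have h1 := (p.abs_tendsto_atTop hdeg).const_mul_atTop (inv_pos.2 hv0)
  refine tendsto_atTop_mono (fun t => ?_) h1
  rw [hp, inv_mul_le_iff₀ hv0]
  exact exists_abs_inner_le_norm_mkQ hvZ _

/-- The vectors of `Y` that are bounded modulo `Z` lie in a bounded neighbourhood of `Y ∩ Z`, a
strict subspace of `Y`. The Grassmann filter avoids such sets by definition. -/
theorem isEscaping_grassmannFilterOn (Y : Submodule ℝ X) : IsEscaping (grassmannFilterOn Y) Y := by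
  refine ⟨eventually_map.2 (Eventually.of_forall fun y => y.2), fun Z hZ => ?_⟩
  rw [grassmannFilterOn, tendsto_map'_iff, tendsto_atTop]
  intro R
  let f : Y →ₗ[ℝ] X ⧸ Z := Z.mkQ ∘ₗ Y.subtype
  obtain ⟨C, hC0, hC⟩ := exists_norm_mkQ_ker_le f
  have hker : LinearMap.ker f ≠ ⊤ := by
    intro h
    refine hZ fun y hy => ?_
    have : f ⟨y, hy⟩ = 0 := LinearMap.mem_ker.1 (h ▸ Submodule.mem_top)
    simpa [f] using this
  -- The factor `C` compares the norm of `Y` modulo `Y ∩ Z` with that of `X` modulo `Z`. The `+ 1`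
  -- gives the strict inequality needed to choose a representative.
  have hmem : (((⋃ W ∈ ({LinearMap.ker f} : Finset (Submodule ℝ Y)), (W : Set Y)) +
      Metric.closedBall (0 : Y) (C * R + 1))ᶜ : Set Y) ∈ grassmannFilter Y :=
    Filter.mem_generate_of_mem ⟨{LinearMap.ker f}, by simpa using hker, _,
      isCompact_closedBall _ _, rfl⟩
  filter_upwards [hmem] with y hy
  by_contra! hlt
  refine hy ?_
  have h1 : ‖(LinearMap.ker f).mkQ y‖ < C * R + 1 :=
    lt_of_le_of_lt ((hC y).trans (by gcongr; exact hlt.le)) (lt_add_one _)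
  obtain ⟨u, hu, z, hz, rfl⟩ := exists_mem_add_of_norm_mkQ_lt _ h1
  refine Set.add_mem_add ?_ (by simpa using hz.le)
  simpa using hu

theorem isEscaping_map_smul {Y : Submodule ℝ X} (hY : Module.finrank ℝ Y = 1) {y : X}
    (hy : y ∈ Y) (hy0 : y ≠ 0) : IsEscaping (map (fun t : ℝ => t • y) atTop) Y := by
  refine ⟨eventually_map.2 (Eventually.of_forall fun t => Y.smul_mem t hy), fun Z hZ => ?_⟩
  rw [tendsto_map'_iff]
  have hyZ : y ∉ Z := by
    refine fun h => hZ fun z hz => ?_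
    obtain ⟨c, hc⟩ := (finrank_eq_one_iff_of_nonzero' (⟨y, hy⟩ : Y)
      (by simpa [Subtype.ext_iff] using hy0)).1 hY ⟨z, hz⟩
    have : c • y = z := congrArg Subtype.val hc
    exact this ▸ Z.smul_mem c h
  have h0 : 0 < ‖Z.mkQ y‖ := norm_pos_iff.2 (by simpa using hyZ)
  refine (tendsto_id.atTop_mul_const h0).congr' ?_
  filter_upwards [eventually_ge_atTop 0] with t ht
  simp only [id, Function.comp, map_smul, norm_smul, Real.norm_of_nonneg ht]

end Escaping

/-! ### The morphisms `τ_Y`. -/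

section Tau

variable {X : Type*} [NormedAddCommGroup X] [InnerProductSpace ℝ X] [FiniteDimensional ℝ X]
  [MeasurableSpace X] [BorelSpace X]

theorem isTranslationAlgebra_univ :
    IsTranslationAlgebra (grassmannAlgebraOf (Set.univ : Set (Submodule ℝ X))) :=
  isTranslationAlgebra_grassmannAlgebraOf fun _ _ _ _ => Set.mem_univ _

theorem isTranslationAlgebra_Ici (Y : Submodule ℝ X) :
    IsTranslationAlgebra (grassmannAlgebraOf (Set.Ici Y)) :=
  isTranslationAlgebra_grassmannAlgebraOf fun _ h₁ _ h₂ => Set.mem_Ici.2 (le_inf h₁ h₂)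

variable (X) in
/-- The `C^*`-algebra `𝓖(X)`. -/
def quantumAlgebra : NonUnitalStarSubalgebra ℂ (BddOp X) :=
  crossedProductAlgebra (isTranslationAlgebra_univ (X := X))

/-- The `C^*`-algebra `𝓖_Y(X)`. -/
def quantumAlgebraOver (Y : Submodule ℝ X) : NonUnitalStarSubalgebra ℂ (BddOp X) :=
  crossedProductAlgebra (isTranslationAlgebra_Ici Y)

theorem mem_quantumAlgebra {T : BddOp X} :
    T ∈ quantumAlgebra X ↔ T ∈ crossedProduct (grassmannAlgebraOf (Set.univ : Set (Submodule ℝ X))) :=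
  Iff.rfl

theorem quantumAlgebraOver_le (Y : Submodule ℝ X) : quantumAlgebraOver Y ≤ quantumAlgebra X :=
  fun _ h => crossedProduct_mono (Set.subset_univ _) h

theorem isClosed_quantumAlgebra : IsClosed (quantumAlgebra X : Set (BddOp X)) :=
  isClosed_crossedProduct _

theorem exists_limitOp (Y : Submodule ℝ X) (T : quantumAlgebra X) :
    ∃ S ∈ quantumAlgebraOver Y, ∀ l : Filter X, IsEscaping l Y →
      LocTendsto (fun y => translate y (T : BddOp X)) l S := by
  obtain ⟨l, _, hl⟩ := exists_neBot_isEscaping Y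
  exact exists_limit l hl T.2

/-- The operator `lim U_y T U_y^*` along the filters escaping in `Y`. -/
def limitOp (Y : Submodule ℝ X) (T : quantumAlgebra X) : BddOp X :=
  (exists_limitOp Y T).choose

theorem limitOp_mem_over (Y : Submodule ℝ X) (T : quantumAlgebra X) :
    limitOp Y T ∈ quantumAlgebraOver Y :=
  (exists_limitOp Y T).choose_spec.1

theorem locTendsto_limitOp {Y : Submodule ℝ X} {l : Filter X} (hl : IsEscaping l Y)
    (T : quantumAlgebra X) : LocTendsto (fun y => translate y (T : BddOp X)) l (limitOp Y T) :=
  (exists_limitOp Y T).choose_spec.2 l hl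

/-- Strong limits suffice to identify `limitOp`, because a nontrivial escaping filter exists. -/
theorem limitOp_eq_of_forall_tendsto {Y : Submodule ℝ X} {T : quantumAlgebra X} {S : BddOp X}
    (h : ∀ l : Filter X, IsEscaping l Y → ∀ u : L2 X,
      Tendsto (fun y => translate y (T : BddOp X) u) l (𝓝 (S u))) : limitOp Y T = S := by
  obtain ⟨l, hl, hlY⟩ := exists_neBot_isEscaping Y
  ext1 u
  exact tendsto_nhds_unique
    ((locTendsto_limitOp hlY T).tendsto_apply (fun y => norm_translate_le y _) u) (h l hlY u)

theorem limitOp_eq_of_forall_locTendsto {Y : Submodule ℝ X} {T : quantumAlgebra X} {S : BddOp X}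
    (h : ∀ l : Filter X, IsEscaping l Y → LocTendsto (fun y => translate y (T : BddOp X)) l S) :
    limitOp Y T = S :=
  limitOp_eq_of_forall_tendsto fun l hl u =>
    (h l hl).tendsto_apply (fun y => norm_translate_le y _) u

theorem tendsto_translate_apply {Y : Submodule ℝ X} {l : Filter X} (hl : IsEscaping l Y)
    (T : quantumAlgebra X) (u : L2 X) :
    Tendsto (fun y => translate y (T : BddOp X) u) l (𝓝 (limitOp Y T u)) :=
  (locTendsto_limitOp hl T).tendsto_apply (fun y => norm_translate_le y _) u

theorem norm_limitOp_le (Y : Submodule ℝ X) (T : quantumAlgebra X) :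
    ‖limitOp Y T‖ ≤ ‖(T : BddOp X)‖ := by
  obtain ⟨l, hl, hlY⟩ := exists_neBot_isEscaping Y
  exact (locTendsto_limitOp hlY T).norm_le fun y => norm_translate_le y _

/-- Multiplication is jointly continuous for strong convergence on bounded families. -/
theorem limitOp_mul (Y : Submodule ℝ X) (S T : quantumAlgebra X) :
    limitOp Y (S * T) = limitOp Y S * limitOp Y T := by
  refine limitOp_eq_of_forall_tendsto fun l hl u => ?_
  have h1 := tendsto_translate_apply hl S (limitOp Y T u)
  have h2 : Tendsto (fun y => translate y (S : BddOp X)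
      (translate y (T : BddOp X) u - limitOp Y T u)) l (𝓝 0) := by
    have h3 := (tendsto_sub_nhds_zero_iff.2 (tendsto_translate_apply hl T u)).norm.const_mul
      ‖(S : BddOp X)‖
    rw [norm_zero, mul_zero] at h3
    exact squeeze_zero_norm (fun y => ContinuousLinearMap.le_of_opNorm_le _
      (norm_translate_le y _) _) h3
  have h3 := h2.add h1
  rw [zero_add] at h3
  refine h3.congr fun y => ?_
  rw [map_sub, sub_add_cancel]
  change _ = translate y ((S : BddOp X) * (T : BddOp X)) u
  rw [translate_mul]
  rfl

/-- The morphism `τ_Y`. -/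
def tau (Y : Submodule ℝ X) : quantumAlgebra X →⋆ₙₐ[ℂ] quantumAlgebra X where
  toFun T := ⟨limitOp Y T, quantumAlgebraOver_le Y (limitOp_mem_over Y T)⟩
  map_smul' c T := Subtype.ext <| limitOp_eq_of_forall_tendsto fun l hl u => by
    refine ((tendsto_translate_apply hl T u).const_smul c).congr fun y => ?_
    change _ = translate y (c • (T : BddOp X)) u
    rw [translate_smul]; rfl
  map_zero' := Subtype.ext <| limitOp_eq_of_forall_tendsto fun l hl u => by
    refine tendsto_const_nhds.congr fun y => ?_
    change _ = translate y (0 : BddOp X) u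
    simp [translate]
  map_add' S T := Subtype.ext <| limitOp_eq_of_forall_tendsto fun l hl u => by
    refine ((tendsto_translate_apply hl S u).add (tendsto_translate_apply hl T u)).congr
      fun y => ?_
    change _ = translate y ((S : BddOp X) + (T : BddOp X)) u
    rw [translate_add]; rfl
  map_mul' S T := Subtype.ext (limitOp_mul Y S T)
  -- Strong convergence does not pass to adjoints; the seminorms of `𝓒_s(X)` do, being symmetric in
  -- left and right multiplication by `θ(Q)`.
  map_star' T := Subtype.ext <| limitOp_eq_of_forall_locTendsto fun l hl θ => by
    have h := (locTendsto_limitOp hl T).adjoint θ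
    simp only [← translate_star] at h
    exact h

theorem tau_mem_over (Y : Submodule ℝ X) (T : quantumAlgebra X) :
    (tau Y T : BddOp X) ∈ quantumAlgebraOver Y :=
  limitOp_mem_over Y T

theorem locTendsto_tau {Y : Submodule ℝ X} {l : Filter X} (hl : IsEscaping l Y)
    (T : quantumAlgebra X) : LocTendsto (fun y => translate y (T : BddOp X)) l (tau Y T) :=
  locTendsto_limitOp hl T

theorem norm_tau_le (Y : Submodule ℝ X) (T : quantumAlgebra X) : ‖tau Y T‖ ≤ ‖T‖ :=
  norm_limitOp_le Y T

theorem continuous_tau (Y : Submodule ℝ X) : Continuous (tau Y) :=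
  AddMonoidHomClass.continuous_of_bound (tau Y) 1 fun T => by
    rw [one_mul]; exact norm_tau_le Y T

theorem tau_eq_of_forall_locTendsto {Y : Submodule ℝ X} {T S : quantumAlgebra X}
    (h : ∀ l : Filter X, IsEscaping l Y →
      LocTendsto (fun y => translate y (T : BddOp X)) l S) : tau Y T = S :=
  Subtype.ext (limitOp_eq_of_forall_locTendsto h)

theorem tau_of_mem_over {Y : Submodule ℝ X} {T : quantumAlgebra X}
    (hT : (T : BddOp X) ∈ quantumAlgebraOver Y) : tau Y T = T :=
  tau_eq_of_forall_locTendsto fun _ hl => locTendsto_of_mem_crossedProduct hl hT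

/-- The operator `φ(Q) ψ(P)` as an element of `𝓖(X)`. -/
def generator {Z : Submodule ℝ X} {φ : X →ᵇ ℂ} (hφ : φ ∈ quotientC0 Z) (ψ : C₀(X, ℂ)) :
    quantumAlgebra X :=
  ⟨mulOp φ * momentumOp ψ.toBCF, mul_mem_crossedProduct_grassmann (Set.mem_univ Z) hφ ψ⟩

theorem tau_generator_of_le {Y Z : Submodule ℝ X} (h : Y ≤ Z) {φ : X →ᵇ ℂ} (hφ : φ ∈ quotientC0 Z)
    (ψ : C₀(X, ℂ)) : tau Y (generator hφ ψ) = generator hφ ψ :=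
  tau_of_mem_over (mul_mem_crossedProduct_grassmann h hφ ψ)

theorem tau_generator_of_not_le {Y Z : Submodule ℝ X} (h : ¬ Y ≤ Z) {φ : X →ᵇ ℂ}
    (hφ : φ ∈ quotientC0 Z) (ψ : C₀(X, ℂ)) : tau Y (generator hφ ψ) = 0 :=
  tau_eq_of_forall_locTendsto fun _ hl => locTendsto_generator_zero (hl.tendsto Z h) hφ ψ

theorem mem_of_generator_mem {F : Set (Submodule ℝ X)} {V : Submodule ℂ (quantumAlgebra X)}
    (hV : IsClosed (V : Set (quantumAlgebra X)))
    (h : ∀ Z ∈ F, ∀ (φ : X →ᵇ ℂ) (hφ : φ ∈ quotientC0 Z) (ψ : C₀(X, ℂ)), generator hφ ψ ∈ V)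
    (T : quantumAlgebra X) (hT : (T : BddOp X) ∈ crossedProduct (grassmannAlgebraOf F)) :
    T ∈ V := by
  let ι : quantumAlgebra X →ₗ[ℂ] BddOp X :=
    (quantumAlgebra X).toNonUnitalSubalgebra.toSubmodule.subtype
  have hι : IsClosedEmbedding ι := isClosed_quantumAlgebra.isClosedEmbedding_subtypeVal
  have hVι : IsClosed (V.map ι : Set (BddOp X)) := by
    rw [Submodule.map_coe]
    exact hι.isClosedMap _ hV
  obtain ⟨S, hS, hST⟩ := crossedProduct_le_of_forall_mem hVι (F := F) (fun Z hZ φ hφ ψ =>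
    ⟨generator hφ ψ, h Z hZ φ hφ ψ, rfl⟩) hT
  obtain rfl : S = T := Subtype.ext hST
  exact hS

theorem eqOn_of_generator {F : Set (Submodule ℝ X)} {f g : quantumAlgebra X →ₗ[ℂ] quantumAlgebra X}
    (hf : Continuous f) (hg : Continuous g)
    (h : ∀ Z ∈ F, ∀ (φ : X →ᵇ ℂ) (hφ : φ ∈ quotientC0 Z) (ψ : C₀(X, ℂ)),
      f (generator hφ ψ) = g (generator hφ ψ)) (T : quantumAlgebra X)
    (hT : (T : BddOp X) ∈ crossedProduct (grassmannAlgebraOf F)) : f T = g T := by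
  have hV : IsClosed (LinearMap.ker (f - g) : Set (quantumAlgebra X)) :=
    isClosed_singleton.preimage (hf.sub hg)
  have h1 := mem_of_generator_mem hV (F := F)
    (fun Z hZ φ hφ ψ => by simpa [sub_eq_zero] using h Z hZ φ hφ ψ) T hT
  simpa [sub_eq_zero] using h1

theorem hom_ext_of_generator {f g : quantumAlgebra X →⋆ₙₐ[ℂ] quantumAlgebra X}
    (hf : Continuous f) (hg : Continuous g)
    (h : ∀ (Z : Submodule ℝ X) (φ : X →ᵇ ℂ) (hφ : φ ∈ quotientC0 Z) (ψ : C₀(X, ℂ)),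
      f (generator hφ ψ) = g (generator hφ ψ)) : f = g := by
  ext T : 1
  exact eqOn_of_generator (F := Set.univ) (f := ⟨⟨f, map_add f⟩, map_smul f⟩)
    (g := ⟨⟨g, map_add g⟩, map_smul g⟩) hf hg (fun Z _ => h Z) T T.2

/-- Both sides keep a generator over `W` exactly when `Y ≤ W` and `Z ≤ W`, that is when `Y ⊔ Z ≤ W`.
-/
theorem tau_comp (Y Z : Submodule ℝ X) : (tau Y).comp (tau Z) = tau (Y ⊔ Z) := by
  refine hom_ext_of_generator ((continuous_tau Y).comp (continuous_tau Z)) (continuous_tau _)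
    fun W φ hφ ψ => ?_
  rw [NonUnitalStarAlgHom.comp_apply]
  by_cases hZ : Z ≤ W
  · rw [tau_generator_of_le hZ]
    by_cases hY : Y ≤ W
    · rw [tau_generator_of_le hY, tau_generator_of_le (sup_le hY hZ)]
    · rw [tau_generator_of_not_le hY, tau_generator_of_not_le fun h => hY (le_sup_left.trans h)]
  · rw [tau_generator_of_not_le hZ, map_zero,
      tau_generator_of_not_le fun h => hZ (le_sup_right.trans h)]

end Tau

/-! ### A functional calculus cut-off. -/

section FunctionalCalculus

/-- With `S = T* T` the right side is `S (1 - f(S))²`, expanded so that every term makes sense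
without a unit. -/
theorem star_mul_self_sub_mul_cfcₙ {A : Type*} [NonUnitalCStarAlgebra A] (T : A) {f : ℂ → ℂ}
    (hf : Continuous f) (hf0 : f 0 = 0) (hfs : ∀ z, star (f z) = f z) :
    star (T - T * cfcₙ f (star T * T)) * (T - T * cfcₙ f (star T * T)) =
      cfcₙ (fun z => (z - f z * z) - (z * f z - f z * z * f z)) (star T * T) := by
  set S := star T * T with hS
  have hSn : IsStarNormal S := (IsSelfAdjoint.star_mul_self T).isStarNormal
  have hfS : star (cfcₙ f S) = cfcₙ f S := by
    rw [← cfcₙ_star]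
    exact congrArg (fun g => cfcₙ g S) (funext hfs)
  have c0 : Continuous fun z : ℂ => z := continuous_id
  have c1 : Continuous fun z => f z * z := hf.mul c0
  have c2 : Continuous fun z => z * f z := c0.mul hf
  have c3 : Continuous fun z => f z * z * f z := c1.mul hf
  have c4 : Continuous fun z => z - f z * z := c0.sub c1
  have c5 : Continuous fun z => z * f z - f z * z * f z := c2.sub c3
  have z1 : f 0 * 0 = 0 := mul_zero _
  have z2 : 0 * f 0 = 0 := zero_mul _
  have z3 : f 0 * 0 * f 0 = 0 := by rw [z1, zero_mul]
  have z4 : 0 - f 0 * 0 = 0 := by rw [z1, sub_zero]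
  have z5 : 0 * f 0 - f 0 * 0 * f 0 = 0 := by rw [z2, z3, sub_zero]
  rw [cfcₙ_sub (fun z => z - f z * z) (fun z => z * f z - f z * z * f z) S
      c4.continuousOn z4 c5.continuousOn z5,
    cfcₙ_sub (fun z => z) (fun z => f z * z) S c0.continuousOn rfl c1.continuousOn z1,
    cfcₙ_sub (fun z => z * f z) (fun z => f z * z * f z) S
      c2.continuousOn z2 c3.continuousOn z3,
    cfcₙ_mul (fun z => f z * z) f S c1.continuousOn z1 hf.continuousOn hf0,
    cfcₙ_mul f (fun z => z) S hf.continuousOn hf0 c0.continuousOn rfl,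
    cfcₙ_mul (fun z => z) f S c0.continuousOn rfl hf.continuousOn hf0,
    cfcₙ_id' ℂ S hSn, star_sub, star_mul, hfS, hS]
  simp only [mul_sub, sub_mul, mul_assoc]

open scoped CStarAlgebra in
/-- An element whose images under a family of morphisms have norm at most `ε` is at distance at
most `ε` from the intersection of the kernels. -/
theorem exists_norm_sub_le_of_forall_norm_le {A ι : Type*} {B : ι → Type*}
    [NonUnitalCStarAlgebra A] [∀ i, NonUnitalCStarAlgebra (B i)] (τ : ∀ i, A →⋆ₙₐ[ℂ] B i) {T : A}
    {ε : ℝ} (hε : 0 < ε) (h : ∀ i, ‖τ i T‖ ≤ ε) : ∃ H, ‖T - H‖ ≤ ε ∧ ∀ i, τ i H = 0 := by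
  -- This is `0` for `‖z‖ ≤ ε²` and `1 - ε² / ‖z‖` beyond. It vanishes on the spectrum of every `τ i
  -- S`, and `‖z‖ (1 - f z)²` never exceeds `ε²`.
  let f : ℂ → ℂ := fun z => ((max 0 (‖z‖ - ε ^ 2) / max ‖z‖ (ε ^ 2) : ℝ) : ℂ)
  have hpos : ∀ z : ℂ, max ‖z‖ (ε ^ 2) ≠ 0 := fun z =>
    (lt_of_lt_of_le (pow_pos hε 2) (le_max_right _ _)).ne'
  have hf : Continuous f := by
    refine Complex.continuous_ofReal.comp (Continuous.div (by fun_prop) (by fun_prop) hpos)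
  have hf0 : f 0 = 0 := by simp [f, max_eq_left (neg_nonpos.2 (sq_nonneg ε))]
  have hfs : ∀ z, ‖z‖ ≤ ε ^ 2 → f z = 0 := fun z hz => by simp [f, max_eq_left (sub_nonpos.2 hz)]
  set S := star T * T with hS
  have hSn : IsStarNormal S := (IsSelfAdjoint.star_mul_self T).isStarNormal
  refine ⟨T * cfcₙ f S, ?_, fun i => ?_⟩
  · have h1 := star_mul_self_sub_mul_cfcₙ T hf hf0 fun z => Complex.conj_ofReal _
    have h2 : ‖star (T - T * cfcₙ f S) * (T - T * cfcₙ f S)‖ ≤ ε ^ 2 := by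
      rw [h1]
      refine norm_cfcₙ_le fun z _ => ?_
      have h3 : (z - f z * z) - (z * f z - f z * z * f z) = z * (1 - f z) ^ 2 := by ring
      have h4 : 1 - f z =
          ((1 - max 0 (‖z‖ - ε ^ 2) / max ‖z‖ (ε ^ 2) : ℝ) : ℂ) := by simp [f]
      rw [h3, norm_mul, norm_pow, h4, Complex.norm_real, Real.norm_eq_abs, sq_abs]
      rcases le_total ‖z‖ (ε ^ 2) with hz | hz
      · rw [max_eq_left (sub_nonpos.2 hz)]
        simpa using hz
      · have hz0 : 0 < ‖z‖ := (pow_pos hε 2).trans_le hz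
        rw [max_eq_right (sub_nonneg.2 hz), max_eq_left hz]
        have h5 : 1 - (‖z‖ - ε ^ 2) / ‖z‖ = ε ^ 2 / ‖z‖ := by field_simp; ring
        rw [h5]
        have h6 : ‖z‖ * (ε ^ 2 / ‖z‖) ^ 2 = ε ^ 2 * (ε ^ 2 / ‖z‖) := by field_simp
        rw [h6]
        exact mul_le_of_le_one_right (sq_nonneg ε) ((div_le_one hz0).2 hz)
    rw [CStarRing.norm_star_mul_self, ← sq] at h2
    exact (pow_le_pow_iff_left₀ (norm_nonneg _) hε.le two_ne_zero).1 h2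
  · have hSi : τ i S = star (τ i T) * τ i T := by rw [hS, map_mul, map_star]
    have hSin : IsStarNormal (τ i S) := by
      rw [hSi]; exact (IsSelfAdjoint.star_mul_self _).isStarNormal
    have hc : Continuous (τ i) := map_continuous (τ i)
    rw [map_mul, (τ i).map_cfcₙ f S hf.continuousOn hf0 hc hSn hSin]
    -- `‖τ i S‖ = ‖τ i T‖² ≤ ε²`, so the quasispectrum lies where `f` vanishes.
    have h1 : cfcₙ f (τ i S) = cfcₙ (fun _ : ℂ => 0) (τ i S) := by
      refine cfcₙ_congr fun z hz => hfs z ?_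
      refine (NonUnitalIsometricContinuousFunctionalCalculus.norm_quasispectrum_le (τ i S) hz).trans
        ?_
      rw [hSi, CStarRing.norm_star_mul_self, ← sq]
      gcongr
      exact h i
    rw [h1, cfcₙ_const_zero, mul_zero]

end FunctionalCalculus

/-! ### The common kernel of the `τ_Y` is the ideal of compact operators. -/

section Compact

variable {X : Type*} [NormedAddCommGroup X] [InnerProductSpace ℝ X] [FiniteDimensional ℝ X]
  [MeasurableSpace X] [BorelSpace X]

theorem isClosed_crossedProductAlgebra {𝒜 : Submodule ℂ (X →ᵇ ℂ)} (h𝒜 : IsTranslationAlgebra 𝒜) :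
    IsClosed (crossedProductAlgebra h𝒜 : Set (BddOp X)) :=
  isClosed_crossedProduct 𝒜

/-- Subtracting `τ_Z` removes all components over subspaces containing `Z`, in particular the one
over `Z` itself, and keeps the others. -/
theorem sub_tau_mem_crossedProduct {F : Set (Submodule ℝ X)} (Z : Submodule ℝ X)
    (T : quantumAlgebra X)
    (hT : (T : BddOp X) ∈ crossedProduct (grassmannAlgebraOf F)) :
    ((T - tau Z T : quantumAlgebra X) : BddOp X) ∈ crossedProduct (grassmannAlgebraOf (F \ {Z})) := by
  let g : quantumAlgebra X →ₗ[ℂ] BddOp X :=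
    (quantumAlgebra X).toNonUnitalSubalgebra.toSubmodule.subtype ∘ₗ
      (LinearMap.id - ⟨⟨tau Z, map_add (tau Z)⟩, map_smul (tau Z)⟩)
  have hg : Continuous g := continuous_subtype_val.comp (continuous_id.sub (continuous_tau Z))
  let V : Submodule ℂ (quantumAlgebra X) := (crossedProduct (grassmannAlgebraOf (F \ {Z}))).comap g
  have hV : IsClosed (V : Set (quantumAlgebra X)) := (isClosed_crossedProduct _).preimage hg
  refine mem_of_generator_mem hV (F := F) (fun W hW φ hφ ψ => ?_) T hT
  change ((generator hφ ψ - tau Z (generator hφ ψ) : quantumAlgebra X) : BddOp X) ∈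
    crossedProduct (grassmannAlgebraOf (F \ {Z}))
  by_cases hZW : Z ≤ W
  · rw [tau_generator_of_le hZW, sub_self]
    exact (crossedProduct (grassmannAlgebraOf (F \ {Z}))).zero_mem
  · rw [tau_generator_of_not_le hZW, sub_zero]
    exact mul_mem_crossedProduct_grassmann (F := F \ {Z}) ⟨hW, fun h => hZW (h ▸ le_rfl)⟩ hφ ψ

/-- If `τ_Z T = 0` then `T = T - τ_Z T` needs no component over `Z`. Induction on the number of
nonzero subspaces in `F` leaves at most `⊥`. -/
theorem mem_crossedProduct_bot_of_finite {F : Set (Submodule ℝ X)} (hF : F.Finite)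
    (T : quantumAlgebra X) (hT : (T : BddOp X) ∈ crossedProduct (grassmannAlgebraOf F))
    (h : ∀ Z : Submodule ℝ X, Z ≠ ⊥ → tau Z T = 0) :
    (T : BddOp X) ∈ crossedProduct (grassmannAlgebraOf {(⊥ : Submodule ℝ X)}) := by
  induction hn : (F \ {⊥}).ncard generalizing F with
  | zero =>
    rw [Set.ncard_eq_zero hF.sdiff, Set.sdiff_eq_empty] at hn
    exact crossedProduct_mono hn hT
  | succ n ih =>
    have hne : (F \ {⊥}).Nonempty := by
      rw [← Set.ncard_pos hF.sdiff, hn]; exact n.succ_pos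
    obtain ⟨Z, hZ⟩ := hne
    have h1 := sub_tau_mem_crossedProduct Z T hT
    rw [h Z hZ.2, sub_zero] at h1
    refine ih (hF.sdiff (t := {Z})) h1 ?_
    have h2 : (F \ {Z}) \ {⊥} = (F \ {⊥}) \ {Z} := by
      rw [Set.sdiff_sdiff, Set.sdiff_sdiff, Set.union_comm]
    rw [h2, Set.ncard_sdiff_singleton_of_mem hZ, hn, Nat.add_sub_cancel]

/-- Finite families closed under intersection form a directed system, since the intersection closure
of a finite family is finite. Closedness under intersection makes the small crossed product an
algebra, so that the cut-off can be performed inside it. -/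
theorem exists_finite_norm_sub_lt (T : quantumAlgebra X) {ε : ℝ} (hε : 0 < ε) :
    ∃ F : Set (Submodule ℝ X), F.Finite ∧ InfClosed F ∧
      ∃ S ∈ crossedProduct (grassmannAlgebraOf F), ‖(T : BddOp X) - S‖ < ε := by
  let 𝓢 := {F : Set (Submodule ℝ X) // F.Finite ∧ InfClosed F}
  let V : Submodule ℂ (BddOp X) := ⨆ F : 𝓢, crossedProduct (grassmannAlgebraOf F.1)
  have : Nonempty 𝓢 := ⟨⟨∅, Set.finite_empty, infClosed_empty⟩⟩
  have hdir : Directed (· ≤ ·) fun F : 𝓢 => crossedProduct (grassmannAlgebraOf F.1) := by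
    intro F G
    refine ⟨⟨infClosure (F.1 ∪ G.1), (F.2.1.union G.2.1).infClosure, infClosed_infClosure⟩, ?_, ?_⟩
    · exact crossedProduct_mono (Set.subset_union_left.trans subset_infClosure)
    · exact crossedProduct_mono (Set.subset_union_right.trans subset_infClosure)
  have hT : (T : BddOp X) ∈ V.topologicalClosure := by
    refine crossedProduct_le_of_forall_mem V.isClosed_topologicalClosure
      (fun Z _ φ hφ ψ => V.le_topologicalClosure ?_) T.2
    refine Submodule.mem_iSup_of_mem (⟨{Z}, Set.finite_singleton Z, infClosed_singleton⟩ : 𝓢) ?_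
    exact mul_mem_crossedProduct_grassmann (Set.mem_singleton Z) hφ ψ
  obtain ⟨S, hS, hST⟩ := Metric.mem_closure_iff.1 hT ε hε
  obtain ⟨F, hF⟩ := (Submodule.mem_iSup_of_directed _ hdir).1 hS
  exact ⟨F.1, F.2.1, F.2.2, S, hF, by rwa [← dist_eq_norm]⟩

theorem exists_line_le {Z : Submodule ℝ X} (hZ : Z ≠ ⊥) : ∃ Y : Lines X, Y.1 ≤ Z := by
  obtain ⟨z, hz, hz0⟩ := Z.exists_mem_ne_zero_of_ne_bot hZ
  exact ⟨⟨Submodule.span ℝ {z}, finrank_span_singleton hz0⟩, by simpa using hz⟩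

/-- A nonzero `Z` contains a line `Y`, and then `τ_Z = τ_Z τ_Y`. -/
theorem tau_eq_zero_of_forall_line {T : quantumAlgebra X} (h : ∀ Y : Lines X, tau Y.1 T = 0)
    {Z : Submodule ℝ X} (hZ : Z ≠ ⊥) : tau Z T = 0 := by
  obtain ⟨Y, hY⟩ := exists_line_le hZ
  rw [← sup_eq_left.2 hY, ← tau_comp, NonUnitalStarAlgHom.comp_apply, h, map_zero]

theorem coe_inclusion {A B : NonUnitalStarSubalgebra ℂ (BddOp X)} (h : A ≤ B) (a : A) :
    ((NonUnitalStarSubalgebra.inclusion h a : B) : BddOp X) = a := rfl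

theorem exists_mem_norm_sub_le_of_forall_line (A : NonUnitalStarSubalgebra ℂ (BddOp X))
    [IsClosed (A : Set (BddOp X))] (hA : A ≤ quantumAlgebra X) (S : A) {ε : ℝ} (hε : 0 < ε)
    (h : ∀ Y : Lines X, ‖tau Y.1 (NonUnitalStarSubalgebra.inclusion hA S)‖ ≤ ε) :
    ∃ H : A, ‖(S : BddOp X) - H‖ ≤ ε ∧
      ∀ Y : Lines X, tau Y.1 (NonUnitalStarSubalgebra.inclusion hA H) = 0 := by
  have : IsClosed (quantumAlgebra X : Set (BddOp X)) := isClosed_quantumAlgebra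
  obtain ⟨H, hH, hH0⟩ := exists_norm_sub_le_of_forall_norm_le
    (fun Y : Lines X => (tau Y.1).comp (NonUnitalStarSubalgebra.inclusion hA)) hε h
  exact ⟨H, hH, hH0⟩

theorem crossedProductAlgebra_le_quantumAlgebra {F : Set (Submodule ℝ X)}
    (hF : IsTranslationAlgebra (grassmannAlgebraOf F)) :
    crossedProductAlgebra hF ≤ quantumAlgebra X :=
  fun _ h => crossedProduct_mono (Set.subset_univ F) h

theorem exists_mem_bot_norm_sub_le {F : Set (Submodule ℝ X)} (hF : F.Finite)
    (hFa : IsTranslationAlgebra (grassmannAlgebraOf F)) (S : crossedProductAlgebra hFa)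
    {ε : ℝ} (hε : 0 < ε) (h : ∀ Y : Lines X,
      ‖tau Y.1 (NonUnitalStarSubalgebra.inclusion
        (crossedProductAlgebra_le_quantumAlgebra hFa) S)‖ ≤ ε) :
    ∃ H ∈ crossedProduct (grassmannAlgebraOf {(⊥ : Submodule ℝ X)}), ‖(S : BddOp X) - H‖ ≤ ε := by
  have := isClosed_crossedProductAlgebra hFa
  obtain ⟨H, hH, hH0⟩ := exists_mem_norm_sub_le_of_forall_line (crossedProductAlgebra hFa)
    (crossedProductAlgebra_le_quantumAlgebra hFa) S hε h
  have hHF : (H : BddOp X) ∈ crossedProduct (grassmannAlgebraOf F) :=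
    H.2
  generalize hK : NonUnitalStarSubalgebra.inclusion
    (crossedProductAlgebra_le_quantumAlgebra hFa) H = K at hH0
  have hKH : (K : BddOp X) = H := by rw [← hK, coe_inclusion]
  rw [← hKH] at hHF hH
  exact ⟨K, mem_crossedProduct_bot_of_finite hF K hHF
    fun Z hZ => tau_eq_zero_of_forall_line hH0 hZ, hH⟩

theorem norm_tau_le_of_forall_line {T S : quantumAlgebra X} {ε : ℝ}
    (h : ∀ Y : Lines X, tau Y.1 T = 0) (hTS : ‖(T : BddOp X) - S‖ ≤ ε) (Y : Lines X) :
    ‖tau Y.1 S‖ ≤ ε := by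
  have h1 : tau Y.1 S = tau Y.1 (S - T) := by rw [map_sub, h Y, sub_zero]
  rw [h1]
  refine (norm_tau_le _ _).trans ?_
  rw [norm_sub_rev]
  exact hTS

/-- An approximation `S` of `T` over a finite family satisfies `τ_Y S = τ_Y (S - T)`, which is
small. The cut-off replaces `S` by a nearby `H` over the same finite family that is killed exactly.
-/
theorem mem_crossedProduct_bot_of_forall_line (T : quantumAlgebra X)
    (h : ∀ Y : Lines X, tau Y.1 T = 0) :
    (T : BddOp X) ∈ crossedProduct (grassmannAlgebraOf {(⊥ : Submodule ℝ X)}) := by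
  have hcl := isClosed_crossedProduct (grassmannAlgebraOf {(⊥ : Submodule ℝ X)})
  refine hcl.closure_subset (Metric.mem_closure_iff.2 fun ε hε => ?_)
  obtain ⟨F, hF, hFi, S, hS, hTS⟩ := exists_finite_norm_sub_lt T (ε := ε / 2) (half_pos hε)
  have hFa : IsTranslationAlgebra (grassmannAlgebraOf F) :=
    isTranslationAlgebra_grassmannAlgebraOf fun _ h₁ _ h₂ => hFi h₁ h₂
  have hS' : S ∈ crossedProductAlgebra hFa := hS
  have hTS' : ‖(T : BddOp X) - NonUnitalStarSubalgebra.inclusion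
    (crossedProductAlgebra_le_quantumAlgebra hFa) ⟨S, hS'⟩‖ ≤ ε / 2 := by
    rw [coe_inclusion]; exact hTS.le
  obtain ⟨H, hH, hSH⟩ := exists_mem_bot_norm_sub_le hF hFa ⟨S, hS'⟩ (half_pos hε)
    (norm_tau_le_of_forall_line h hTS')
  refine ⟨H, hH, ?_⟩
  rw [dist_eq_norm, ← sub_add_sub_cancel _ S]
  refine (norm_add_le _ _).trans_lt ?_
  have h2 : ‖S - (H : BddOp X)‖ ≤ ε / 2 := hSH
  linarith

theorem tau_eq_zero_of_mem_crossedProduct_bot {T : quantumAlgebra X}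
    (hT : (T : BddOp X) ∈ crossedProduct (grassmannAlgebraOf {(⊥ : Submodule ℝ X)}))
    {Y : Submodule ℝ X} (hY : Y ≠ ⊥) : tau Y T = 0 := by
  refine eqOn_of_generator (f := ⟨⟨tau Y, map_add (tau Y)⟩, map_smul (tau Y)⟩) (g := 0)
    (continuous_tau Y) continuous_zero (fun Z hZ φ hφ ψ => ?_) T hT
  rw [Set.mem_singleton_iff] at hZ
  exact tau_generator_of_not_le (fun h => hY (le_bot_iff.1 (hZ ▸ h))) hφ ψ

theorem isCompactOperator_iff_forall_line (T : quantumAlgebra X) :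
    IsCompactOperator (T : BddOp X) ↔ ∀ Y : Lines X, tau Y.1 T = 0 := by
  refine ⟨fun h Y => tau_eq_zero_of_mem_crossedProduct_bot
    (mem_crossedProduct_of_isCompactOperator h) ?_, fun h =>
      isCompactOperator_of_mem_crossedProduct (mem_crossedProduct_bot_of_forall_line T h)⟩
  intro hY
  have h1 := Y.2
  rw [hY, finrank_bot] at h1
  exact zero_ne_one h1

theorem mem_quantumAlgebra_of_isCompactOperator {T : BddOp X} (hT : IsCompactOperator T) :
    T ∈ quantumAlgebra X :=
  crossedProduct_mono (Set.subset_univ _) (mem_crossedProduct_of_isCompactOperator hT)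

end Compact

theorem norm_coe_subalgebra {R : Type*} [NonUnitalCStarAlgebra R]
    {A : NonUnitalStarSubalgebra ℂ R} (a : A) : ‖a‖ = ‖(a : R)‖ := rfl

/-! ### Uniqueness of the projection onto `𝓖_Y(X)`. -/

section Uniqueness

variable {X : Type*} [NormedAddCommGroup X] [InnerProductSpace ℝ X] [FiniteDimensional ℝ X]
  [MeasurableSpace X] [BorelSpace X]

theorem one_mem_quotientC0_top : (1 : X →ᵇ ℂ) ∈ quotientC0 (⊤ : Submodule ℝ X) := by
  refine mem_quotientC0_iff.2 ⟨fun _ _ _ => rfl, fun ε _ => ⟨0, fun x hx => ?_⟩⟩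
  have : (⊤ : Submodule ℝ X).mkQ x = 0 := by simp
  rw [this, norm_zero] at hx
  exact absurd hx (lt_irrefl 0)

theorem momentumOp_mem_over (Y : Submodule ℝ X) (ψ : C₀(X, ℂ)) :
    momentumOp ψ.toBCF ∈ quantumAlgebraOver Y := by
  have h : mulOp 1 * momentumOp ψ.toBCF ∈ quantumAlgebraOver Y :=
    mul_mem_crossedProduct_grassmann (F := Set.Ici Y) (Set.mem_Ici.2 le_top) one_mem_quotientC0_top ψ
  rwa [← mulOpHom_apply, map_one, one_mul] at h

/-- The operator `ψ(P)` as an element of `𝓖(X)`. -/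
def momentum (ψ : C₀(X, ℂ)) : quantumAlgebra X :=
  ⟨momentumOp ψ.toBCF, quantumAlgebraOver_le ⊥ (momentumOp_mem_over ⊥ ψ)⟩

/-- Multiplying a symbol by a character preserves decay. A translation next to some `ψ(P)` can thus
be absorbed, which makes `U_x` accessible to a morphism defined on `𝓖(X)` only. -/
theorem exists_momentumOp_mul_transOp (ψ : C₀(X, ℂ)) (x : X) :
    ∃ η : C₀(X, ℂ), momentumOp ψ.toBCF * transOp x = momentumOp η.toBCF := by
  have h : ψ.toBCF * charFun x ∈ quotientC0 (⊥ : Submodule ℝ X) := by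
    have h1 := mem_quotientC0_iff.1 (toBCF_mem_quotientC0_bot ψ)
    refine mem_quotientC0_iff.2 ⟨fun z y hy => by rw [(Submodule.mem_bot ℝ).1 hy, add_zero],
      fun ε hε => ?_⟩
    obtain ⟨R, hR⟩ := h1.2 ε hε
    refine ⟨R, fun z hz => ?_⟩
    rw [BoundedContinuousFunction.mul_apply, norm_mul]
    refine (mul_le_of_le_one_right (norm_nonneg _) ?_).trans_lt (hR z hz)
    exact ((charFun x).norm_coe_le_norm z).trans (norm_charFun_le x)
  obtain ⟨η, hη⟩ := exists_eq_toBCF_of_mem_quotientC0_bot h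
  refine ⟨η, ?_⟩
  rw [transOp_eq_momentumOp, ← hη]
  simp only [← momentumOpHom_apply, map_mul]

theorem continuous_translate (y : X) : Continuous (translate y) :=
  AddMonoidHomClass.continuous_of_bound (translateₗ y) 1 fun T => by
    rw [one_mul]; exact norm_translate_le y T

theorem translate_mem_crossedProduct {𝒜 : Submodule ℂ (X →ᵇ ℂ)} (h𝒜 : IsTranslationAlgebra 𝒜)
    (y : X) {T : BddOp X} (hT : T ∈ crossedProduct 𝒜) : translate y T ∈ crossedProduct 𝒜 := by
  have hcl : IsClosed {T : BddOp X | translate y T ∈ crossedProduct 𝒜} :=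
    (isClosed_crossedProduct 𝒜).preimage (continuous_translate y)
  refine crossedProduct_induction (p := fun T => translate y T ∈ crossedProduct 𝒜)
    (fun φ hφ ψ => ?_) ?_ (fun S T hS hT => ?_) (fun c T hT => ?_) hcl hT
  · rw [translate_generator]
    exact mul_mem_crossedProduct (h𝒜.shift_mem φ hφ y) ψ
  · have h : translate y (0 : BddOp X) = 0 := map_zero (translateₗ y)
    rw [h]
    exact Submodule.zero_mem _
  · rw [translate_add]
    exact Submodule.add_mem _ hS hT
  · rw [translate_smul]
    exact Submodule.smul_mem _ c hT

theorem translate_mem_quantumAlgebra (y : X) {T : BddOp X} (hT : T ∈ quantumAlgebra X) :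
    translate y T ∈ quantumAlgebra X :=
  mem_quantumAlgebra.2 (translate_mem_crossedProduct isTranslationAlgebra_univ y
    (mem_quantumAlgebra.1 hT))

theorem translate_eq_self_of_mem_over {Y : Submodule ℝ X} {y : X} (hy : y ∈ Y) {T : BddOp X}
    (hT : T ∈ quantumAlgebraOver Y) : translate y T = T := by
  have hc : Continuous (translateₗ y - LinearMap.id : BddOp X →ₗ[ℂ] BddOp X) :=
    (continuous_translate y).sub continuous_id
  have hV : IsClosed (LinearMap.ker (translateₗ y - LinearMap.id) : Set (BddOp X)) :=
    isClosed_singleton.preimage hc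
  have h := crossedProduct_le_of_forall_mem hV (F := Set.Ici Y) (fun Z hZ φ hφ ψ => ?_) hT
  · exact sub_eq_zero.1 h
  · refine LinearMap.mem_ker.2 (sub_eq_zero.2 ?_)
    change translate y (mulOp φ * momentumOp ψ.toBCF) = _
    rw [translate_generator, shift_eq_self hZ hφ hy]
    rfl

/-- After conjugation by the Fourier transform, suitable operators `θ(Q)` fix the compactly
supported vectors, which are dense. -/
theorem eq_zero_of_forall_mul_momentumOp {R : BddOp X}
    (h : ∀ ψ : C₀(X, ℂ), R * momentumOp ψ.toBCF = 0) : R = 0 := by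
  have h1 : ∀ θ : C₀(X, ℂ), R * star fourierOp * mulOp θ.toBCF = 0 := by
    intro θ
    have h2 := h θ
    rw [momentumOp_eq] at h2
    calc _ = R * (star fourierOp * mulOp θ.toBCF * fourierOp) * star fourierOp := by
          rw [← mul_assoc, ← mul_assoc, mul_assoc _ fourierOp, fourierOp_mul_star, mul_one]
      _ = 0 := by rw [h2, zero_mul]
  have h3 : R * star fourierOp = 0 := by
    ext1 u
    refine dense_compactlySupportedL2.induction
      (P := fun u => (R * star fourierOp : BddOp X) u = (0 : BddOp X) u) ?_
      (isClosed_eq (R * star fourierOp : BddOp X).continuous (0 : BddOp X).continuous) u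
    rintro _ ⟨a, ha, rfl⟩
    obtain ⟨θ, hθ⟩ := exists_mulOp_compactlySupportedL2_eq a ha
    have h4 := congrArg (fun T : BddOp X => T (compactlySupportedL2 a ha)) (h1 θ)
    change (R * star fourierOp : BddOp X) (mulOp θ.toBCF (compactlySupportedL2 a ha)) = 0 at h4
    rw [hθ] at h4
    exact h4
  rw [← mul_one R, ← star_fourierOp_mul, ← mul_assoc, h3, zero_mul]

theorem eq_zero_of_forall_momentumOp_mul_mul {R : BddOp X}
    (h : ∀ ψ ψ' : C₀(X, ℂ), momentumOp ψ'.toBCF * R * momentumOp ψ.toBCF = 0) : R = 0 := by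
  have h1 : ∀ ψ' : C₀(X, ℂ), momentumOp ψ'.toBCF * R = 0 := fun ψ' =>
    eq_zero_of_forall_mul_momentumOp fun ψ => h ψ ψ'
  rw [← star_eq_zero]
  refine eq_zero_of_forall_mul_momentumOp fun ψ => ?_
  have h2 := h1 (star ψ)
  have h3 : (star ψ : C₀(X, ℂ)).toBCF = star ψ.toBCF := rfl
  rw [h3, ← momentumOpHom_apply, map_star, momentumOpHom_apply] at h2
  rw [← star_eq_zero, star_mul, star_star, h2]

/-- The operator `U_y T U_y^*` as an element of `𝓖(X)`. -/
def translateElem (y : X) (T : quantumAlgebra X) : quantumAlgebra X :=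
  ⟨translate y T, translate_mem_quantumAlgebra y T.2⟩

/-- `P` fixes every `ψ(P)`. Sandwiched between two of these, `U_y` and its adjoint are absorbed into
new symbols, which `P` also fixes. -/
theorem map_translateElem {Y : Submodule ℝ X} {P : quantumAlgebra X →⋆ₙₐ[ℂ] quantumAlgebra X}
    (hfix : ∀ T : quantumAlgebra X, (T : BddOp X) ∈ quantumAlgebraOver Y → P T = T)
    (hran : ∀ T, (P T : BddOp X) ∈ quantumAlgebraOver Y) {y : X} (hy : y ∈ Y)
    (T : quantumAlgebra X) : P (translateElem y T) = P T := by
  have hm : ∀ ψ, P (momentum ψ) = momentum ψ := fun ψ => hfix _ (momentumOp_mem_over Y ψ)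
  rw [← sub_eq_zero]
  refine Subtype.ext (eq_zero_of_forall_momentumOp_mul_mul fun ψ ψ' => ?_)
  obtain ⟨η, hη⟩ := exists_momentumOp_mul_transOp ψ (-y)
  obtain ⟨η', hη'⟩ := exists_momentumOp_mul_transOp ψ' y
  have hη2 : star (transOp y) * momentumOp ψ.toBCF = momentumOp η.toBCF := by
    rw [star_transOp, transOp_mul_momentumOp, hη]
  have key : ∀ S : BddOp X, momentumOp ψ'.toBCF * translate y S * momentumOp ψ.toBCF =
      momentumOp η'.toBCF * S * momentumOp η.toBCF := by
    intro S
    rw [← hη', ← hη2, translate]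
    simp only [mul_assoc]
  have h1 : momentum ψ' * translateElem y T * momentum ψ = momentum η' * T * momentum η :=
    Subtype.ext (key T)
  have h2 := congrArg P h1
  simp only [map_mul, hm] at h2
  have h3 : momentumOp ψ'.toBCF * (P (translateElem y T) : BddOp X) * momentumOp ψ.toBCF =
      momentumOp η'.toBCF * (P T : BddOp X) * momentumOp η.toBCF := congrArg Subtype.val h2
  -- The translation reappears around `P T`, where it acts trivially because `P T` lies in `𝓖_Y(X)`.
  rw [← key, translate_eq_self_of_mem_over hy (hran T)] at h3
  change momentumOp ψ'.toBCF * ((P (translateElem y T) : BddOp X) - (P T : BddOp X)) *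
    momentumOp ψ.toBCF = 0
  rw [mul_sub, sub_mul, h3, sub_self]

/-- Translates along a vector of `Y` outside `Z`, spaced so widely that at each point at most one of
them can exceed `ε`. -/
theorem exists_norm_sum_shift_le {Y Z : Submodule ℝ X} (hYZ : ¬ Y ≤ Z) {φ : X →ᵇ ℂ}
    (hφ : φ ∈ quotientC0 Z) {ε : ℝ} (hε : 0 < ε) : ∃ x : ℕ → X, (∀ n, x n ∈ Y) ∧
      ∀ N : ℕ, ‖∑ n ∈ Finset.range N, shift (x n) φ‖ ≤ N * ε + ‖φ‖ := by
  obtain ⟨y, hy, hyZ⟩ := Set.not_subset.1 hYZ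
  obtain ⟨R, hR⟩ := (mem_quotientC0_iff.1 hφ).2 ε hε
  have hδ : 0 < ‖Z.mkQ y‖ := norm_pos_iff.2 (by simpa using hyZ)
  -- Two points within `R` of `0` modulo `Z` differ by at most `2 R`, so this spacing separates the
  -- translates.
  obtain ⟨t, ht⟩ : ∃ t : ℝ, 2 * R < t * ‖Z.mkQ y‖ ∧ 0 < t := by
    refine ⟨(2 * |R| + 1) / ‖Z.mkQ y‖, ?_, by positivity⟩
    rw [div_mul_cancel₀ _ hδ.ne']
    linarith [le_abs_self R]
  refine ⟨fun n => ((n : ℝ) * t) • y, fun n => Y.smul_mem _ hy, fun N => ?_⟩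
  refine (BoundedContinuousFunction.norm_le (by positivity)).2 fun x => ?_
  have hfar : ∀ m n : ℕ, ‖Z.mkQ (((m : ℝ) * t) • y + x)‖ ≤ R →
      ‖Z.mkQ (((n : ℝ) * t) • y + x)‖ ≤ R → m = n := by
    intro m n hm hn
    by_contra hmn
    have h1 : (1 : ℝ) ≤ |(m : ℝ) - n| := by
      have : (1 : ℤ) ≤ |(m : ℤ) - n| := Int.one_le_abs (by omega)
      exact_mod_cast this
    have h2 := norm_sub_le (Z.mkQ (((m : ℝ) * t) • y + x)) (Z.mkQ (((n : ℝ) * t) • y + x))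
    rw [← map_sub, add_sub_add_right_eq_sub, ← sub_smul, ← sub_mul, map_smul, norm_smul,
      Real.norm_eq_abs, abs_mul, abs_of_pos ht.2] at h2
    have h3 : t * ‖Z.mkQ y‖ ≤ |(m : ℝ) - n| * (t * ‖Z.mkQ y‖) :=
      le_mul_of_one_le_left (mul_pos ht.2 hδ).le h1
    rw [← mul_assoc] at h3
    linarith [ht.1]
  have hb : ∃ n₀ : ℕ, ∀ n : ℕ, ‖φ (((n : ℝ) * t) • y + x)‖ ≤ ε + if n = n₀ then ‖φ‖ else 0 := by
    by_cases hex : ∃ n₀ : ℕ, ‖Z.mkQ (((n₀ : ℝ) * t) • y + x)‖ ≤ R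
    · obtain ⟨n₀, hn₀⟩ := hex
      refine ⟨n₀, fun n => ?_⟩
      split_ifs with h
      · exact (φ.norm_coe_le_norm _).trans (le_add_of_nonneg_left hε.le)
      · rw [add_zero]
        exact (hR _ (not_le.1 fun h1 => h (hfar n n₀ h1 hn₀))).le
    · push Not at hex
      refine ⟨0, fun n => (hR _ (hex n)).le.trans (le_add_of_nonneg_right ?_)⟩
      split_ifs <;> positivity
  obtain ⟨n₀, hn₀⟩ := hb
  have h1 : (∑ n ∈ Finset.range N, shift (((n : ℝ) * t) • y) φ) x =
      ∑ n ∈ Finset.range N, φ (((n : ℝ) * t) • y + x) := by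
    simp
  rw [h1]
  refine (norm_sum_le_of_le _ fun n _ => hn₀ n).trans ?_
  rw [Finset.sum_add_distrib, Finset.sum_const, Finset.card_range, nsmul_eq_mul,
    Finset.sum_ite_eq']
  split_ifs
  · exact le_rfl
  · linarith [norm_nonneg φ]

theorem norm_map_le (P : quantumAlgebra X →⋆ₙₐ[ℂ] quantumAlgebra X) (T : quantumAlgebra X) :
    ‖P T‖ ≤ ‖T‖ :=
  have : IsClosed (quantumAlgebra X : Set (BddOp X)) := isClosed_quantumAlgebra
  NonUnitalStarAlgHom.norm_apply_le P T

/-- `P` takes the same value on all translates along `Y`, so it maps the sum of `N` of them to `N`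
times that value. Being contractive, it cannot do so for large `N` unless the value is `0`. -/
theorem map_generator_eq_zero {Y Z : Submodule ℝ X} (hYZ : ¬ Y ≤ Z)
    {P : quantumAlgebra X →⋆ₙₐ[ℂ] quantumAlgebra X}
    (hfix : ∀ T : quantumAlgebra X, (T : BddOp X) ∈ quantumAlgebraOver Y → P T = T)
    (hran : ∀ T, (P T : BddOp X) ∈ quantumAlgebraOver Y) {φ : X →ᵇ ℂ} (hφ : φ ∈ quotientC0 Z)
    (ψ : C₀(X, ℂ)) : P (generator hφ ψ) = 0 := by
  have : IsClosed (quantumAlgebra X : Set (BddOp X)) := isClosed_quantumAlgebra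
  by_contra hne
  have ha : 0 < ‖P (generator hφ ψ)‖ := norm_pos_iff.2 hne
  set a := ‖P (generator hφ ψ)‖
  set c := ‖momentumOp ψ.toBCF‖
  have hc : 0 ≤ c := norm_nonneg _
  -- With this `ε` the linear term is at most `N a / 2`, so `N a ≤ N a / 2 + ‖φ‖ c`, which fails for
  -- large `N`.
  obtain ⟨x, hxY, hx⟩ := exists_norm_sum_shift_le hYZ hφ (ε := a / (2 * (c + 1))) (by positivity)
  have key : ∀ N : ℕ, N * a ≤ (N * (a / (2 * (c + 1))) + ‖φ‖) * c := by
    intro N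
    have h1 : P (∑ n ∈ Finset.range N, translateElem (x n) (generator hφ ψ)) =
        (N : ℂ) • P (generator hφ ψ) := by
      rw [map_sum, Finset.sum_congr rfl fun n _ => map_translateElem hfix hran (hxY n) _,
        Finset.sum_const, Finset.card_range, Nat.cast_smul_eq_nsmul]
    have h2 := norm_map_le P
      (∑ n ∈ Finset.range N, translateElem (x n) (generator hφ ψ))
    rw [h1, norm_smul, Complex.norm_natCast] at h2
    have h3 : ((∑ n ∈ Finset.range N, translateElem (x n) (generator hφ ψ) : quantumAlgebra X) :
        BddOp X) = mulOp (∑ n ∈ Finset.range N, shift (x n) φ) * momentumOp ψ.toBCF := by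
      rw [← mulOpHom_apply, map_sum, Finset.sum_mul, AddSubmonoidClass.coe_finsetSum]
      exact Finset.sum_congr rfl fun n _ => translate_generator _ _ _
    have h4 : ‖(∑ n ∈ Finset.range N, translateElem (x n) (generator hφ ψ) : quantumAlgebra X)‖ ≤
        (N * (a / (2 * (c + 1))) + ‖φ‖) * c := by
      rw [norm_coe_subalgebra, h3]
      refine (norm_mul_le _ _).trans ?_
      gcongr
      exact (norm_mulOp_le _).trans (hx N)
    exact h2.trans h4
  obtain ⟨N, hN⟩ := exists_nat_gt (2 * (‖φ‖ * c) / a)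
  rw [div_lt_iff₀ ha] at hN
  have h5 := key N
  have h6 : a / (2 * (c + 1)) * c ≤ a / 2 := by
    rw [div_mul_eq_mul_div, div_le_div_iff₀ (by positivity) two_pos]
    nlinarith
  have h7 : (N : ℝ) * (a / (2 * (c + 1)) * c) ≤ N * (a / 2) := by gcongr
  linarith

theorem eq_tau_iff (Y : Submodule ℝ X) (P : quantumAlgebra X →⋆ₙₐ[ℂ] quantumAlgebra X) :
    ((∀ T, P (P T) = P T) ∧
      Set.range (fun T => (P T : BddOp X)) = quantumAlgebraOver Y) ↔ P = tau Y := by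
  constructor
  · rintro ⟨hP, hr⟩
    have hran : ∀ T, (P T : BddOp X) ∈ quantumAlgebraOver Y := fun T => by
      rw [← SetLike.mem_coe, ← hr]; exact Set.mem_range_self T
    have hfix : ∀ T : quantumAlgebra X, (T : BddOp X) ∈ quantumAlgebraOver Y → P T = T := by
      intro T hT
      rw [← SetLike.mem_coe, ← hr] at hT
      obtain ⟨S, hS⟩ := hT
      obtain rfl : P S = T := Subtype.ext hS
      exact hP S
    have hc : Continuous P := AddMonoidHomClass.continuous_of_bound P 1 fun T => by
      rw [one_mul]; exact norm_map_le P T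
    refine hom_ext_of_generator hc (continuous_tau Y) fun Z φ hφ ψ => ?_
    by_cases hYZ : Y ≤ Z
    · rw [tau_generator_of_le hYZ]
      exact hfix _ (mul_mem_crossedProduct_grassmann hYZ hφ ψ)
    · rw [tau_generator_of_not_le hYZ]
      exact map_generator_eq_zero hYZ hfix hran hφ ψ
  · rintro rfl
    refine ⟨fun T => tau_of_mem_over (tau_mem_over Y T), Set.Subset.antisymm ?_ fun T hT => ?_⟩
    · rintro _ ⟨T, rfl⟩
      exact tau_mem_over Y T
    · exact ⟨⟨T, quantumAlgebraOver_le Y hT⟩, congrArg Subtype.val (tau_of_mem_over hT)⟩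

end Uniqueness

/-! ### Convergence in `𝓒_s(X)` and the embedding of the quotient. -/

section Quotient

variable {X : Type*} [NormedAddCommGroup X] [InnerProductSpace ℝ X] [FiniteDimensional ℝ X]
  [MeasurableSpace X] [BorelSpace X]

theorem tendstoCs_tau {α : Type*} {Y : Submodule ℝ X} {l : Filter α} {f : α → X}
    (hl : IsEscaping (map f l) Y) (T : quantumAlgebra X) :
    TendstoCs (fun a => translate (f a) (T : BddOp X)) l (tau Y T) :=
  tendstoCs_of_locTendsto
    (fun a => crossedProduct_subset_hamAlgebra isTranslationAlgebra_univ
      (translate_mem_quantumAlgebra (f a) T.2))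
    (crossedProduct_subset_hamAlgebra isTranslationAlgebra_univ (tau Y T).2) fun θ =>
      ⟨tendsto_map'_iff.1 (locTendsto_tau hl T θ).1, tendsto_map'_iff.1 (locTendsto_tau hl T θ).2⟩

/-- A morphism with values in a smaller subalgebra. -/
def codRestrictHom {A : NonUnitalStarSubalgebra ℂ (BddOp X)} (t : A →⋆ₙₐ[ℂ] A) (C : NonUnitalStarSubalgebra ℂ (BddOp X))
    (ht : ∀ T, (t T : BddOp X) ∈ C) : A →⋆ₙₐ[ℂ] C where
  toFun T := ⟨t T, ht T⟩
  map_smul' c T := Subtype.ext (congrArg (fun a : A => (a : BddOp X)) (map_smul t c T))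
  map_zero' := Subtype.ext (congrArg (fun a : A => (a : BddOp X)) (map_zero t))
  map_add' S T := Subtype.ext (congrArg (fun a : A => (a : BddOp X)) (map_add t S T))
  map_mul' S T := Subtype.ext (congrArg (fun a : A => (a : BddOp X)) (map_mul t S T))
  map_star' T := Subtype.ext (congrArg (fun a : A => (a : BddOp X)) (map_star t T))

/-- A family of morphisms as a morphism to the algebra of bounded families. -/
def familyHom {ι A : Type*} {B : ι → Type*} [NonUnitalCStarAlgebra A]
    [∀ i, NonUnitalCStarAlgebra (B i)] (t : ∀ i, A →⋆ₙₐ[ℂ] B i) : A →⋆ₙₐ[ℂ] lp B ∞ where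
  toFun T := ⟨fun i => t i T, memℓp_infty ⟨‖T‖, by
    rintro _ ⟨i, rfl⟩; exact NonUnitalStarAlgHom.norm_apply_le (t i) T⟩⟩
  map_smul' c T := lp.ext <| funext fun i => map_smul (t i) c T
  map_zero' := lp.ext <| funext fun i => map_zero (t i)
  map_add' S T := lp.ext <| funext fun i => map_add (t i) S T
  map_mul' S T := lp.ext <| funext fun i => map_mul (t i) S T
  map_star' T := lp.ext <| funext fun i => map_star (t i) T

/-- One inequality holds because the family is contractive on every representative of the class. The
other is the cut-off, which finds an element of `K` nearly as close to `T` as the supremum of the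
`‖t i T‖` allows. -/
theorem norm_familyHom_eq {ι A : Type*} {B : ι → Type*} [NonUnitalCStarAlgebra A]
    [∀ i, NonUnitalCStarAlgebra (B i)] (t : ∀ i, A →⋆ₙₐ[ℂ] B i) {K : Submodule ℂ A}
    (hK : ∀ T, T ∈ K ↔ ∀ i, t i T = 0) (T : A) : ‖familyHom t T‖ = ‖K.mkQ T‖ := by
  refine le_antisymm (le_of_forall_pos_le_add fun δ hδ => ?_)
    (le_of_forall_pos_le_add fun δ hδ => ?_)
  · obtain ⟨S, hS, hSn⟩ := Submodule.Quotient.norm_mk_lt (K.mkQ T) hδ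
    have h1 : T - S ∈ K := (Submodule.Quotient.eq _).1 hS.symm
    have h2 : familyHom t T = familyHom t S := by
      rw [← sub_eq_zero, ← map_sub]
      exact lp.ext <| funext fun i => (hK _).1 h1 i
    rw [h2]
    exact (NonUnitalStarAlgHom.norm_apply_le (familyHom t) S).trans hSn.le
  -- The `δ` keeps the threshold positive when the supremum is `0`.
  · obtain ⟨H, hH, hH0⟩ := exists_norm_sub_le_of_forall_norm_le t
      (T := T) (ε := ‖familyHom t T‖ + δ) (add_pos_of_nonneg_of_pos (norm_nonneg _) hδ)
      fun i => (lp.norm_apply_le_norm ENNReal.top_ne_zero (familyHom t T) i).trans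
        (le_add_of_nonneg_right hδ.le)
    have h1 : K.mkQ T = K.mkQ (T - H) := by
      rw [map_sub, Submodule.mkQ_apply _ H, (Submodule.Quotient.mk_eq_zero _).2 ((hK H).2 hH0),
        sub_zero]
    rw [h1]
    exact (Submodule.Quotient.norm_mk_le _ _).trans hH

theorem exists_quotient_embedding_lp {ι A : Type*} {B : ι → Type*} [NonUnitalCStarAlgebra A]
    [∀ i, NonUnitalCStarAlgebra (B i)] (t : ∀ i, A →⋆ₙₐ[ℂ] B i) {K : Submodule ℂ A}
    (hK : ∀ T, T ∈ K ↔ ∀ i, t i T = 0) :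
    ∃ j : (A ⧸ K) →ₗᵢ[ℂ] lp B ∞, ∀ T, j (K.mkQ T) = familyHom t T := by
  let f : A →ₗ[ℂ] lp B ∞ := ⟨⟨familyHom t, map_add (familyHom t)⟩, map_smul (familyHom t)⟩
  refine ⟨⟨K.liftQ f fun T hT => lp.ext <| funext fun i => (hK T).1 hT i, fun q => ?_⟩,
    fun T => rfl⟩
  obtain ⟨T, rfl⟩ := K.mkQ_surjective q
  exact norm_familyHom_eq t hK T

set_option maxHeartbeats 1000000 in
theorem exists_quotient_embedding {ι : Type*} {A : NonUnitalStarSubalgebra ℂ (BddOp X)}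
    (hA : IsClosed (A : Set (BddOp X))) {B : ι → NonUnitalStarSubalgebra ℂ (BddOp X)}
    (hB : ∀ i, IsClosed (B i : Set (BddOp X)))
    (t : ι → (A →⋆ₙₐ[ℂ] A)) (ht : ∀ i T, (t i T : BddOp X) ∈ B i) {K : Submodule ℂ A}
    (hK : ∀ T, T ∈ K ↔ ∀ i, t i T = 0) :
    ∃ j : (A ⧸ K) →ₗᵢ[ℂ] lp (fun i => B i) ∞,
      (∀ (T : A) (i : ι), (j (K.mkQ T) i : BddOp X) = (t i T : BddOp X)) ∧
      (∀ S T : A, j (K.mkQ (S * T)) = j (K.mkQ S) * j (K.mkQ T)) ∧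
      (∀ (T : A) (i : ι), j (K.mkQ (star T)) i = star (j (K.mkQ T) i)) := by
  have hK' : ∀ T, T ∈ K ↔ ∀ i, codRestrictHom (t i) (B i) (ht i) T = 0 := fun T =>
    (hK T).trans (forall_congr' fun i => by
      rw [Subtype.ext_iff, Subtype.ext_iff]; rfl)
  obtain ⟨j, hj⟩ := exists_quotient_embedding_lp (B := fun i => B i)
    (fun i => codRestrictHom (t i) (B i) (ht i)) hK'
  refine ⟨j, fun T i => ?_, fun S T => ?_, fun T i => ?_⟩
  · rw [hj]; rfl
  · rw [hj, hj, hj, map_mul]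
  · rw [hj, hj, map_star]; rfl

end Quotient

end QuantumGrassmann

end

open QuantumGrassmann in
theorem mainTheorem9 {X : Type*} [NormedAddCommGroup X] [InnerProductSpace ℝ X]
    [FiniteDimensional ℝ X] [MeasurableSpace X] [BorelSpace X] :
    -- `𝓖(X)` and the `𝓖_Y(X)` are `C^*`-algebras, and `𝓖_Y(X) ⊆ 𝓖(X)`
    ∃ (𝓖 : NonUnitalStarSubalgebra ℂ (BddOp X))
      (𝓖sub : Submodule ℝ X → NonUnitalStarSubalgebra ℂ (BddOp X)),
      (𝓖 : Set (BddOp X)) = quantumGrassmann X ∧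
      (∀ Y, (𝓖sub Y : Set (BddOp X)) = quantumGrassmannOver Y) ∧
      (∀ Y, 𝓖sub Y ≤ 𝓖) ∧
      ∃ τ : Submodule ℝ X → (𝓖 →⋆ₙₐ[ℂ] 𝓖),
        -- `τ_Y T` is the limit of `U_y T U_y^*` along the Grassmann filter of `Y`
        (∀ (Y : Submodule ℝ X) (T : 𝓖),
          TendstoCs (fun y : X => translate y (T : BddOp X)) (grassmannFilterOn Y) (τ Y T)) ∧
        -- `τ_Y` is a linear projection of `𝓖(X)` onto `𝓖_Y(X)`, and is the only such morphism
        (∀ (Y : Submodule ℝ X) (P : 𝓖 →⋆ₙₐ[ℂ] 𝓖),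
          ((∀ T, P (P T) = P T) ∧ Set.range (fun T => (P T : BddOp X)) = 𝓖sub Y) ↔ P = τ Y) ∧
        (∀ Y Z : Submodule ℝ X, (τ Y).comp (τ Z) = τ (Y ⊔ Z) ∧ (τ Z).comp (τ Y) = τ (Y ⊔ Z)) ∧
        (∀ (Y : Lines X) (y : X), y ∈ Y.1 → y ≠ 0 → ∀ T : 𝓖,
          TendstoCs (fun t : ℝ => translate (t • y) (T : BddOp X)) atTop (τ Y.1 T)) ∧
        (∀ T : 𝓖, IsCompactOperator (T : BddOp X) ↔ ∀ Y : Lines X, τ Y.1 T = 0) ∧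
        -- all compact operators belong to `𝓖(X)`, and the embedding of the quotient
        (∀ T : BddOp X, IsCompactOperator T → T ∈ 𝓖) ∧
        ∃ j : (𝓖 ⧸ compactPart 𝓖) →ₗᵢ[ℂ] lp (fun Y : Lines X => 𝓖sub Y.1) ∞,
          (∀ (T : 𝓖) (Y : Lines X),
            (j ((compactPart 𝓖).mkQ T) Y : BddOp X) = (τ Y.1 T : BddOp X)) ∧
          (∀ S T : 𝓖, j ((compactPart 𝓖).mkQ (S * T)) =
            j ((compactPart 𝓖).mkQ S) * j ((compactPart 𝓖).mkQ T)) ∧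
          (∀ (T : 𝓖) (Y : Lines X),
            j ((compactPart 𝓖).mkQ (star T)) Y = star (j ((compactPart 𝓖).mkQ T) Y)) := by
  refine ⟨quantumAlgebra X, quantumAlgebraOver, ?_, fun Y => ?_, quantumAlgebraOver_le, tau,
    fun Y T => tendstoCs_tau (l := grassmannFilterOn Y) (f := fun y => y)
      (by rw [map_id']; exact isEscaping_grassmannFilterOn Y) T, eq_tau_iff,
    fun Y Z => ⟨tau_comp Y Z, ?_⟩, fun Y y hy hy0 T => ?_, isCompactOperator_iff_forall_line,
    fun T => mem_quantumAlgebra_of_isCompactOperator, ?_⟩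
  · rw [quantumGrassmann, grassmannAlgebra_eq]; rfl
  · rw [quantumGrassmannOver, grassmannAlgebraOver_eq]; rfl
  · rw [tau_comp, sup_comm]
  · exact tendstoCs_tau (isEscaping_map_smul Y.2 hy hy0) T
  · exact exists_quotient_embedding isClosed_quantumAlgebra
      (fun Y => isClosed_crossedProduct _) (fun Y : Lines X => tau Y.1) (fun Y => tau_mem_over Y.1)
      isCompactOperator_iff_forall_line
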